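/- Work over the category $\mathrm{CGTop}$ of compactly generated Hausdorff spaces with the open-cover topology; all fibre products of spaces, topological groupoids $[R\rightrightarrows X]$ and principal bundles are taken in $\mathrm{CGTop}$. For a topological groupoid $\mathcal G$ let $B\mathcal G$ be the category fibred in groupoids of principal $\mathcal G$-bundles (whose projection admits local sections). A topological stack is a stack of groupoids $\mathcal D$ over $\mathrm{CGTop}$ with $B\mathcal G\simeq\mathcal D$ (over $\mathrm{CGTop}$) for some topological groupoid $\mathcal G$; morphisms of stacks are morphisms of the fibred categories over $\mathrm{CGTop}$. A continuous map $f\colon A\to B$ is locally a Hurewicz (respectively, Serre) fibration if every $a\in A$ has an open neighbourhood $U$ such that $f$ restricts to a map $U\to V$, for some open $V\subseteq B$, having the homotopy lifting property with respect to all spaces in $\mathrm{CGTop}$ (respectively, all cubes $[0,1]^n$, $n\ge 0$). A topological stack $\mathcal D$ is a Hurewicz (respectively, Serre) stack if $\mathcal D\simeq B[R\rightrightarrows X]$ for some topological groupoid $[R\rightrightarrows X]$ whose source map $R\to X$ is locally a Hurewicz (respectively, Serre) fibration. A morphism $f\colon\mathcal X\to\mathcal Y$ of topological stacks is a Hurewicz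 (respectively, Serre) morphism if for every space $U$ in $\mathrm{CGTop}$ and every morphism $U\to\mathcal Y$ the $2$-fibre product $\mathcal X\times_{\mathcal Y}U$ is a Hurewicz (respectively, Serre) stack. **Lemma.** Let $f\colon\mathcal X\to\mathcal Y$ be a morphism of topological stacks. If $\mathcal X$ is a Serre stack, then $f$ is a Serre morphism; if $\mathcal X$ is a Hurewicz stack, then $f$ is a Hurewicz morphism. -/

import Mathlib

open CategoryTheory

universe u v₁ u₁ v₂ u₂ v₃ u₃

/-! ### Compactly generated Hausdorff spaces -/

/-- The objects of the category `CGTop` of (small) compactly generated Hausdorff spaces. -/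
structure CGTop where
  carrier : Type u
  [top : TopologicalSpace carrier]
  [cg : CompactlyGeneratedSpace carrier]
  [t2 : T2Space carrier]

namespace CGTop

instance : CoeSort CGTop.{u} (Type u) := ⟨CGTop.carrier⟩

attribute [instance] CGTop.top CGTop.cg CGTop.t2

/-- Morphisms are continuous maps. -/
instance : Category.{u} CGTop.{u} where
  Hom X Y := C(X, Y)
  id X := ContinuousMap.id X
  comp f g := g.comp f

/-- A morphism of `CGTop` seen as a continuous map. -/
def Hom.toMap {X Y : CGTop.{u}} (f : X ⟶ Y) : C(X, Y) := f

/-- The set underlying the fibre product of `f : A → C` and `g : B → C`. -/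
@[ext]
structure PullbackType {A B C : CGTop.{u}} (f : C(A, C)) (g : C(B, C)) : Type u where
  fst : A
  snd : B
  condition : f fst = g snd

namespace PullbackType

variable {A B C : CGTop.{u}} (f : C(A, C)) (g : C(B, C))

/-- The topology of the fibre product in `CGTop`: the compactly generated topology associated
with the topology of the fibre product in `Top`. -/
instance : TopologicalSpace (PullbackType f g) :=
  TopologicalSpace.coinduced (fun p : {p : A × B // f p.1 = g p.2} => ⟨p.1.1, p.1.2, p.2⟩)
    (TopologicalSpace.compactlyGenerated.{u} {p : A × B // f p.1 = g p.2})

theorem continuous_pair : Continuous (fun z : PullbackType f g => (z.fst, z.snd)) :=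
  continuous_coinduced_dom.2 (continuous_from_compactlyGenerated.{u} _
    fun _ h => continuous_subtype_val.comp h.continuous)

/-- A map from a space of `CGTop` to the fibre product is continuous if its components are. -/
theorem continuous_of_pair {T : Type u} [TopologicalSpace T] [CompactlyGeneratedSpace T]
    (h : T → PullbackType f g) (hh : Continuous fun t => ((h t).fst, (h t).snd)) :
    Continuous h := by
  refine continuous_from_uCompactlyGeneratedSpace.{u} h fun S k => ?_
  let h' : C(S, {p : A × B // f p.1 = g p.2}) :=
    ⟨fun s => ⟨((h (k s)).fst, (h (k s)).snd), (h (k s)).condition⟩,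
      (hh.comp k.continuous).subtype_mk _⟩
  refine continuous_def.2 fun W hW => ?_
  exact isOpen_sigma_iff.1 (isOpen_coinduced.1 (isOpen_coinduced.1 hW)) ⟨S, h'⟩

theorem pair_injective :
    Function.Injective (fun z : PullbackType f g => (z.fst, z.snd)) :=
  fun _ _ h => PullbackType.ext (congrArg Prod.fst h) (congrArg Prod.snd h)

instance : T2Space (PullbackType f g) :=
  T2Space.of_injective_continuous (pair_injective f g) (continuous_pair f g)

instance : CompactlyGeneratedSpace (PullbackType f g) := by
  refine uCompactlyGeneratedSpace_of_isClosed.{u} fun s hs => ?_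
  refine isClosed_coinduced.2 (isClosed_coinduced.2 (isClosed_sigma_iff.2 fun i => ?_))
  exact hs i.1 ⟨fun x => ⟨(i.2 x).1.1, (i.2 x).1.2, (i.2 x).2⟩,
    continuous_of_pair f g _ (continuous_subtype_val.comp i.2.continuous)⟩

end PullbackType

/-- The fibre product `A ×_C B` in `CGTop`. -/
def pullback {A B C : CGTop.{u}} (f : C(A, C)) (g : C(B, C)) : CGTop.{u} := ⟨PullbackType f g⟩

/-- The point `(a, b)` of the fibre product. -/
def pullback.mk {A B C : CGTop.{u}} {f : C(A, C)} {g : C(B, C)} (a : A) (b : B) (h : f a = g b) :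
    pullback f g := (⟨a, b, h⟩ : PullbackType f g)

/-- `f : X → Y` admits local sections. -/
def AdmitsLocalSections {X Y : CGTop.{u}} (f : C(X, Y)) : Prop :=
  ∀ y : Y, ∃ V : Set Y, IsOpen V ∧ y ∈ V ∧ ∃ s : C(V, X), ∀ v : V, f (s v) = v

/-- A covering of `U` for the open-cover topology: a jointly surjective family of
open embeddings. -/
def IsOpenCover {U : CGTop.{u}} {ι : Type u} {V : ι → CGTop.{u}} (σ : ∀ i, V i ⟶ U) : Prop :=
  (∀ i, Topology.IsOpenEmbedding (Hom.toMap (σ i))) ∧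
    ∀ x : U, ∃ (i : ι) (y : V i), Hom.toMap (σ i) y = x

end CGTop

/-! ### Local Hurewicz and Serre fibrations -/

/-- The homotopy lifting property of `f : X → Y` with respect to the space `T`. -/
def HasHomotopyLifting (T : Type*) [TopologicalSpace T] {X Y : Type*} [TopologicalSpace X]
    [TopologicalSpace Y] (f : X → Y) : Prop :=
  ∀ (h : C(T × unitInterval, Y)) (g : C(T, X)), (∀ t, f (g t) = h (t, 0)) →
    ∃ H : C(T × unitInterval, X), (∀ t, H (t, 0) = g t) ∧ ∀ z, f (H z) = h z

/-- Hurewicz fibrations (in compactly generated Hausdorff spaces): continuous maps with the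
homotopy lifting property with respect to all spaces of `CGTop`. -/
def IsHurewiczFibration {X Y : Type u} [TopologicalSpace X] [TopologicalSpace Y]
    (f : X → Y) : Prop :=
  Continuous f ∧ ∀ T : CGTop.{u}, HasHomotopyLifting T f

/-- Serre fibrations: continuous maps with the homotopy lifting property with respect to all
cubes. -/
def IsSerreFibration {X Y : Type u} [TopologicalSpace X] [TopologicalSpace Y]
    (f : X → Y) : Prop :=
  Continuous f ∧ ∀ n : ℕ, HasHomotopyLifting (Fin n → unitInterval) f

/-- `f : X → Y` is locally a Hurewicz fibration: every point of `X` has an open neighbourhood `U`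
such that `f` restricts to a Hurewicz fibration from `U` to some open subset `V` of `Y`. -/
def IsLocallyHurewiczFibration {X Y : CGTop.{u}} (f : C(X, Y)) : Prop :=
  ∀ x : X, ∃ (U : Set X) (V : Set Y) (h : Set.MapsTo f U V),
    x ∈ U ∧ IsOpen U ∧ IsOpen V ∧ IsHurewiczFibration (h.restrict f U V)

/-- `f : X → Y` is locally a Serre fibration. -/
def IsLocallySerreFibration {X Y : CGTop.{u}} (f : C(X, Y)) : Prop :=
  ∀ x : X, ∃ (U : Set X) (V : Set Y) (h : Set.MapsTo f U V),
    x ∈ U ∧ IsOpen U ∧ IsOpen V ∧ IsSerreFibration (h.restrict f U V)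

/-! ### Topological groupoids and principal bundles -/

open CGTop in
/-- A topological groupoid `[arr ⇉ obj]` in `CGTop`. The pair `(γ, γ')` is composable when
`src γ = tgt γ'`, and `comp (γ, γ')` is `γ ∘ γ'`. -/
structure TopGroupoid where
  obj : CGTop.{u}
  arr : CGTop.{u}
  src : C(arr, obj)
  tgt : C(arr, obj)
  unit : C(obj, arr)
  inv : C(arr, arr)
  comp : C(pullback src tgt, arr)
  src_unit : ∀ x, src (unit x) = x
  tgt_unit : ∀ x, tgt (unit x) = x
  src_inv : ∀ γ, src (inv γ) = tgt γ
  tgt_inv : ∀ γ, tgt (inv γ) = src γ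
  src_comp : ∀ z, src (comp z) = src z.snd
  tgt_comp : ∀ z, tgt (comp z) = tgt z.fst
  unit_comp : ∀ γ, comp (pullback.mk (unit (tgt γ)) γ (src_unit _)) = γ
  comp_unit : ∀ γ, comp (pullback.mk γ (unit (src γ)) (tgt_unit _).symm) = γ
  inv_comp : ∀ γ, comp (pullback.mk (inv γ) γ (src_inv γ)) = unit (src γ)
  comp_inv : ∀ γ, comp (pullback.mk γ (inv γ) (tgt_inv γ).symm) = unit (tgt γ)
  assoc : ∀ (γ₁ γ₂ γ₃ : arr) (h : src γ₁ = tgt γ₂) (h' : src γ₂ = tgt γ₃),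
    comp (pullback.mk (comp (pullback.mk γ₁ γ₂ h)) γ₃ ((src_comp _).trans h')) =
      comp (pullback.mk γ₁ (comp (pullback.mk γ₂ γ₃ h')) (h.trans (tgt_comp (pullback.mk γ₂ γ₃ h')).symm))

open CGTop in
/-- A principal `G`-bundle over `M`, with `G` acting on the right. -/
structure PrincipalBundle (G : TopGroupoid.{u}) (M : CGTop.{u}) where
  total : CGTop.{u}
  proj : C(total, M)
  anchor : C(total, G.obj)
  act : C(pullback anchor G.tgt, total)
  anchor_act : ∀ z, anchor (act z) = G.src z.snd
  act_unit : ∀ p, act (pullback.mk p (G.unit (anchor p)) (G.tgt_unit _).symm) = p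
  act_act : ∀ (p : total) (γ γ' : G.arr) (h : anchor p = G.tgt γ) (h' : G.src γ = G.tgt γ'),
    act (pullback.mk (act (pullback.mk p γ h)) γ' ((anchor_act _).trans h')) =
      act (pullback.mk p (G.comp (pullback.mk γ γ' h')) (h.trans (G.tgt_comp (pullback.mk γ γ' h')).symm))
  proj_act : ∀ z, proj (act z) = proj z.fst
  proj_local : AdmitsLocalSections proj
  shear : IsHomeomorph fun z : pullback anchor G.tgt =>
    (pullback.mk z.fst (act z) (proj_act z).symm : pullback proj proj)

/-! ### The category fibred in groupoids `BG` -/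

/-- The objects of `BG`: principal `G`-bundles over some base. -/
structure BObj (G : TopGroupoid.{u}) where
  base : CGTop.{u}
  bundle : PrincipalBundle G base

namespace BObj

variable {G : TopGroupoid.{u}}

/-- The morphisms of `BG`: morphisms of principal `G`-bundles over a map of the bases. -/
@[ext]
structure Hom (P Q : BObj G) where
  base : P.base ⟶ Q.base
  map : C(P.bundle.total, Q.bundle.total)
  anchor_map : ∀ p, Q.bundle.anchor (map p) = P.bundle.anchor p
  map_act : ∀ (p : P.bundle.total) (γ : G.arr) (h : P.bundle.anchor p = G.tgt γ),
    map (P.bundle.act (CGTop.pullback.mk p γ h)) =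
      Q.bundle.act (CGTop.pullback.mk (map p) γ ((anchor_map p).trans h))
  proj_map : ∀ p, Q.bundle.proj (map p) = CGTop.Hom.toMap base (P.bundle.proj p)

instance : Category.{u} (BObj G) where
  Hom := Hom
  id P :=
    { base := 𝟙 P.base
      map := ContinuousMap.id _
      anchor_map := fun _ => rfl
      map_act := fun _ _ _ => rfl
      proj_map := fun _ => rfl }
  comp {P Q R} f g :=
    { base := f.base ≫ g.base
      map := g.map.comp f.map
      anchor_map := fun p => (g.anchor_map _).trans (f.anchor_map p)
      map_act := fun p γ h => by
        simp only [ContinuousMap.comp_apply, f.map_act p γ h, g.map_act]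
      proj_map := fun p => by
        simp only [ContinuousMap.comp_apply, g.proj_map, f.proj_map]
        rfl }

end BObj

/-- `BG` as a category over `CGTop`. -/
def TopGroupoid.B (G : TopGroupoid.{u}) : BasedCategory.{u, u + 1} CGTop.{u} :=
  BasedCategory.ofFunctor (𝒳 := BObj G)
    { obj := fun P => P.base
      map := fun f => f.base }

/-- The category over `CGTop` associated with a space `U`; its objects are the maps `T → U`. -/
def CGTop.underline (U : CGTop.{u}) : BasedCategory.{u, u + 1} CGTop.{u} :=
  BasedCategory.ofFunctor (Over.forget U)

/-! ### Stacks over `CGTop`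

A category over `CGTop` is a `BasedCategory`. A morphism of categories fibred in groupoids is a
functor which commutes (strictly) with the projections, i.e. a `BasedFunctor`: every arrow of a
category fibred in groupoids is Cartesian, so such a functor preserves Cartesian arrows. The
2-morphisms are the natural transformations whose components lie over identities. -/

/-- Categories fibred in groupoids over `CGTop`. -/
def IsFiberedInGroupoids (D : BasedCategory.{v₁, u₁} CGTop.{u}) : Prop :=
  D.p.IsFibered ∧ ∀ (U : CGTop.{u}) (a b : D.p.Fiber U) (φ : a ⟶ b), IsIso φ

/-- A sieve `S` on `U`, as a category over `CGTop` (a full subcategory of `CGTop/U`). -/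
def sieveCategory {U : CGTop.{u}} (S : Sieve U) : BasedCategory.{u, u + 1} CGTop.{u} :=
  BasedCategory.ofFunctor (S.arrows.diagram)

/-- The inclusion of a sieve on `U` into `CGTop/U`. -/
def sieveInclusion {U : CGTop.{u}} (S : Sieve U) : sieveCategory S ⥤ᵇ U.underline where
  toFunctor := ObjectProperty.ι _
  w := rfl

/-- Precomposition with `F : A ⥤ᵇ B`, as a functor between categories of morphisms over
`CGTop`. -/
def precomp {A : BasedCategory.{v₁, u₁} CGTop.{u}} {B : BasedCategory.{v₂, u₂} CGTop.{u}}
    (F : A ⥤ᵇ B) (D : BasedCategory.{v₃, u₃} CGTop.{u}) : (B ⥤ᵇ D) ⥤ (A ⥤ᵇ D) where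
  obj H := BasedFunctor.comp F H
  map α := BasedCategory.whiskerLeft F α

/-- Stacks (of groupoids) for the open-cover topology on `CGTop`, in Giraud's form: for each open
cover of `U`, generating the sieve `S`, restriction from the category of morphisms `CGTop/U → D`
(which is the fibre of `D` over `U`) to the category of morphisms `S → D` (which is the category
of descent data for the cover) is an equivalence of categories. -/
def IsStack (D : BasedCategory.{v₁, u₁} CGTop.{u}) : Prop :=
  IsFiberedInGroupoids D ∧
    ∀ (U : CGTop.{u}) (ι : Type u) (V : ι → CGTop.{u}) (σ : ∀ i, V i ⟶ U),
      CGTop.IsOpenCover σ → (precomp (sieveInclusion (Sieve.ofArrows V σ)) D).IsEquivalence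

/-- Equivalence of categories over `CGTop` (what is called an isomorphism of stacks). -/
def IsEquivalentOver (A : BasedCategory.{v₁, u₁} CGTop.{u})
    (B : BasedCategory.{v₂, u₂} CGTop.{u}) : Prop :=
  ∃ (F : A ⥤ᵇ B) (G : B ⥤ᵇ A),
    Nonempty (BasedFunctor.comp F G ≅ BasedFunctor.id A) ∧
      Nonempty (BasedFunctor.comp G F ≅ BasedFunctor.id B)

/-- Topological stacks. -/
def IsTopologicalStack (D : BasedCategory.{v₁, u₁} CGTop.{u}) : Prop :=
  IsStack D ∧ ∃ G : TopGroupoid.{u}, IsEquivalentOver G.B D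

/-- Hurewicz stacks. -/
def IsHurewiczStack (D : BasedCategory.{v₁, u₁} CGTop.{u}) : Prop :=
  IsTopologicalStack D ∧
    ∃ G : TopGroupoid.{u}, IsLocallyHurewiczFibration G.src ∧ IsEquivalentOver G.B D

/-- Serre stacks. -/
def IsSerreStack (D : BasedCategory.{v₁, u₁} CGTop.{u}) : Prop :=
  IsTopologicalStack D ∧
    ∃ G : TopGroupoid.{u}, IsLocallySerreFibration G.src ∧ IsEquivalentOver G.B D

/-! ### 2-fibre products -/

section FiberProduct

variable {X : BasedCategory.{v₁, u₁} CGTop.{u}} {Y : BasedCategory.{v₂, u₂} CGTop.{u}}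
  {Z : BasedCategory.{v₃, u₃} CGTop.{u}}

/-- The objects of the 2-fibre product `X ×_Y Z`: triples `(x, z, α)` with `x` and `z` over the
same space and `α : f x → g z` in the fibre of `Y` over this space. -/
structure FiberProductObj (f : X ⥤ᵇ Y) (g : Z ⥤ᵇ Y) where
  x : X.obj
  z : Z.obj
  base_eq : X.p.obj x = Z.p.obj z
  α : f.obj x ⟶ g.obj z
  isHomLift : Y.p.IsHomLift (𝟙 (X.p.obj x)) α

namespace FiberProductObj

variable {f : X ⥤ᵇ Y} {g : Z ⥤ᵇ Y}

/-- The morphisms of the 2-fibre product: pairs `(a, b)` of morphisms of `X` and `Z` over the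
same morphism of `CGTop`, compatible with the `α`s. -/
@[ext]
structure Hom (A B : FiberProductObj f g) where
  a : A.x ⟶ B.x
  b : A.z ⟶ B.z
  isHomLift : Z.p.IsHomLift (X.p.map a) b
  comm : f.map a ≫ B.α = A.α ≫ g.map b

instance : Category (FiberProductObj f g) where
  Hom := Hom
  id A :=
    { a := 𝟙 A.x
      b := 𝟙 A.z
      isHomLift := by
        rw [X.p.map_id]
        exact IsHomLift.id A.base_eq.symm
      comm := by simp }
  comp {A B C} φ ψ :=
    { a := φ.a ≫ ψ.a
      b := φ.b ≫ ψ.b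
      isHomLift := by
        have := φ.isHomLift
        have := ψ.isHomLift
        rw [X.p.map_comp]
        infer_instance
      comm := by
        rw [f.map_comp, g.map_comp, Category.assoc, ψ.comm, ← Category.assoc, φ.comm,
          Category.assoc] }
  id_comp φ := by
    apply Hom.ext
    · exact Category.id_comp φ.a
    · exact Category.id_comp φ.b
  comp_id φ := by
    apply Hom.ext
    · exact Category.comp_id φ.a
    · exact Category.comp_id φ.b
  assoc φ ψ χ := by
    apply Hom.ext
    · exact Category.assoc φ.a ψ.a χ.a
    · exact Category.assoc φ.b ψ.b χ.b

end FiberProductObj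

/-- The 2-fibre product `X ×_Y Z` as a category over `CGTop`. -/
def fiberProduct (f : X ⥤ᵇ Y) (g : Z ⥤ᵇ Y) :
    BasedCategory.{max v₁ v₃, max u₁ u₃ v₂} CGTop.{u} :=
  BasedCategory.ofFunctor (𝒳 := FiberProductObj f g)
    { obj := fun A => X.p.obj A.x
      map := fun φ => X.p.map φ.a
      map_id := fun A => X.p.map_id A.x
      map_comp := fun φ ψ => X.p.map_comp φ.a ψ.a }

/-- Hurewicz morphisms. -/
def IsHurewiczMorphism (f : X ⥤ᵇ Y) : Prop :=
  ∀ (U : CGTop.{u}) (q : U.underline ⥤ᵇ Y), IsHurewiczStack (fiberProduct f q)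

/-- Serre morphisms. -/
def IsSerreMorphism (f : X ⥤ᵇ Y) : Prop :=
  ∀ (U : CGTop.{u}) (q : U.underline ⥤ᵇ Y), IsSerreStack (fiberProduct f q)

end FiberProduct

-- Let $\mathcal X\simeq BG$, where the source map of $G$ is locally a fibration, and let $\mathcal
-- Y\simeq BH$ for any $H$. Then $f$ becomes a functor $L$ from $G$-bundles to $H$-bundles. By
-- Yoneda, a morphism $U\to\mathcal Y$ becomes one $H$-bundle $Q$ on $U$. An object of $\mathcal
-- X\times_{\mathcal Y}U$ is now a $G$-bundle $M$ with a bundle morphism $LM\to Q$, that is, an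
-- object of the slice of $L$ over $Q$.
--
-- The value $P$ of $L$ on the trivial bundle $G_1\to G_0$ carries a left $G$-action, and $LM$ is
-- the quotient of $M\times_{G_0}P$ by $G$ (`act`, `coact`). As $Q$ may have no global section, take
-- a surjective étale map $N\to U$ with a lift $s\colon N\to Q$. The slice is presented by a
-- groupoid (`sliceGroupoid`) whose objects are the pairs $(p,n)\in P\times_{H_0}N$. An arrow
-- $(p',n')\to(p,n)$ is an arrow $g$ of $G$ such that, for some $\gamma$ in $H$, both $gp'=p\gamma$
-- and $s(n')=s(n)\gamma$.
--
-- Here $\gamma$ is determined by $n$ and $n'$, and then $p$ is determined by $g$ and $p'$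
-- (`SliceRel.left_unique`). Conversely $g$, $(p',n')$ and $n$ over the same point of $U$ as $n'$
-- can be prescribed freely, subject to $g$ starting at the image of $p'$ in $G_0$
-- (`exists_sliceRel_of_lact`). So the source map of the new groupoid is built from a base change of
-- the source map of $G$ and a base change of the étale map $N\to U$. It therefore lifts homotopies
-- locally whenever the source map of $G$ does (`exists_restrict_sliceGroupoid_src`). This treats
-- the Hurewicz and the Serre case at once and asks nothing of $H$.
--
-- No quasi-inverse is built for the presentation `exists_sliceGroupoid_isEquivalentOver`. The
-- functor from the 2-fibre product to the classifying stack of the slice groupoid is fully faithful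
-- and hits every bundle locally on its base. Since the 2-fibre product is a stack
-- (`IsStack.fiberProduct`), local preimages glue (`IsStack.essSurjOnFibers`).

universe v₄ u₄ v₅ u₅

/-! ### Categories fibred in groupoids -/

theorem isHomLift_congr {C : Type u₁} {D : Type u₂} [Category.{v₁} C] [Category.{v₂} D]
    {p : D ⥤ C} {R S : C} {f g : R ⟶ S} {a b : D} {φ : a ⟶ b} (h : p.IsHomLift f φ) (e : f = g) :
    p.IsHomLift g φ := e ▸ h

theorem isHomLift_id_congr {C : Type u₁} {D : Type u₂} [Category.{v₁} C] [Category.{v₂} D]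
    {p : D ⥤ C} {R S : C} {a b : D} {φ : a ⟶ b} (h : p.IsHomLift (𝟙 R) φ) (e : R = S) :
    p.IsHomLift (𝟙 S) φ := by
  subst e; exact h

/-- In a category fibred in groupoids, every arrow is strongly Cartesian. -/
theorem IsFiberedInGroupoids.isStronglyCartesian {D : BasedCategory.{v₁, u₁} CGTop.{u}}
    (hD : IsFiberedInGroupoids D) {R S : CGTop.{u}} {a b : D.obj} (f : R ⟶ S) (φ : a ⟶ b)
    [h : D.p.IsHomLift f φ] : D.p.IsStronglyCartesian f φ := by
  have := hD.1
  obtain ⟨a', ψ, hψ⟩ := IsPreFibered.exists_isCartesian D.p (IsHomLift.codomain_eq D.p f φ) f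
  -- The comparison of φ with a chosen Cartesian lift lies over the identity, so it is an
  -- isomorphism of the fibre and φ inherits the Cartesian property.
  let τ := Functor.IsCartesian.map D.p f ψ φ
  have hτ : τ ≫ ψ = φ := Functor.IsCartesian.fac D.p f ψ φ
  have : IsIso τ := by
    have := hD.2 R (Functor.Fiber.mk (IsHomLift.domain_eq D.p (𝟙 R) τ))
      (Functor.Fiber.mk (IsHomLift.codomain_eq D.p (𝟙 R) τ)) (Functor.Fiber.homMk D.p R τ)
    have h2 := Functor.map_isIso Functor.Fiber.fiberInclusion (Functor.Fiber.homMk D.p R τ)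
    exact h2
  have h3 : D.p.IsStronglyCartesian (𝟙 R ≫ f) (τ ≫ ψ) := inferInstance
  rw [hτ, Category.id_comp] at h3
  exact h3

theorem IsFiberedInGroupoids.exists_lift {D : BasedCategory.{v₁, u₁} CGTop.{u}}
    (hD : IsFiberedInGroupoids D) {R S : CGTop.{u}} {a : D.obj} (ha : D.p.obj a = S) (f : R ⟶ S) :
    ∃ (b : D.obj) (φ : b ⟶ a), D.p.IsHomLift f φ := by
  have := hD.1
  obtain ⟨a', ψ, hψ⟩ := IsPreFibered.exists_isCartesian D.p ha f
  exact ⟨a', ψ, inferInstance⟩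

/-- A Cartesian arrow over an identity is invertible, so the fibres are groupoids as soon as all
arrows are Cartesian. -/
theorem IsFiberedInGroupoids.of_isStronglyCartesian {D : BasedCategory.{v₁, u₁} CGTop.{u}}
    (h₁ : ∀ (a : D.obj) (R : CGTop.{u}) (f : R ⟶ D.p.obj a),
      ∃ (b : D.obj) (φ : b ⟶ a), D.p.IsHomLift f φ)
    (h₂ : ∀ (a b : D.obj) (φ : a ⟶ b), D.p.IsStronglyCartesian (D.p.map φ) φ) :
    IsFiberedInGroupoids D := by
  have h₂' : ∀ {R S : CGTop.{u}} {a b : D.obj} (f : R ⟶ S) (φ : a ⟶ b) (_ : D.p.IsHomLift f φ),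
      D.p.IsStronglyCartesian f φ := by
    intro R S a b f φ h
    cases h
    exact h₂ _ _ φ
  refine ⟨Functor.IsFibered.of_exists_isStronglyCartesian fun a R f => ?_, fun U a b φ => ?_⟩
  · obtain ⟨b, φ, h⟩ := h₁ a R f
    exact ⟨b, φ, h₂' f φ h⟩
  · have := φ.2
    have : D.p.IsStronglyCartesian (𝟙 U) φ.1 := h₂' _ _ φ.2
    have hi : IsIso φ.1 := Functor.IsStronglyCartesian.isIso_of_base_isIso D.p (𝟙 U) φ.1
    refine ⟨⟨inv φ.1, inferInstance⟩, ?_, ?_⟩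
    · exact Subtype.ext (IsIso.hom_inv_id φ.1)
    · exact Subtype.ext (IsIso.inv_hom_id φ.1)

/-- In a category fibred in groupoids, arrows factor uniquely through a given one. -/
theorem IsFiberedInGroupoids.exists_factor {D : BasedCategory.{v₁, u₁} CGTop.{u}}
    (hD : IsFiberedInGroupoids D) {R R' S : CGTop.{u}} {a a' b : D.obj} {f : R ⟶ S} {φ : a ⟶ b}
    (hφ : D.p.IsHomLift f φ) {g : R' ⟶ R} {φ' : a' ⟶ b} (hφ' : D.p.IsHomLift (g ≫ f) φ') :
    ∃ χ : a' ⟶ a, D.p.IsHomLift g χ ∧ χ ≫ φ = φ' := by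
  have := hD.isStronglyCartesian f φ
  exact (Functor.IsStronglyCartesian.universal_property D.p f φ g (g ≫ f) rfl φ').exists

theorem IsFiberedInGroupoids.hom_ext {D : BasedCategory.{v₁, u₁} CGTop.{u}}
    (hD : IsFiberedInGroupoids D) {a a' b : D.obj} (φ : a ⟶ b)
    {χ χ' : a' ⟶ a} {R R' : CGTop.{u}} {g : R' ⟶ R} (hχ : D.p.IsHomLift g χ)
    (hχ' : D.p.IsHomLift g χ') (e : χ ≫ φ = χ' ≫ φ) : χ = χ' := by
  have h : D.p.obj a = R := IsHomLift.codomain_eq D.p g χ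
  subst h
  have := hD.isStronglyCartesian (D.p.map φ) φ
  exact Functor.IsStronglyCartesian.ext D.p (D.p.map φ) φ g e

theorem IsFiberedInGroupoids.isIso {D : BasedCategory.{v₁, u₁} CGTop.{u}}
    (hD : IsFiberedInGroupoids D) {a b : D.obj} (φ : a ⟶ b) {R : CGTop.{u}}
    (h : D.p.IsHomLift (𝟙 R) φ) : IsIso φ := by
  have := hD.isStronglyCartesian (𝟙 R) φ
  exact Functor.IsStronglyCartesian.isIso_of_base_isIso D.p (𝟙 R) φ

namespace CategoryTheory.BasedFunctor

variable {A : BasedCategory.{v₁, u₁} CGTop.{u}} {B : BasedCategory.{v₂, u₂} CGTop.{u}}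

/-- Essential surjectivity on the fibres. -/
def EssSurjOnFibers (F : A ⥤ᵇ B) : Prop :=
  ∀ b : B.obj, ∃ (a : A.obj) (i : F.obj a ≅ b), B.p.IsHomLift (𝟙 (B.p.obj b)) i.hom

/-- A fully faithful functor over `CGTop` that is essentially surjective on the fibres is an
equivalence over `CGTop`. -/
theorem isEquivalentOver (F : A ⥤ᵇ B) [F.toFunctor.Full] [F.toFunctor.Faithful]
    (hF : EssSurjOnFibers F) : IsEquivalentOver A B := by
  choose o i hi using hF
  have hi' : ∀ b, B.p.IsHomLift (𝟙 (B.p.obj b)) (i b).inv := fun b => by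
    have := hi b
    infer_instance
  let G₀ : B.obj ⥤ A.obj :=
    { obj := o
      map := fun {b b'} φ => F.toFunctor.preimage ((i b).hom ≫ φ ≫ (i b').inv)
      map_id := fun b => F.toFunctor.map_injective (by simp)
      map_comp := fun φ ψ => F.toFunctor.map_injective (by simp) }
  have hG : ∀ {b b' : B.obj} (φ : b ⟶ b'), F.map (G₀.map φ) = (i b).hom ≫ φ ≫ (i b').inv :=
    fun φ => F.toFunctor.map_preimage _
  have hl : ∀ {b b' : B.obj} (φ : b ⟶ b'), A.p.IsHomLift (B.p.map φ) (G₀.map φ) := by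
    intro b b' φ
    rw [← F.isHomLift_iff, hG]
    have := hi b
    have := hi' b'
    infer_instance
  have hobj : ∀ b, A.p.obj (o b) = B.p.obj b := fun b =>
    (F.w_obj (o b)).symm.trans (IsHomLift.domain_eq B.p (𝟙 (B.p.obj b)) (i b).hom)
  -- The quasi-inverse has to commute strictly with the projections. It does, because each `i b`
  -- lies over an identity, so `o b` lies exactly over the base of `b`.
  let G : B ⥤ᵇ A :=
    { toFunctor := G₀
      w := by
        refine CategoryTheory.Functor.ext hobj fun b b' φ => ?_
        have := hl φ
        exact IsHomLift.fac' A.p (B.p.map φ) (G₀.map φ) }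
  refine ⟨F, G, ⟨BasedNatIso.mkNatIso (NatIso.ofComponents
    (fun a => F.toFunctor.preimageIso (i (F.obj a))) ?_) ?_⟩,
    ⟨BasedNatIso.mkNatIso (NatIso.ofComponents i ?_) ?_⟩⟩
  · intro a a' φ
    refine F.toFunctor.map_injective ?_
    change F.map (G₀.map (F.map φ) ≫ F.toFunctor.preimage _) =
      F.map (F.toFunctor.preimage _ ≫ φ)
    rw [F.map_comp, F.map_comp, hG, F.toFunctor.map_preimage, F.toFunctor.map_preimage]
    simp
  · intro a
    change A.p.IsHomLift _ (F.toFunctor.preimage (i (F.obj a)).hom)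
    rw [← F.isHomLift_iff, F.toFunctor.map_preimage]
    exact isHomLift_id_congr (hi (F.obj a)) (F.w_obj a)
  · intro b b' φ
    change F.map (G₀.map φ) ≫ _ = _ ≫ φ
    rw [hG]
    simp
  · intro b
    exact hi b

end CategoryTheory.BasedFunctor

theorem IsEquivalentOver.symm {A : BasedCategory.{v₁, u₁} CGTop.{u}}
    {B : BasedCategory.{v₂, u₂} CGTop.{u}} (h : IsEquivalentOver A B) : IsEquivalentOver B A :=
  let ⟨F, G, h₁, h₂⟩ := h
  ⟨G, F, h₂, h₁⟩

/-! ### 2-fibre products of stacks -/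

section FiberProductFunctors

variable {X : BasedCategory.{v₁, u₁} CGTop.{u}} {Y : BasedCategory.{v₂, u₂} CGTop.{u}}
  {Z : BasedCategory.{v₃, u₃} CGTop.{u}} (f : X ⥤ᵇ Y) (g : Z ⥤ᵇ Y)

namespace fiberProduct

/-- The first projection of the 2-fibre product. -/
def fst : fiberProduct f g ⥤ᵇ X where
  obj A := A.x
  map φ := φ.a
  map_id _ := rfl
  map_comp _ _ := rfl
  w := rfl

/-- The second projection of the 2-fibre product. -/
def snd : fiberProduct f g ⥤ᵇ Z where
  obj A := A.z
  map φ := φ.b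
  map_id _ := rfl
  map_comp _ _ := rfl
  w := by
    refine CategoryTheory.Functor.ext (fun A => A.base_eq.symm) fun A B φ => ?_
    have := φ.isHomLift
    exact IsHomLift.fac' Z.p (X.p.map φ.a) φ.b

/-- The 2-cell of the 2-fibre product. -/
def square : (fst f g).comp f ⟶ (snd f g).comp g where
  app A := A.α
  naturality _ _ φ := φ.comm
  isHomLift' A := A.isHomLift

variable {f g}

/-- Lifts are taken separately in `X` and `Z`; the arrow joining their images is the unique
factorisation over the identity through the Cartesian arrow `g.map b`. Factorisations are likewise
found in each component, and their compatibility follows from uniqueness in `Y`. -/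
theorem isFiberedInGroupoids (hX : IsFiberedInGroupoids X) (hY : IsFiberedInGroupoids Y)
    (hZ : IsFiberedInGroupoids Z) : IsFiberedInGroupoids (fiberProduct f g) := by
  refine .of_isStronglyCartesian (fun A R r => ?_) fun A B φ => ⟨fun {A'} r ψ hψ => ?_⟩
  · change R ⟶ X.p.obj A.x at r
    obtain ⟨x, a, ha⟩ := hX.exists_lift rfl r
    obtain ⟨z, b, hb⟩ := hZ.exists_lift A.base_eq.symm r
    have hR : X.p.obj x = R := IsHomLift.domain_eq X.p r a
    have := A.isHomLift
    obtain ⟨α, hα, hα'⟩ := hY.exists_factor (g := 𝟙 R) (f := r) (φ := g.map b) inferInstance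
      (φ' := f.map a ≫ A.α) (by rw [Category.id_comp]; infer_instance)
    subst hR
    refine ⟨⟨x, z, (IsHomLift.domain_eq Z.p r b).symm, α, hα⟩, ⟨a, b, ?_, hα'.symm⟩, ?_⟩
    · exact isHomLift_congr hb (IsHomLift.eq_of_isHomLift X.p r a)
    · exact ((fst f g).isHomLift_iff r _).1 ha
  · change X.p.obj A'.x ⟶ X.p.obj A.x at r
    have e : r ≫ X.p.map φ.a = X.p.map ψ.a :=
      @IsHomLift.eq_of_isHomLift _ _ _ _ (fiberProduct f g).p _ _
        (r ≫ (fiberProduct f g).p.map φ) ψ hψ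
    have h1 : X.p.IsHomLift (r ≫ X.p.map φ.a) ψ.a := by rw [e]; infer_instance
    have h2 : Z.p.IsHomLift (r ≫ X.p.map φ.a) ψ.b := by rw [e]; exact ψ.isHomLift
    obtain ⟨a, ha, ha'⟩ := hX.exists_factor (φ := φ.a) inferInstance h1
    obtain ⟨b, hb, hb'⟩ := hZ.exists_factor φ.isHomLift h2
    have ea := IsHomLift.eq_of_isHomLift X.p r a
    have hA := A.isHomLift
    have hA' := A'.isHomLift
    refine ⟨⟨a, b, ea ▸ hb, ?_⟩, ⟨?_, ?_⟩, ?_⟩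
    · refine hY.hom_ext (g.map φ.b) (g := r) inferInstance inferInstance ?_
      rw [Category.assoc, Category.assoc, ← g.map_comp, hb', ← φ.comm, ← Category.assoc,
        ← f.map_comp, ha', ψ.comm]
    · exact ((fst f g).isHomLift_iff r _).1 ha
    · exact FiberProductObj.Hom.ext ha' hb'
    · rintro χ ⟨hχ, hχ'⟩
      have e1 : r = X.p.map χ.a :=
        @IsHomLift.eq_of_isHomLift _ _ _ _ (fiberProduct f g).p _ _ r χ hχ
      refine FiberProductObj.Hom.ext ?_ ?_
      · exact hX.hom_ext φ.a (g := r) (by rw [e1]; infer_instance) ha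
          ((congrArg FiberProductObj.Hom.a hχ').trans ha'.symm)
      · exact hZ.hom_ext φ.b (g := r) (by rw [e1]; exact χ.isHomLift) hb
          ((congrArg FiberProductObj.Hom.b hχ').trans hb'.symm)

section Lift

variable {T : BasedCategory.{v₄, u₄} CGTop.{u}}

/-- The morphism to the 2-fibre product given by a 2-commutative square. -/
def lift (H : T ⥤ᵇ X) (K : T ⥤ᵇ Z) (α : H.comp f ⟶ K.comp g) : T ⥤ᵇ fiberProduct f g where
  obj t :=
    { x := H.obj t
      z := K.obj t
      base_eq := (H.w_obj t).trans (K.w_obj t).symm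
      α := α.toNatTrans.app t
      isHomLift := isHomLift_id_congr (α.isHomLift' t) (H.w_obj t).symm }
  map {t t'} φ :=
    { a := H.map φ
      b := K.map φ
      isHomLift := by
        have h : Z.p.IsHomLift (T.p.map φ) (K.map φ) := inferInstance
        rw [IsHomLift.fac X.p (T.p.map φ) (H.map φ)] at h
        simpa [IsHomLift.lift_eqToHom_comp_iff, IsHomLift.lift_comp_eqToHom_iff] using h
      comm := α.naturality φ }
  map_id t := FiberProductObj.Hom.ext (H.map_id t) (K.map_id t)
  map_comp φ ψ := FiberProductObj.Hom.ext (H.map_comp φ ψ) (K.map_comp φ ψ)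
  w := H.w

/-- A 2-morphism between morphisms to the 2-fibre product, given by its components. -/
def homMk {H K : T ⥤ᵇ fiberProduct f g} (a : H.comp (fst f g) ⟶ K.comp (fst f g))
    (b : H.comp (snd f g) ⟶ K.comp (snd f g))
    (comm : ∀ t, f.map (a.toNatTrans.app t) ≫ (K.obj t).α =
      (H.obj t).α ≫ g.map (b.toNatTrans.app t)) : H ⟶ K where
  app t :=
    { a := a.toNatTrans.app t
      b := b.toNatTrans.app t
      isHomLift := by
        have h := b.isHomLift' t
        have h' := a.isHomLift' t
        rw [IsHomLift.fac X.p (𝟙 (T.p.obj t)) (a.toNatTrans.app t)] at h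
        rwa [IsHomLift.lift_eqToHom_comp_iff, IsHomLift.lift_comp_eqToHom_iff] at h
      comm := comm t }
  naturality _ _ φ := FiberProductObj.Hom.ext (a.naturality φ) (b.naturality φ)
  isHomLift' t := by
    have := a.isHomLift' t
    exact IsHomLift.of_fac' _ _ _ (H.w_obj t) (K.w_obj t)
      (IsHomLift.fac' X.p (𝟙 (T.p.obj t)) (a.toNatTrans.app t))

end Lift

end fiberProduct

end FiberProductFunctors

theorem BasedCategory.hom_app_ext {A : BasedCategory.{v₁, u₁} CGTop.{u}}
    {B : BasedCategory.{v₂, u₂} CGTop.{u}} {F G : A ⥤ᵇ B} {α β : F ⟶ G}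
    (h : ∀ a, α.toNatTrans.app a = β.toNatTrans.app a) : α = β :=
  BasedNatTrans.ext _ _ (NatTrans.ext (funext h))

theorem BasedCategory.congr_app {A : BasedCategory.{v₁, u₁} CGTop.{u}}
    {B : BasedCategory.{v₂, u₂} CGTop.{u}} {F G : A ⥤ᵇ B} {α β : F ⟶ G}
    (h : α = β) (a : A.obj) : α.toNatTrans.app a = β.toNatTrans.app a := by rw [h]

theorem map_comp_map_eq_id {C : Type u₁} [Category.{v₁} C] {D : Type u₂} [Category.{v₂} D]
    (F : C ⥤ D) {a b : C} {i : a ⟶ b} {j : b ⟶ a} (h : i ≫ j = 𝟙 a) :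
    F.map i ≫ F.map j = 𝟙 (F.obj a) := by
  rw [← F.map_comp, h, F.map_id]

theorem comp_eq_comp_of_eq_comp {C : Type u₁} [Category.{v₁} C] {a b c d : C} {α : a ⟶ d}
    {i : a ⟶ b} {m : b ⟶ c} {j : c ⟶ d} {j' : d ⟶ c} (h : α = i ≫ m ≫ j) (hj : j ≫ j' = 𝟙 _) :
    i ≫ m = α ≫ j' := by
  rw [h, Category.assoc, Category.assoc, hj, Category.comp_id]

theorem comp_eq_comp_of_eq_comp' {C : Type u₁} [Category.{v₁} C] {a b c d : C} {α : a ⟶ d}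
    {i : a ⟶ b} {m : b ⟶ c} {j : c ⟶ d} {i' : b ⟶ a} (h : α = i ≫ m ≫ j) (hi : i' ≫ i = 𝟙 _) :
    i' ≫ α = m ≫ j := by
  rw [h, ← Category.assoc, hi, Category.id_comp]

/-! ### Descent for 2-fibre products -/

section Precomp

variable {X : BasedCategory.{v₁, u₁} CGTop.{u}} {Y : BasedCategory.{v₂, u₂} CGTop.{u}}
  {Z : BasedCategory.{v₃, u₃} CGTop.{u}} {f : X ⥤ᵇ Y} {g : Z ⥤ᵇ Y}
  {S : BasedCategory.{v₄, u₄} CGTop.{u}} {T : BasedCategory.{v₅, u₅} CGTop.{u}} (R : S ⥤ᵇ T)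

open BasedCategory

/-- A morphism to the 2-fibre product is a pair of morphisms to `X` and `Z` with a 2-cell in `Y`.
The pair extends along `R` by the equivalences for `X` and `Z`, the 2-cell by full faithfulness of
restriction for `Y`. -/
theorem fiberProduct.precomp_isEquivalence [hX : (precomp R X).IsEquivalence]
    [hY : (precomp R Y).IsEquivalence] [hZ : (precomp R Z).IsEquivalence] :
    (precomp R (fiberProduct f g)).IsEquivalence where
  faithful := ⟨fun {H K} β β' h => by
    have ha : whiskerRight β (fst f g) = whiskerRight β' (fst f g) :=
      (precomp R X).map_injective (hom_app_ext fun s =>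
        congrArg FiberProductObj.Hom.a (congr_app h s))
    have hb : whiskerRight β (snd f g) = whiskerRight β' (snd f g) :=
      (precomp R Z).map_injective (hom_app_ext fun s =>
        congrArg FiberProductObj.Hom.b (congr_app h s))
    exact hom_app_ext fun t => FiberProductObj.Hom.ext (congr_app ha t) (congr_app hb t)⟩
  full := ⟨fun {H K} β => by
    obtain ⟨a, ha⟩ := (precomp R X).map_surjective
      (X := H.comp (fst f g)) (Y := K.comp (fst f g)) (whiskerRight β (fst f g))
    obtain ⟨b, hb⟩ := (precomp R Z).map_surjective
      (X := H.comp (snd f g)) (Y := K.comp (snd f g)) (whiskerRight β (snd f g))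
    have hc : whiskerRight a f ≫ whiskerLeft K (square f g) =
        whiskerLeft H (square f g) ≫ whiskerRight b g := by
      refine (precomp R Y).map_injective (hom_app_ext fun s => ?_)
      change f.map (a.toNatTrans.app (R.obj s)) ≫ (K.obj (R.obj s)).α =
        (H.obj (R.obj s)).α ≫ g.map (b.toNatTrans.app (R.obj s))
      have ha' : a.toNatTrans.app (R.obj s) = (β.toNatTrans.app s).a := congr_app ha s
      have hb' : b.toNatTrans.app (R.obj s) = (β.toNatTrans.app s).b := congr_app hb s
      rw [ha', hb']
      exact (β.toNatTrans.app s).comm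
    refine ⟨homMk a b fun t => congr_app hc t, hom_app_ext fun s => ?_⟩
    exact FiberProductObj.Hom.ext (congr_app ha s) (congr_app hb s)⟩
  essSurj := ⟨fun H => by
    let x := (precomp R X).objPreimage (H.comp (fst f g))
    let z := (precomp R Z).objPreimage (H.comp (snd f g))
    let i : R.comp x ≅ H.comp (fst f g) := (precomp R X).objObjPreimageIso _
    let j : R.comp z ≅ H.comp (snd f g) := (precomp R Z).objObjPreimageIso _
    -- The extensions `x` and `z` agree with the components of `H` only up to `i` and `j`, so the
    -- 2-cell of `H` is conjugated by them before it is extended.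
    obtain ⟨α, hα⟩ := (precomp R Y).map_surjective (X := x.comp f) (Y := z.comp g)
      (whiskerRight i.hom f ≫ whiskerLeft H (square f g) ≫ whiskerRight j.inv g)
    have hα' : ∀ s, α.toNatTrans.app (R.obj s) = f.map (i.hom.toNatTrans.app s) ≫
        (H.obj s).α ≫ g.map (j.inv.toNatTrans.app s) := fun s => congr_app hα s
    have hi : ∀ s, i.hom.toNatTrans.app s ≫ i.inv.toNatTrans.app s = 𝟙 _ :=
      fun s => congr_app i.hom_inv_id s
    have hi' : ∀ s, i.inv.toNatTrans.app s ≫ i.hom.toNatTrans.app s = 𝟙 _ :=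
      fun s => congr_app i.inv_hom_id s
    have hj : ∀ s, j.hom.toNatTrans.app s ≫ j.inv.toNatTrans.app s = 𝟙 _ :=
      fun s => congr_app j.hom_inv_id s
    have hj' : ∀ s, j.inv.toNatTrans.app s ≫ j.hom.toNatTrans.app s = 𝟙 _ :=
      fun s => congr_app j.inv_hom_id s
    have h1 : ∀ s, f.map (i.hom.toNatTrans.app s) ≫ (H.obj s).α =
        α.toNatTrans.app (R.obj s) ≫ g.map (j.hom.toNatTrans.app s) := fun s =>
      comp_eq_comp_of_eq_comp (hα' s) (map_comp_map_eq_id g.toFunctor (hj' s))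
    have h2 : ∀ s, f.map (i.inv.toNatTrans.app s) ≫ α.toNatTrans.app (R.obj s) =
        (H.obj s).α ≫ g.map (j.inv.toNatTrans.app s) := fun s =>
      comp_eq_comp_of_eq_comp' (hα' s) (map_comp_map_eq_id f.toFunctor (hi' s))
    refine ⟨lift x z α, ⟨⟨homMk (K := H) (H := R.comp (lift x z α)) i.hom j.hom h1,
      homMk (H := H) (K := R.comp (lift x z α)) i.inv j.inv h2, ?_, ?_⟩⟩⟩
    · exact hom_app_ext fun s => FiberProductObj.Hom.ext (hi s) (hj s)
    · exact hom_app_ext fun s => FiberProductObj.Hom.ext (hi' s) (hj' s)⟩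

end Precomp

theorem IsStack.fiberProduct {X : BasedCategory.{v₁, u₁} CGTop.{u}}
    {Y : BasedCategory.{v₂, u₂} CGTop.{u}} {Z : BasedCategory.{v₃, u₃} CGTop.{u}}
    (hX : IsStack X) (hY : IsStack Y) (hZ : IsStack Z) (f : X ⥤ᵇ Y) (g : Z ⥤ᵇ Y) :
    IsStack (fiberProduct f g) :=
  ⟨fiberProduct.isFiberedInGroupoids hX.1 hY.1 hZ.1, fun U ι V σ hσ =>
    have := hX.2 U ι V σ hσ
    have := hY.2 U ι V σ hσ
    have := hZ.2 U ι V σ hσ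
    fiberProduct.precomp_isEquivalence _⟩

/-! ### Spaces are stacks -/

namespace CGTop

/-- The one-point space. -/
def point : CGTop.{u} := ⟨PUnit⟩

/-- The morphism from the one-point space given by a point. -/
def pointMap {X : CGTop.{u}} (x : X) : point ⟶ X := ContinuousMap.const PUnit x

/-- A continuous map as a morphism of `CGTop`. -/
def ofMap {X Y : CGTop.{u}} (f : C(X, Y)) : X ⟶ Y := f

@[ext]
theorem hom_ext {X Y : CGTop.{u}} {f g : X ⟶ Y} (h : ∀ x, Hom.toMap f x = Hom.toMap g x) :
    f = g :=
  ContinuousMap.ext h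

/-- A map out of a space with an open cover is continuous if it is so on the members of the
cover. -/
theorem IsOpenCover.continuous {U : CGTop.{u}} {ι : Type u} {V : ι → CGTop.{u}}
    {σ : ∀ i, V i ⟶ U} (hσ : IsOpenCover σ) {Y : Type*} [TopologicalSpace Y] (f : U → Y)
    (hf : ∀ i, Continuous fun y => f (Hom.toMap (σ i) y)) : Continuous f := by
  refine continuous_iff_continuousAt.2 fun x => ?_
  obtain ⟨i, y, rfl⟩ := hσ.2 x
  exact (hσ.1 i).continuousAt_iff.1 (hf i).continuousAt

theorem IsOpenCover.pointMap_mem {U : CGTop.{u}} {ι : Type u} {V : ι → CGTop.{u}}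
    {σ : ∀ i, V i ⟶ U} (hσ : IsOpenCover σ) (x : U) :
    (Sieve.ofArrows V σ).arrows (pointMap x) := by
  obtain ⟨i, y, rfl⟩ := hσ.2 x
  exact (Sieve.mem_ofArrows_iff _ _ _).2 ⟨i, pointMap y, rfl⟩

end CGTop

open CGTop

namespace underline

variable {A : BasedCategory.{v₁, u₁} CGTop.{u}} {U : CGTop.{u}}

/-- The structure map of an object of `CGTop/U`. -/
def hom (x : U.underline.obj) : U.underline.p.obj x ⟶ U := Comma.hom x

theorem map_comp_hom {x y : U.underline.obj} (φ : x ⟶ y) :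
    U.underline.p.map φ ≫ hom y = hom x := Over.w φ

/-- A morphism of `CGTop/U`. -/
def homMk {x y : U.underline.obj} (r : U.underline.p.obj x ⟶ U.underline.p.obj y)
    (h : r ≫ hom y = hom x) : x ⟶ y := Over.homMk r h

theorem map_homMk {x y : U.underline.obj} (r : U.underline.p.obj x ⟶ U.underline.p.obj y)
    (h : r ≫ hom y = hom x) : U.underline.p.map (homMk r h) = r := rfl

theorem map_injective {x y : U.underline.obj} {φ ψ : x ⟶ y}
    (h : U.underline.p.map φ = U.underline.p.map ψ) : φ = ψ := Over.OverMorphism.ext h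

/-- An object of `CGTop/U`. -/
def mk {T : CGTop.{u}} (r : T ⟶ U) : U.underline.obj := Over.mk r

/-- The map to `U` given by the value of a morphism `A → U`. -/
def val (G : A ⥤ᵇ U.underline) (a : A.obj) : A.p.obj a ⟶ U :=
  eqToHom (G.w_obj a).symm ≫ hom (G.obj a)

theorem val_naturality (G : A ⥤ᵇ U.underline) {a b : A.obj} (φ : a ⟶ b) :
    A.p.map φ ≫ val G b = val G a := by
  rw [IsHomLift.fac U.underline.p (A.p.map φ) (G.map φ), val, val, ← map_comp_hom (G.map φ)]
  simp

/-- The morphism `A → U` with given values. -/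
def ofVal (v : ∀ a, A.p.obj a ⟶ U) (hv : ∀ {a b : A.obj} (φ : a ⟶ b), A.p.map φ ≫ v b = v a) :
    A ⥤ᵇ U.underline where
  obj a := mk (v a)
  map φ := homMk (A.p.map φ) (hv φ)
  map_id a := map_injective (A.p.map_id a)
  map_comp φ ψ := map_injective (A.p.map_comp φ ψ)
  w := rfl

theorem hom_subsingleton {R S : CGTop.{u}} {r : R ⟶ S} {x y : U.underline.obj} {φ ψ : x ⟶ y}
    (hφ : U.underline.p.IsHomLift r φ) (hψ : U.underline.p.IsHomLift r ψ) : φ = ψ :=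
  map_injective ((IsHomLift.fac' U.underline.p r φ).trans
    (IsHomLift.fac' U.underline.p r ψ).symm)

theorem val_eq_of_hom {G H : A ⥤ᵇ U.underline} (β : G ⟶ H) (a : A.obj) :
    val G a = val H a := by
  have := β.isHomLift' a
  have h := IsHomLift.fac' U.underline.p (𝟙 (A.p.obj a)) (β.toNatTrans.app a)
  rw [val, val, ← map_comp_hom (β.toNatTrans.app a), h]
  simp

/-- A 2-morphism between morphisms `A → U` with the same values. -/
def homOfVal {G H : A ⥤ᵇ U.underline} (h : ∀ a, val G a = val H a) : G ⟶ H where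
  app a := homMk (eqToHom ((G.w_obj a).trans (H.w_obj a).symm)) (by
    have := h a
    rw [val, val, ← cancel_epi (eqToHom (G.w_obj a)), eqToHom_trans_assoc, eqToHom_trans_assoc,
      eqToHom_refl, Category.id_comp] at this
    exact this.symm)
  naturality a b φ := map_injective (by
    rw [Functor.map_comp, Functor.map_comp, map_homMk, map_homMk,
      IsHomLift.fac' U.underline.p (A.p.map φ) (G.map φ),
      IsHomLift.fac' U.underline.p (A.p.map φ) (H.map φ)]
    simp)
  isHomLift' a := IsHomLift.of_fac' _ _ _ (G.w_obj a) (H.w_obj a) (by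
    rw [map_homMk]
    simp)

theorem nonempty_iso {G H : A ⥤ᵇ U.underline} (h : ∀ a, val G a = val H a) : Nonempty (G ≅ H) :=
  ⟨⟨homOfVal h, homOfVal fun a => (h a).symm,
    BasedCategory.hom_app_ext fun a => hom_subsingleton
      ((homOfVal h ≫ homOfVal fun a => (h a).symm).isHomLift' a) ((𝟙 G : G ⟶ G).isHomLift' a),
    BasedCategory.hom_app_ext fun a => hom_subsingleton
      (((homOfVal fun a => (h a).symm) ≫ homOfVal h).isHomLift' a) ((𝟙 H : H ⟶ H).isHomLift' a)⟩⟩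

variable (U) in
theorem isFiberedInGroupoids : IsFiberedInGroupoids U.underline := by
  refine .of_isStronglyCartesian (fun a R f => ?_) fun a b φ => ⟨fun {a'} r ψ hψ => ?_⟩
  · let φ : mk (f ≫ hom a) ⟶ a := homMk f rfl
    exact ⟨_, φ, IsHomLift.map U.underline.p φ⟩
  · have e : r ≫ U.underline.p.map φ = U.underline.p.map ψ :=
      @IsHomLift.eq_of_isHomLift _ _ _ _ U.underline.p _ _ (r ≫ U.underline.p.map φ) ψ hψ
    let χ : a' ⟶ a := homMk r (by
      rw [← map_comp_hom φ, ← map_comp_hom ψ, ← e, Category.assoc])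
    have hχ : U.underline.p.IsHomLift r χ := IsHomLift.map U.underline.p χ
    exact ⟨χ, ⟨hχ, map_injective e⟩, fun χ' h' => hom_subsingleton h'.1 hχ⟩

section Sieve

variable {T : CGTop.{u}} {ι : Type u} {V : ι → CGTop.{u}} {σ : ∀ i, V i ⟶ T}

/-- The point `x` as an object of the sieve generated by an open cover. -/
def _root_.CGTop.IsOpenCover.pt (hσ : IsOpenCover σ) (x : T) :
    (sieveCategory (Sieve.ofArrows V σ)).obj :=
  ⟨Over.mk (pointMap x), hσ.pointMap_mem x⟩

/-- A point of an object of the sieve generated by an open cover, as a morphism. -/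
def _root_.CGTop.IsOpenCover.ptHom (hσ : IsOpenCover σ)
    (s : (sieveCategory (Sieve.ofArrows V σ)).obj) (y : s.obj.left) :
    hσ.pt (Hom.toMap s.obj.hom y) ⟶ s :=
  ObjectProperty.homMk (Over.homMk (pointMap y) rfl)

/-- A member of an open cover as an object of the sieve generated by the cover. -/
def _root_.CGTop.IsOpenCover.mem (_ : IsOpenCover σ) (i : ι) :
    (sieveCategory (Sieve.ofArrows V σ)).obj :=
  ⟨Over.mk (σ i), Sieve.ofArrows_mk V σ i⟩

end Sieve

/-- The sieve of an open cover contains every map from the one-point space to `T`. A morphism from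
the sieve to `U` thus has a value at each point of `T`, and naturality along points shows that it is
composition with the resulting function. Continuity of this function is checked on the members of
the cover. -/
theorem isStack (U : CGTop.{u}) : IsStack U.underline := by
  refine ⟨isFiberedInGroupoids U, fun T ι V σ hσ => ⟨⟨?_⟩, ⟨?_⟩, ⟨?_⟩⟩⟩
  · intro G H β β' _
    exact BasedCategory.hom_app_ext fun a =>
      hom_subsingleton (β.isHomLift' a) (β'.isHomLift' a)
  · intro G H β
    refine ⟨homOfVal fun t => ?_, ?_⟩
    · have hpt : ∀ x : T, val G (mk (pointMap x)) = val H (mk (pointMap x)) :=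
        fun x => val_eq_of_hom β (hσ.pt x)
      refine CGTop.hom_ext fun y => ?_
      let φ : mk (pointMap (Hom.toMap (hom t) y)) ⟶ t := homMk (pointMap y) rfl
      have h1 := val_naturality G φ
      have h2 := val_naturality H φ
      rw [hpt _, ← h2] at h1
      exact congrArg (fun f : point ⟶ U => Hom.toMap f PUnit.unit) h1
    · exact BasedCategory.hom_app_ext fun a =>
        hom_subsingleton (BasedNatTrans.isHomLift' _ a) (β.isHomLift' a)
  · intro G
    let g : T → U := fun x => Hom.toMap (val G (hσ.pt x)) PUnit.unit
    have hg : ∀ (s : (sieveCategory (Sieve.ofArrows V σ)).obj) (y : s.obj.left),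
        g (Hom.toMap s.obj.hom y) = Hom.toMap (val G s) y := fun s y =>
      (congrArg (fun f : point ⟶ U => Hom.toMap f PUnit.unit)
        (val_naturality G (hσ.ptHom s y))).symm
    have hc : Continuous g := hσ.continuous g fun i => by
      have : (fun y => g (Hom.toMap (σ i) y)) = fun y => Hom.toMap (val G (hσ.mem i)) y :=
        funext fun y => hg (hσ.mem i) y
      rw [this]
      exact (Hom.toMap (val G (hσ.mem i))).continuous
    refine ⟨ofVal (A := T.underline) (fun t => hom t ≫ ofMap ⟨g, hc⟩) fun {a b} φ => ?_,
      nonempty_iso fun s => ?_⟩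
    · rw [← Category.assoc, map_comp_hom]
    · refine CGTop.hom_ext fun y => ?_
      exact hg s y

end underline

/-! ### Compactly generated spaces -/

/-- The set underlying the compactly generated space associated with a space. -/
@[ext]
structure Kify (Z : Type u) where
  val : Z

namespace Kify

variable {Z : Type u} [TopologicalSpace Z]

instance : TopologicalSpace (Kify Z) :=
  TopologicalSpace.coinduced Kify.mk (TopologicalSpace.compactlyGenerated.{u} Z)

theorem continuous_val : Continuous (Kify.val : Kify Z → Z) :=
  continuous_coinduced_dom.2 (continuous_from_compactlyGenerated.{u} _ fun _ h => h.continuous)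

/-- A map from a compactly generated space to `Kify Z` is continuous if it is so as a map
to `Z`. -/
theorem continuous_of_val {T : Type u} [TopologicalSpace T] [CompactlyGeneratedSpace T]
    {h : T → Kify Z} (hh : Continuous fun t => (h t).val) : Continuous h := by
  refine continuous_from_uCompactlyGeneratedSpace.{u} h fun S k => ?_
  let h' : C(S, Z) := ⟨fun s => (h (k s)).val, hh.comp k.continuous⟩
  refine continuous_def.2 fun W hW => ?_
  exact isOpen_sigma_iff.1 (isOpen_coinduced.1 (isOpen_coinduced.1 hW)) ⟨S, h'⟩

instance : CompactlyGeneratedSpace (Kify Z) := by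
  refine uCompactlyGeneratedSpace_of_isClosed.{u} fun s hs => ?_
  refine isClosed_coinduced.2 (isClosed_coinduced.2 (isClosed_sigma_iff.2 fun i => ?_))
  exact hs i.1 ⟨fun x => ⟨i.2 x⟩, continuous_of_val i.2.continuous⟩

end Kify

theorem exists_compact_nhds_subset_of_compactSpace {X : Type u} [TopologicalSpace X]
    [CompactSpace X] [T2Space X] {x : X} {O : Set X} (hO : O ∈ nhds x) :
    ∃ K ∈ nhds x, K ⊆ O ∧ IsCompact K :=
  local_compact_nhds hO

/-- Open subspaces of compactly generated Hausdorff spaces are compactly generated. -/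
theorem IsOpen.compactlyGeneratedSpace {X : Type u} [TopologicalSpace X] [T2Space X]
    [CompactlyGeneratedSpace X] {V : Set X} (hV : IsOpen V) : CompactlyGeneratedSpace V := by
  refine uCompactlyGeneratedSpace_of_isOpen.{u} fun s hs => ?_
  rw [hV.isOpenEmbedding_subtypeVal.isOpen_iff_image_isOpen]
  refine UCompactlyGeneratedSpace.isOpen.{u} fun S f => ?_
  refine isOpen_iff_mem_nhds.2 fun x hx => ?_
  have hxV : f x ∈ V := by
    obtain ⟨y, _, hy⟩ := hx
    exact hy ▸ y.2
  -- The hypothesis on `s` only concerns maps into `V`, so the test map `f` is cut down to a compact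
  -- neighbourhood of `x` that it sends into `V`.
  obtain ⟨K, hK, hKV, hKc⟩ := exists_compact_nhds_subset_of_compactSpace
    ((hV.preimage f.continuous).mem_nhds (show x ∈ f ⁻¹' V from hxV))
  have : CompactSpace K := isCompact_iff_compactSpace.1 hKc
  have h := hs (CompHaus.of K) ⟨fun k => ⟨f k.1, hKV k.2⟩,
    (f.continuous.comp continuous_subtype_val).subtype_mk _⟩
  obtain ⟨O, hO, hO'⟩ := isOpen_induced_iff.1 h
  have hxK : x ∈ K := mem_of_mem_nhds hK
  have key : ∀ y (hy : y ∈ K), y ∈ O ↔ f y ∈ Subtype.val '' s := fun y hy => by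
    have h1 : y ∈ O ↔ (⟨f y, hKV hy⟩ : V) ∈ s := by
      change (⟨y, hy⟩ : K) ∈ Subtype.val ⁻¹' O ↔ _
      rw [hO']
      rfl
    refine h1.trans ⟨fun h => ⟨_, h, rfl⟩, ?_⟩
    rintro ⟨z, hz, hz'⟩
    have : z = ⟨f y, hKV hy⟩ := Subtype.ext hz'
    exact this ▸ hz
  filter_upwards [hK, hO.mem_nhds ((key x hxK).2 hx)] with y hy hyO
  exact (key y hy).1 hyO

/-- By the exponential law for the locally compact interval, continuity on `T × I` is continuity of
a map from `T` to a mapping space, which compact Hausdorff spaces `S → T` detect, `S × I` being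
compact Hausdorff. This is what lets homotopies be mapped continuously into fibre products of
`CGTop` by giving components. -/
instance CGTop.compactlyGeneratedSpace_prod_unitInterval (T : CGTop.{u}) :
    CompactlyGeneratedSpace (T × unitInterval) := by
  refine uCompactlyGeneratedSpace_of_continuous_maps.{u} fun {Y} _ f hf => ?_
  have key : ∀ (S : CompHaus.{u}) (k : C(S, T)),
      Continuous fun p : S × unitInterval => f (k p.1, p.2) := fun S k =>
    hf (CompHaus.of (S × unitInterval)) ⟨fun p => (k p.1, p.2), by fun_prop⟩
  have hsec : ∀ t, Continuous fun i => f (t, i) := fun t =>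
    (key (CompHaus.of PUnit) (ContinuousMap.const _ t)).comp
      (continuous_const (y := PUnit.unit) |>.prodMk continuous_id)
  let F : T → C(unitInterval, Y) := fun t => ⟨fun i => f (t, i), hsec t⟩
  have hF : Continuous F := continuous_from_uCompactlyGeneratedSpace.{u} F fun S k =>
    (ContinuousMap.curry ⟨_, key S k⟩).continuous
  exact ContinuousMap.continuous_uncurry_of_continuous ⟨F, hF⟩

namespace CGTop

/-- An open subset as a space of `CGTop`. -/
def opens (X : CGTop.{u}) (V : Set X) (hV : IsOpen V) : CGTop.{u} :=
  { carrier := V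
    cg := hV.compactlyGeneratedSpace }

/-- The inclusion of an open subset. -/
def opensι (X : CGTop.{u}) (V : Set X) (hV : IsOpen V) : X.opens V hV ⟶ X :=
  (⟨Subtype.val, continuous_subtype_val⟩ : C(V, X))

theorem isOpenEmbedding_opensι (X : CGTop.{u}) (V : Set X) (hV : IsOpen V) :
    Topology.IsOpenEmbedding (Hom.toMap (X.opensι V hV)) :=
  hV.isOpenEmbedding_subtypeVal

section Pullback

variable {A B C : CGTop.{u}} {f : C(A, C)} {g : C(B, C)}

theorem continuous_fst : Continuous fun z : pullback f g => z.fst :=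
  _root_.continuous_fst.comp (PullbackType.continuous_pair f g)

theorem continuous_snd : Continuous fun z : pullback f g => z.snd :=
  _root_.continuous_snd.comp (PullbackType.continuous_pair f g)

theorem continuous_pullback_mk {T : Type u} [TopologicalSpace T] [CompactlyGeneratedSpace T]
    {a : T → A} {b : T → B} (ha : Continuous a) (hb : Continuous b) (h : ∀ t, f (a t) = g (b t)) :
    Continuous fun t => (pullback.mk (a t) (b t) (h t) : pullback f g) :=
  PullbackType.continuous_of_pair f g _ (ha.prodMk hb)

theorem pullback_ext {z w : pullback f g} (h₁ : z.fst = w.fst) (h₂ : z.snd = w.snd) : z = w :=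
  PullbackType.ext h₁ h₂

end Pullback

/-- A map admitting local sections has a section over a space étale over its target. -/
theorem AdmitsLocalSections.exists_isLocalHomeomorph {E M : CGTop.{u}} {π : C(E, M)}
    (h : AdmitsLocalSections π) : ∃ (N : CGTop.{u}) (c : C(N, M)) (s : C(N, E)),
      IsLocalHomeomorph c ∧ Function.Surjective c ∧ ∀ x, π (s x) = c x := by
  choose V hV hm s hs using h
  have : ∀ y, CompactlyGeneratedSpace (V y) := fun y => (hV y).compactlyGeneratedSpace
  refine ⟨⟨Σ y, V y⟩, ⟨fun z => z.2.1, ?_⟩, ⟨fun z => s z.1 z.2, ?_⟩, ?_, ?_, ?_⟩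
  · exact continuous_sigma fun y => continuous_subtype_val
  · exact continuous_sigma fun y => (s y).continuous
  · refine isLocalHomeomorph_iff_isLocalHomeomorphOn_univ.2 fun z _ => ?_
    have h1 : Topology.IsOpenEmbedding (Sigma.mk (β := fun y => V y) z.1) := .sigmaMk
    have h2 : IsLocalHomeomorph (Subtype.val : V z.1 → M) :=
      (hV z.1).isOpenEmbedding_subtypeVal.isLocalHomeomorph
    exact IsLocalHomeomorphOn.of_comp_right (s := Set.univ) (f := Sigma.mk (β := fun y => V y) z.1)
      (g := fun z : Σ y, V y => (z.2.1 : M)) h2.isLocalHomeomorphOn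
      h1.isLocalHomeomorph.isLocalHomeomorphOn z ⟨z.2, trivial, rfl⟩
  · exact fun y => ⟨⟨y, y, hm y⟩, rfl⟩
  · exact fun z => hs z.1 z.2

end CGTop

/-! ### Calculus in topological groupoids and principal bundles -/

theorem CGTop.continuous_of_local {T : CGTop.{u}} {Y : Type*} [TopologicalSpace Y] {f : T → Y}
    (h : ∀ x, ∃ O : Set T, IsOpen O ∧ x ∈ O ∧ Continuous fun y : O => f y) : Continuous f := by
  refine continuous_iff_continuousAt.2 fun x => ?_
  obtain ⟨O, hO, hx, hf⟩ := h x
  exact (hO.isOpenEmbedding_subtypeVal.continuousAt_iff (x := ⟨x, hx⟩)).1 hf.continuousAt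

theorem isHomeomorph_of_inverse {X Y : Type*} [TopologicalSpace X] [TopologicalSpace Y]
    {f : X → Y} {g : Y → X} (hf : Continuous f) (hg : Continuous g) (h₁ : ∀ x, g (f x) = x)
    (h₂ : ∀ y, f (g y) = y) : IsHomeomorph f :=
  (Homeomorph.mk ⟨f, g, h₁, h₂⟩ hf hg).isHomeomorph

namespace TopGroupoid

variable (G : TopGroupoid.{u})

/-- The composite of two composable arrows. -/
def mul (γ γ' : G.arr) (h : G.src γ = G.tgt γ') : G.arr := G.comp (pullback.mk γ γ' h)

variable {G}

theorem mul_congr {γ γ' δ δ' : G.arr} (h₁ : γ = δ) (h₂ : γ' = δ') (h : G.src γ = G.tgt γ') :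
    G.mul γ γ' h = G.mul δ δ' (by rw [← h₁, ← h₂, h]) := by
  subst h₁ h₂; rfl

theorem src_mul {γ γ' : G.arr} (h : G.src γ = G.tgt γ') : G.src (G.mul γ γ' h) = G.src γ' :=
  G.src_comp _

theorem tgt_mul {γ γ' : G.arr} (h : G.src γ = G.tgt γ') : G.tgt (G.mul γ γ' h) = G.tgt γ :=
  G.tgt_comp _

theorem mul_assoc' {γ γ' γ'' : G.arr} (h : G.src γ = G.tgt γ') (h' : G.src γ' = G.tgt γ'') :
    G.mul (G.mul γ γ' h) γ'' ((src_mul h).trans h') =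
      G.mul γ (G.mul γ' γ'' h') (h.trans (tgt_mul h').symm) := G.assoc γ γ' γ'' h h'

theorem unit_mul (γ : G.arr) : G.mul (G.unit (G.tgt γ)) γ (G.src_unit _) = γ := G.unit_comp γ

theorem mul_unit (γ : G.arr) : G.mul γ (G.unit (G.src γ)) (G.tgt_unit _).symm = γ := G.comp_unit γ

theorem inv_mul (γ : G.arr) : G.mul (G.inv γ) γ (G.src_inv γ) = G.unit (G.src γ) := G.inv_comp γ

theorem mul_inv (γ : G.arr) : G.mul γ (G.inv γ) (G.tgt_inv γ).symm = G.unit (G.tgt γ) :=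
  G.comp_inv γ

theorem continuous_mul {T : Type u} [TopologicalSpace T] [CompactlyGeneratedSpace T]
    {a b : T → G.arr} (ha : Continuous a) (hb : Continuous b) (h : ∀ t, G.src (a t) = G.tgt (b t)) :
    Continuous fun t => G.mul (a t) (b t) (h t) :=
  G.comp.continuous.comp (continuous_pullback_mk ha hb h)

theorem inv_mul_mul {γ γ' : G.arr} (h : G.src γ = G.tgt γ') :
    G.mul (G.inv γ) (G.mul γ γ' h) ((G.src_inv γ).trans (tgt_mul h).symm) = γ' := by
  rw [← mul_assoc' (G.src_inv γ) h, mul_congr (inv_mul γ) rfl]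
  exact (mul_congr (by rw [h]) rfl _).trans (unit_mul γ')

theorem mul_inv_mul {γ γ' : G.arr} (h : G.tgt γ = G.tgt γ') :
    G.mul γ (G.mul (G.inv γ) γ' ((G.src_inv γ).trans h))
      ((G.tgt_inv γ).symm.trans (tgt_mul _).symm) = γ' := by
  rw [← mul_assoc' (G.tgt_inv γ).symm ((G.src_inv γ).trans h), mul_congr (mul_inv γ) rfl]
  exact (mul_congr (by rw [h]) rfl _).trans (unit_mul γ')

end TopGroupoid

namespace PrincipalBundle

variable {G : TopGroupoid.{u}} {M : CGTop.{u}} (E : PrincipalBundle G M)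

/-- The action on the total space. -/
def smul (p : E.total) (γ : G.arr) (h : E.anchor p = G.tgt γ) : E.total :=
  E.act (pullback.mk p γ h)

variable {E}

theorem smul_congr {p p' : E.total} {γ γ' : G.arr} (h₁ : p = p') (h₂ : γ = γ')
    (h : E.anchor p = G.tgt γ) : E.smul p γ h = E.smul p' γ' (by rw [← h₁, ← h₂, h]) := by
  subst h₁ h₂; rfl

theorem anchor_smul {p : E.total} {γ : G.arr} (h : E.anchor p = G.tgt γ) :
    E.anchor (E.smul p γ h) = G.src γ := E.anchor_act _

theorem proj_smul {p : E.total} {γ : G.arr} (h : E.anchor p = G.tgt γ) :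
    E.proj (E.smul p γ h) = E.proj p := E.proj_act _

theorem smul_unit (p : E.total) : E.smul p (G.unit (E.anchor p)) (G.tgt_unit _).symm = p :=
  E.act_unit p

theorem smul_smul {p : E.total} {γ γ' : G.arr} (h : E.anchor p = G.tgt γ)
    (h' : G.src γ = G.tgt γ') : E.smul (E.smul p γ h) γ' ((anchor_smul h).trans h') =
      E.smul p (G.mul γ γ' h') (h.trans (TopGroupoid.tgt_mul h').symm) := E.act_act p γ γ' h h'

theorem continuous_smul {T : Type u} [TopologicalSpace T] [CompactlyGeneratedSpace T]
    {a : T → E.total} {b : T → G.arr} (ha : Continuous a) (hb : Continuous b)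
    (h : ∀ t, E.anchor (a t) = G.tgt (b t)) : Continuous fun t => E.smul (a t) (b t) (h t) :=
  E.act.continuous.comp (continuous_pullback_mk ha hb h)

theorem smul_inv_smul {p : E.total} {γ : G.arr} (h : E.anchor p = G.tgt γ) :
    E.smul (E.smul p γ h) (G.inv γ) ((anchor_smul h).trans (G.tgt_inv γ).symm) = p := by
  rw [smul_smul h (G.tgt_inv γ).symm, smul_congr rfl (TopGroupoid.mul_inv γ)]
  exact (smul_congr rfl (by rw [h]) _).trans (smul_unit p)

variable (E) in
/-- The inverse of the shear map. -/
noncomputable def shearInv : pullback E.proj E.proj → pullback E.anchor G.tgt :=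
  (E.shear.homeomorph _).symm

theorem exists_smul_eq {p p' : E.total} (h : E.proj p = E.proj p') :
    ∃ (γ : G.arr) (h : E.anchor p = G.tgt γ), E.smul p γ h = p' := by
  obtain ⟨z, hz⟩ := E.shear.surjective (pullback.mk p p' h)
  have h1 : z.fst = p := congrArg PullbackType.fst hz
  have h2 : E.act z = p' := congrArg PullbackType.snd hz
  subst h1
  exact ⟨z.snd, z.condition, h2⟩

variable (E) in
/-- The arrow that takes a point to another point of its fibre. -/
noncomputable def div (p p' : E.total) (h : E.proj p = E.proj p') : G.arr :=
  (E.shearInv (pullback.mk p p' h)).snd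

theorem smul_left_injective {p : E.total} {γ γ' : G.arr} (h : E.anchor p = G.tgt γ)
    (h' : E.anchor p = G.tgt γ') (e : E.smul p γ h = E.smul p γ' h') : γ = γ' := by
  have := E.shear.injective (a₁ := pullback.mk p γ h) (a₂ := pullback.mk p γ' h')
    (pullback_ext rfl e)
  exact congrArg PullbackType.snd this

theorem div_eq {p : E.total} {γ : G.arr} (h : E.anchor p = G.tgt γ)
    (h' : E.proj p = E.proj (E.smul p γ h)) : E.div p (E.smul p γ h) h' = γ := by
  have : E.shearInv (pullback.mk p (E.smul p γ h) h') = pullback.mk p γ h :=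
    (E.shear.homeomorph _).symm_apply_apply (pullback.mk p γ h)
  rw [div, this]
  rfl

theorem anchor_eq_tgt_div {p p' : E.total} (h : E.proj p = E.proj p') :
    E.anchor p = G.tgt (E.div p p' h) := by
  obtain ⟨γ, hγ, rfl⟩ := exists_smul_eq h
  rw [div_eq, hγ]

theorem smul_div {p p' : E.total} (h : E.proj p = E.proj p') :
    E.smul p (E.div p p' h) (anchor_eq_tgt_div h) = p' := by
  obtain ⟨γ, hγ, rfl⟩ := exists_smul_eq h
  exact smul_congr rfl (div_eq hγ h) _

theorem src_div {p p' : E.total} (h : E.proj p = E.proj p') :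
    G.src (E.div p p' h) = E.anchor p' := by
  rw [← anchor_smul (anchor_eq_tgt_div h), smul_div]

theorem continuous_div {T : Type u} [TopologicalSpace T] [CompactlyGeneratedSpace T]
    {a b : T → E.total} (ha : Continuous a) (hb : Continuous b)
    (h : ∀ t, E.proj (a t) = E.proj (b t)) : Continuous fun t => E.div (a t) (b t) (h t) :=
  CGTop.continuous_snd.comp ((E.shear.homeomorph _).symm.continuous.comp
    (continuous_pullback_mk ha hb h))

theorem proj_surjective : Function.Surjective E.proj := fun x =>
  let ⟨_, _, hx, s, hs⟩ := E.proj_local x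
  ⟨s ⟨x, hx⟩, hs ⟨x, hx⟩⟩

/-- The shear map is a homeomorphism if there is a continuous division. -/
theorem shear_of_div {T : CGTop.{u}} {proj : C(T, M)} {anchor : C(T, G.obj)}
    {act : C(pullback anchor G.tgt, T)} (proj_act : ∀ z, proj (act z) = proj z.fst)
    (d : C(pullback proj proj, G.arr)) (hd : ∀ z, anchor z.fst = G.tgt (d z))
    (act_d : ∀ z, act (pullback.mk z.fst (d z) (hd z)) = z.snd)
    (d_act : ∀ z, d (pullback.mk z.fst (act z) (proj_act z).symm) = z.snd) :
    IsHomeomorph fun z : pullback anchor G.tgt =>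
      (pullback.mk z.fst (act z) (proj_act z).symm : pullback proj proj) := by
  refine isHomeomorph_of_inverse
    (g := fun z : pullback proj proj => (pullback.mk z.fst (d z) (hd z) : pullback anchor G.tgt))
    (continuous_pullback_mk CGTop.continuous_fst act.continuous _)
    (continuous_pullback_mk CGTop.continuous_fst d.continuous _) (fun z => ?_) fun z => ?_
  · exact pullback_ext rfl (d_act z)
  · exact pullback_ext rfl (act_d z)

open TopGroupoid in
variable (G) in
/-- The trivial bundle over the space of objects. -/
def unit : PrincipalBundle G G.obj where
  total := G.arr
  proj := G.tgt
  anchor := G.src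
  act := G.comp
  anchor_act := G.src_comp
  act_unit := G.comp_unit
  act_act := G.assoc
  proj_act := G.tgt_comp
  proj_local _ := ⟨Set.univ, isOpen_univ, trivial,
    ⟨fun v => G.unit v, G.unit.continuous.comp continuous_subtype_val⟩, fun v => G.tgt_unit v⟩
  shear := shear_of_div (act := G.comp) G.tgt_comp
    ⟨fun z => G.mul (G.inv z.fst) z.snd ((G.src_inv _).trans z.condition),
      continuous_mul (G.inv.continuous.comp CGTop.continuous_fst) CGTop.continuous_snd _⟩
    (fun z => ((tgt_mul _).trans (G.tgt_inv z.fst)).symm)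
    (fun z => mul_inv_mul z.condition)
    (fun z => inv_mul_mul z.condition)

/-- The pull-back of a principal bundle. -/
noncomputable def pull {N : CGTop.{u}} (E : PrincipalBundle G M) (r : C(N, M)) :
    PrincipalBundle G N where
  total := pullback r E.proj
  proj := ⟨fun z => z.fst, CGTop.continuous_fst⟩
  anchor := ⟨fun z => E.anchor z.snd, E.anchor.continuous.comp CGTop.continuous_snd⟩
  act := ⟨fun z => pullback.mk z.fst.fst (E.smul z.fst.snd z.snd z.condition)
      (z.fst.condition.trans (proj_smul z.condition).symm),
    continuous_pullback_mk (CGTop.continuous_fst.comp CGTop.continuous_fst)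
      (continuous_smul (CGTop.continuous_snd.comp CGTop.continuous_fst) CGTop.continuous_snd _) _⟩
  anchor_act z := anchor_smul z.condition
  act_unit p := pullback_ext rfl (smul_unit p.snd)
  act_act p γ γ' h h' := pullback_ext rfl (smul_smul (E := E) (p := p.snd) h h')
  proj_act _ := rfl
  proj_local x := by
    obtain ⟨V, hV, hx, s, hs⟩ := E.proj_local (r x)
    have hV' : IsOpen (r ⁻¹' V) := hV.preimage r.continuous
    have := hV'.compactlyGeneratedSpace
    exact ⟨r ⁻¹' V, hV', hx, ⟨fun v => pullback.mk (v : N) (s ⟨r v, v.2⟩) (hs ⟨r v, v.2⟩).symm,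
      continuous_pullback_mk continuous_subtype_val (s.continuous.comp
        ((r.continuous.comp continuous_subtype_val).subtype_mk _)) _⟩, fun v => rfl⟩
  shear := shear_of_div (fun _ => rfl)
    ⟨fun z => E.div z.fst.snd z.snd.snd (z.fst.condition.symm.trans
      ((congrArg r z.condition).trans z.snd.condition)),
      continuous_div (CGTop.continuous_snd.comp CGTop.continuous_fst)
        (CGTop.continuous_snd.comp CGTop.continuous_snd) _⟩
    (fun z => anchor_eq_tgt_div _)
    (fun z => pullback_ext z.condition (smul_div _))
    (fun z => div_eq (E := E) (p := z.fst.snd) z.condition _)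

end PrincipalBundle

namespace BObj

open PrincipalBundle

variable {G : TopGroupoid.{u}}

/-! ### Bundle morphisms are bijective on fibres -/

namespace Hom

variable {P Q R : BObj G} (a : P ⟶ Q)

theorem map_smul {p : P.bundle.total} {γ : G.arr} (h : P.bundle.anchor p = G.tgt γ) :
    a.map (P.bundle.smul p γ h) = Q.bundle.smul (a.map p) γ ((a.anchor_map p).trans h) :=
  a.map_act p γ h

theorem ext_map {a b : P ⟶ Q} (h : ∀ p, a.map p = b.map p) : a = b := by
  refine Hom.ext (CGTop.hom_ext fun x => ?_) (ContinuousMap.ext h)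
  obtain ⟨p, rfl⟩ := P.bundle.proj_surjective x
  rw [← a.proj_map, ← b.proj_map, h]

/-- Move any point over `t` by the arrow that takes its image to `q`; equivariance makes the moved
point map to `q`. -/
theorem exists_lift (t : P.base) (q : Q.bundle.total)
    (h : Q.bundle.proj q = Hom.toMap a.base t) :
    ∃ p, P.bundle.proj p = t ∧ a.map p = q := by
  obtain ⟨p, rfl⟩ := P.bundle.proj_surjective t
  obtain ⟨γ, hγ, rfl⟩ := exists_smul_eq ((a.proj_map p).trans h.symm)
  exact ⟨P.bundle.smul p γ ((a.anchor_map p).symm.trans hγ), proj_smul _, a.map_smul _⟩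

theorem map_injective {p p' : P.bundle.total} (h : P.bundle.proj p = P.bundle.proj p')
    (h' : a.map p = a.map p') : p = p' := by
  obtain ⟨γ, hγ, rfl⟩ := exists_smul_eq h
  rw [map_smul] at h'
  have h1 := smul_left_injective (E := Q.bundle) (G.tgt_unit (Q.bundle.anchor (a.map p))).symm _
    ((smul_unit _).trans h')
  rw [smul_congr rfl (h1.symm.trans (congrArg G.unit (a.anchor_map p)))]
  exact (smul_unit p).symm

/-- The point over `t` that is mapped to `q`. -/
noncomputable def lift (t : P.base) (q : Q.bundle.total)
    (h : Q.bundle.proj q = Hom.toMap a.base t) : P.bundle.total :=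
  (a.exists_lift t q h).choose

section

variable {t : P.base} {q : Q.bundle.total} (h : Q.bundle.proj q = Hom.toMap a.base t)

theorem proj_lift : P.bundle.proj (a.lift t q h) = t := (a.exists_lift t q h).choose_spec.1

theorem map_lift : a.map (a.lift t q h) = q := (a.exists_lift t q h).choose_spec.2

theorem anchor_lift : P.bundle.anchor (a.lift t q h) = Q.bundle.anchor q := by
  rw [← a.anchor_map, map_lift]

theorem eq_lift {p : P.bundle.total} (h₁ : P.bundle.proj p = t) (h₂ : a.map p = q) :
    p = a.lift t q h :=
  a.map_injective (h₁.trans (a.proj_lift h).symm) (h₂.trans (a.map_lift h).symm)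

end

/-- Over an open set where the source bundle has a section `s`, the lift of `q` is `s` acted on by
the division of `q` by `a ∘ s`, and division is continuous because the shear map is a homeomorphism.
-/
theorem continuous_lift {T : CGTop.{u}} {t : T → P.base} {q : T → Q.bundle.total}
    (ht : Continuous t) (hq : Continuous q)
    (h : ∀ x, Q.bundle.proj (q x) = Hom.toMap a.base (t x)) :
    Continuous fun x => a.lift (t x) (q x) (h x) := by
  refine continuous_of_local fun x => ?_
  obtain ⟨V, hV, hx, s, hs⟩ := P.bundle.proj_local (t x)
  have hO : IsOpen (t ⁻¹' V) := hV.preimage ht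
  have := hO.compactlyGeneratedSpace
  refine ⟨t ⁻¹' V, hO, hx, ?_⟩
  have hs' : Continuous fun y : t ⁻¹' V => s ⟨t y, y.2⟩ :=
    s.continuous.comp ((ht.comp continuous_subtype_val).subtype_mk _)
  have hq' : Continuous fun y : t ⁻¹' V => q y := hq.comp continuous_subtype_val
  have hp : ∀ y : t ⁻¹' V, Q.bundle.proj (a.map (s ⟨t y, y.2⟩)) = Q.bundle.proj (q y) :=
    fun y => by rw [a.proj_map, h, hs]
  have key : ∀ y : t ⁻¹' V, a.lift (t y) (q y) (h y) = P.bundle.smul (s ⟨t y, y.2⟩)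
      (Q.bundle.div (a.map (s ⟨t y, y.2⟩)) (q y) (hp y))
      ((a.anchor_map _).symm.trans (anchor_eq_tgt_div (hp y))) := fun y =>
    (a.eq_lift (h y) ((proj_smul _).trans (hs _)) ((a.map_smul _).trans (smul_div _))).symm
  rw [funext key]
  exact continuous_smul hs' (continuous_div (a.map.continuous.comp hs') hq' hp) _

/-- Morphisms of principal bundles are Cartesian. -/
theorem exists_factor (c : R ⟶ Q) (r : R.base ⟶ P.base) (h : r ≫ a.base = c.base) :
    ∃ b : R ⟶ P, b.base = r ∧ b ≫ a = c := by
  have hq : ∀ x : R.bundle.total, Q.bundle.proj (c.map x) =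
      Hom.toMap a.base (Hom.toMap r (R.bundle.proj x)) := fun x => by
    rw [c.proj_map, ← h]; rfl
  refine ⟨
    { base := r
      map := ⟨fun x => a.lift _ _ (hq x), a.continuous_lift
        ((Hom.toMap r).continuous.comp R.bundle.proj.continuous) c.map.continuous hq⟩
      anchor_map := fun x => (a.anchor_lift (hq x)).trans (c.anchor_map x)
      map_act := fun x γ hγ => ?_
      proj_map := fun x => a.proj_lift (hq x) }, rfl, ext_map fun x => a.map_lift (hq x)⟩
  refine (a.eq_lift (hq (R.bundle.smul x γ hγ)) ?_ ?_).symm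
  · exact (proj_smul (E := P.bundle) _).trans
      ((a.proj_lift (hq x)).trans (congrArg (Hom.toMap r) (proj_smul hγ).symm))
  · refine (a.map_smul _).trans (Eq.trans (smul_congr (a.map_lift (hq x)) rfl _) ?_)
    exact (c.map_smul hγ).symm

theorem factor_unique {b b' : R ⟶ P} (h : b.base = b'.base) (h' : b ≫ a = b' ≫ a) : b = b' :=
  ext_map fun x => a.map_injective
    (((b.proj_map x).trans (congrArg (fun r => Hom.toMap r (R.bundle.proj x)) h)).trans
      (b'.proj_map x).symm)
    (congrArg (fun φ : R ⟶ Q => φ.map x) h')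

end Hom

/-- A morphism out of a bundle with a section is determined by the image of the section. -/
theorem exists_hom_of_section {P Q : BObj G} (τ : C(P.base, P.bundle.total))
    (hτ : ∀ v, P.bundle.proj (τ v) = v) (j : P.base ⟶ Q.base) (σ : C(P.base, Q.bundle.total))
    (hσ : ∀ v, Q.bundle.proj (σ v) = Hom.toMap j v)
    (h : ∀ v, P.bundle.anchor (τ v) = Q.bundle.anchor (σ v)) :
    ∃ b : P ⟶ Q, b.base = j ∧ ∀ v, b.map (τ v) = σ v := by
  have hp : ∀ x, P.bundle.proj (τ (P.bundle.proj x)) = P.bundle.proj x := fun x => hτ _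
  have ha : ∀ x, Q.bundle.anchor (σ (P.bundle.proj x)) = G.tgt (P.bundle.div _ _ (hp x)) :=
    fun x => (h _).symm.trans (anchor_eq_tgt_div _)
  -- Every `x` equals `τ (proj x)` acted on by a division, so equivariance forces the image to be `σ
  -- (proj x)` acted on by the same arrow.
  refine ⟨
    { base := j
      map := ⟨fun x => Q.bundle.smul (σ (P.bundle.proj x)) (P.bundle.div _ _ (hp x)) (ha x),
        continuous_smul (σ.continuous.comp P.bundle.proj.continuous)
          (continuous_div (τ.continuous.comp P.bundle.proj.continuous) continuous_id hp) _⟩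
      anchor_map := fun x => (anchor_smul _).trans (src_div _)
      map_act := fun x γ hγ => ?_
      proj_map := fun x => (proj_smul _).trans (hσ _) }, rfl, fun v => ?_⟩
  · have e : P.bundle.proj (P.bundle.smul x γ hγ) = P.bundle.proj x := proj_smul _
    have hs : G.src (P.bundle.div _ _ (hp x)) = G.tgt γ := (src_div _).trans hγ
    refine Eq.trans ?_ (smul_smul (ha x) hs).symm
    refine smul_congr (congrArg σ e) ?_ _
    refine smul_left_injective (anchor_eq_tgt_div _)
      (((congrArg (fun v => P.bundle.anchor (τ v)) e).trans (anchor_eq_tgt_div (hp x))).trans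
        (TopGroupoid.tgt_mul hs).symm) ?_
    rw [smul_div]
    refine Eq.trans ?_ (smul_congr (congrArg τ e.symm) rfl
      ((anchor_eq_tgt_div (hp x)).trans (TopGroupoid.tgt_mul hs).symm))
    rw [← smul_smul (anchor_eq_tgt_div (hp x)) hs]
    exact (smul_congr (smul_div (hp x)) rfl _).symm
  · have e := hτ v
    have h1 : P.bundle.div _ _ (hp (τ v)) = G.unit (P.bundle.anchor (τ v)) := by
      refine smul_left_injective (anchor_eq_tgt_div _)
        ((congrArg (fun v => P.bundle.anchor (τ v)) e).trans (G.tgt_unit _).symm) ?_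
      rw [smul_div]
      exact ((smul_congr (congrArg τ e) rfl _).trans (smul_unit (τ v))).symm
    exact (smul_congr (congrArg σ e) (h1.trans (congrArg G.unit (h v))) _).trans (smul_unit (σ v))

/-- The pull-back of a principal bundle, as an object over the source. -/
noncomputable def pull (Q : BObj G) {N : CGTop.{u}} (r : N ⟶ Q.base) : BObj G :=
  ⟨N, Q.bundle.pull (Hom.toMap r)⟩

/-- The canonical morphism from the pull-back. -/
noncomputable def pullHom (Q : BObj G) {N : CGTop.{u}} (r : N ⟶ Q.base) : Q.pull r ⟶ Q where
  base := r
  map := ⟨fun z => z.snd, CGTop.continuous_snd⟩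
  anchor_map _ := rfl
  map_act _ _ _ := rfl
  proj_map z := z.condition.symm

end BObj

namespace TopGroupoid

variable (G : TopGroupoid.{u})

theorem isHomLift_B_iff {P Q : BObj G} (r : P.base ⟶ Q.base) (a : P ⟶ Q) :
    Functor.IsHomLift G.B.p (a := P) (b := Q) r a ↔ a.base = r :=
  ⟨fun h => (@IsHomLift.eq_of_isHomLift _ _ _ _ G.B.p P Q r a h).symm,
    fun h => by subst h; exact IsHomLift.map G.B.p (a := P) (b := Q) a⟩

theorem isStronglyCartesian_B {P Q : BObj G} (a : P ⟶ Q) :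
    Functor.IsStronglyCartesian G.B.p (a := P) (b := Q) (G.B.p.map (X := P) (Y := Q) a) a where
  toIsHomLift := IsHomLift.map G.B.p (a := P) (b := Q) a
  universal_property' := fun {R} r c hc => by
    change BObj G at R
    have e : r ≫ a.base = (show R ⟶ Q from c).base :=
      @IsHomLift.eq_of_isHomLift _ _ _ _ G.B.p R Q (r ≫ a.base) c hc
    obtain ⟨b, hb, hb'⟩ := a.exists_factor c r e
    refine ⟨b, ⟨(G.isHomLift_B_iff (P := R) (Q := P) r b).2 hb, hb'⟩, ?_⟩
    rintro b' ⟨h1, h2⟩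
    have hb1 := (G.isHomLift_B_iff (P := R) (Q := P) r b').1 h1
    exact a.factor_unique (hb1.trans hb.symm) (h2.trans hb'.symm)

theorem isFiberedInGroupoids_B : IsFiberedInGroupoids G.B :=
  .of_isStronglyCartesian
    (fun Q _ r => ⟨BObj.pull Q r, BObj.pullHom Q r,
      (G.isHomLift_B_iff (P := BObj.pull Q r) r (BObj.pullHom Q r)).2 rfl⟩)
    (fun _ _ φ => G.isStronglyCartesian_B φ)

end TopGroupoid

open PrincipalBundle

/-! ### Functors between categories of principal bundles -/

/-- A functor from principal `G`-bundles to principal `H`-bundles that preserves the base. -/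
structure BundleFunctor (G H : TopGroupoid.{u}) where
  obj : ∀ M : BObj G, PrincipalBundle H M.base
  map : ∀ {M N : BObj G}, (M ⟶ N) → C((obj M).total, (obj N).total)
  anchor_map : ∀ {M N : BObj G} (a : M ⟶ N) (p : (obj M).total),
    (obj N).anchor (map a p) = (obj M).anchor p
  map_smul : ∀ {M N : BObj G} (a : M ⟶ N) (p : (obj M).total) (γ : H.arr)
    (h : (obj M).anchor p = H.tgt γ),
    map a ((obj M).smul p γ h) = (obj N).smul (map a p) γ ((anchor_map a p).trans h)
  proj_map : ∀ {M N : BObj G} (a : M ⟶ N) (p : (obj M).total),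
    (obj N).proj (map a p) = Hom.toMap a.base ((obj M).proj p)
  map_id : ∀ (M : BObj G) (p : (obj M).total), map (𝟙 M) p = p
  map_comp : ∀ {M N O : BObj G} (a : M ⟶ N) (b : N ⟶ O) (p : (obj M).total),
    map (a ≫ b) p = map b (map a p)

namespace BObj

/-- The trivial bundle over the space of objects. -/
def unitObj (G : TopGroupoid.{u}) : BObj G := ⟨G.obj, PrincipalBundle.unit G⟩

variable {G : TopGroupoid.{u}} (M : BObj G)

/-- The pull-back of the trivial bundle to the total space of a bundle. -/
noncomputable def pullUnit : BObj G := (unitObj G).pull (ofMap M.bundle.anchor)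

/-- The canonical morphism to the trivial bundle. -/
noncomputable def pullUnitFst : M.pullUnit ⟶ unitObj G := (unitObj G).pullHom _

/-- The morphism given by the action. -/
noncomputable def pullUnitAct : M.pullUnit ⟶ M where
  base := ofMap M.bundle.proj
  map := M.bundle.act
  anchor_map z := M.bundle.anchor_act z
  map_act z γ h := (M.bundle.act_act z.fst z.snd γ z.condition h).symm
  proj_map z := M.bundle.proj_act z

/-- The trivial bundle pulled back to the total space is functorial. -/
noncomputable def pullUnitMap {M N : BObj G} (a : M ⟶ N) : M.pullUnit ⟶ N.pullUnit where
  base := ofMap a.map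
  map := ⟨fun z => pullback.mk (a.map z.fst) z.snd ((a.anchor_map _).trans z.condition),
    continuous_pullback_mk (a.map.continuous.comp CGTop.continuous_fst) CGTop.continuous_snd _⟩
  anchor_map _ := rfl
  map_act _ _ _ := rfl
  proj_map _ := rfl

theorem pullUnitMap_comp_act {M N : BObj G} (a : M ⟶ N) :
    pullUnitMap a ≫ N.pullUnitAct = M.pullUnitAct ≫ a :=
  Hom.ext_map fun z => (a.map_act z.fst z.snd z.condition).symm

theorem pullUnitMap_comp_fst {M N : BObj G} (a : M ⟶ N) :
    pullUnitMap a ≫ N.pullUnitFst = M.pullUnitFst :=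
  Hom.ext_map fun _ => rfl

end BObj

open BObj

namespace BundleFunctor

variable {G H : TopGroupoid.{u}} (L : BundleFunctor G H)

/-- The value of the functor, with its base. -/
def bobj (M : BObj G) : BObj H := ⟨M.base, L.obj M⟩

/-- The value of the functor on morphisms. -/
def hom {M N : BObj G} (a : M ⟶ N) : L.bobj M ⟶ L.bobj N where
  base := a.base
  map := L.map a
  anchor_map := L.anchor_map a
  map_act := L.map_smul a
  proj_map := L.proj_map a

theorem hom_id (M : BObj G) : L.hom (𝟙 M) = 𝟙 (L.bobj M) := Hom.ext_map fun p => L.map_id M p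

theorem hom_comp {M N O : BObj G} (a : M ⟶ N) (b : N ⟶ O) :
    L.hom (a ≫ b) = L.hom a ≫ L.hom b := Hom.ext_map fun p => L.map_comp a b p

/-- The value of the functor on the trivial bundle, which has a left action of `G`. -/
def P : PrincipalBundle H G.obj := L.obj (unitObj G)

/-! ### The left action on the value at the trivial bundle, and the recovery of the functor from it
-/

section Action

variable {M : BObj G}

/-- The identification of the value of the functor on `M` with the quotient of `M ×_{G.obj} P`. -/
noncomputable def act (m : M.bundle.total) (p : L.P.total) (h : M.bundle.anchor m = L.P.proj p) :
    (L.obj M).total :=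
  -- The pull-back of the trivial bundle to the total space of `M` maps to the trivial bundle (over
  -- the anchor) and, by the action, to `M` (over the projection). Under `L` both arrows stay
  -- bijective on fibres, so lifting along one and pushing along the other identifies the fibre of
  -- `P` at the anchor of `m` with the fibre of `L M` at the projection of `m`; `coact` is the same
  -- correspondence read backwards.
  L.map M.pullUnitAct ((L.hom M.pullUnitFst).lift m p h.symm)

/-- The inverse of the action of a point. -/
noncomputable def coact (m : M.bundle.total) (e : (L.obj M).total)
    (h : M.bundle.proj m = (L.obj M).proj e) : L.P.total :=
  L.map M.pullUnitFst ((L.hom M.pullUnitAct).lift m e h.symm)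

variable {L}

theorem act_congr {m m' : M.bundle.total} {p p' : L.P.total} (h₁ : m = m') (h₂ : p = p')
    (h : M.bundle.anchor m = L.P.proj p) : L.act m p h = L.act m' p' (by rw [← h₁, ← h₂, h]) := by
  subst h₁ h₂; rfl

theorem continuous_act {T : CGTop.{u}} {m : T → M.bundle.total} {p : T → L.P.total}
    (hm : Continuous m) (hp : Continuous p) (h : ∀ t, M.bundle.anchor (m t) = L.P.proj (p t)) :
    Continuous fun t => L.act (m t) (p t) (h t) :=
  (L.map M.pullUnitAct).continuous.comp
    ((L.hom M.pullUnitFst).continuous_lift hm hp fun t => (h t).symm)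

theorem continuous_coact {T : CGTop.{u}} {m : T → M.bundle.total} {e : T → (L.obj M).total}
    (hm : Continuous m) (he : Continuous e) (h : ∀ t, M.bundle.proj (m t) = (L.obj M).proj (e t)) :
    Continuous fun t => L.coact (m t) (e t) (h t) :=
  (L.map M.pullUnitFst).continuous.comp
    ((L.hom M.pullUnitAct).continuous_lift hm he fun t => (h t).symm)

theorem proj_act {m : M.bundle.total} {p : L.P.total} (h : M.bundle.anchor m = L.P.proj p) :
    (L.obj M).proj (L.act m p h) = M.bundle.proj m :=
  (L.proj_map _ _).trans
    (congrArg M.bundle.proj ((L.hom M.pullUnitFst).proj_lift (t := m) (q := p) h.symm))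

theorem anchor_act {m : M.bundle.total} {p : L.P.total} (h : M.bundle.anchor m = L.P.proj p) :
    (L.obj M).anchor (L.act m p h) = L.P.anchor p :=
  (L.anchor_map _ _).trans ((L.hom M.pullUnitFst).anchor_lift (t := m) (q := p) h.symm)

theorem proj_coact {m : M.bundle.total} {e : (L.obj M).total}
    (h : M.bundle.proj m = (L.obj M).proj e) :
    L.P.proj (L.coact m e h) = M.bundle.anchor m :=
  (L.proj_map _ _).trans
    (congrArg M.bundle.anchor ((L.hom M.pullUnitAct).proj_lift (t := m) (q := e) h.symm))

theorem anchor_coact {m : M.bundle.total} {e : (L.obj M).total}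
    (h : M.bundle.proj m = (L.obj M).proj e) :
    L.P.anchor (L.coact m e h) = (L.obj M).anchor e :=
  (L.anchor_map _ _).trans ((L.hom M.pullUnitAct).anchor_lift (t := m) (q := e) h.symm)

theorem act_coact {m : M.bundle.total} {e : (L.obj M).total}
    (h : M.bundle.proj m = (L.obj M).proj e) :
    L.act m (L.coact m e h) (proj_coact h).symm = e := by
  have h1 : (L.hom M.pullUnitAct).lift m e h.symm =
      (L.hom M.pullUnitFst).lift m (L.coact m e h) (proj_coact h) :=
    (L.hom M.pullUnitFst).eq_lift _ ((L.hom M.pullUnitAct).proj_lift (t := m) (q := e) h.symm) rfl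
  exact (congrArg (L.map M.pullUnitAct) h1.symm).trans
    ((L.hom M.pullUnitAct).map_lift (t := m) (q := e) h.symm)

theorem coact_act {m : M.bundle.total} {p : L.P.total} (h : M.bundle.anchor m = L.P.proj p) :
    L.coact m (L.act m p h) (proj_act h).symm = p := by
  have h1 : (L.hom M.pullUnitFst).lift m p h.symm =
      (L.hom M.pullUnitAct).lift m (L.act m p h) (proj_act h) :=
    (L.hom M.pullUnitAct).eq_lift _ ((L.hom M.pullUnitFst).proj_lift (t := m) (q := p) h.symm) rfl
  exact (congrArg (L.map M.pullUnitFst) h1.symm).trans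
    ((L.hom M.pullUnitFst).map_lift (t := m) (q := p) h.symm)

theorem coact_congr {m m' : M.bundle.total} {e e' : (L.obj M).total} (h₁ : m = m') (h₂ : e = e')
    (h : M.bundle.proj m = (L.obj M).proj e) :
    L.coact m e h = L.coact m' e' (by rw [← h₁, ← h₂, h]) := by
  subst h₁ h₂; rfl

theorem act_injective {m : M.bundle.total} {p p' : L.P.total} (h : M.bundle.anchor m = L.P.proj p)
    (h' : M.bundle.anchor m = L.P.proj p') (e : L.act m p h = L.act m p' h') : p = p' := by
  rw [← coact_act h, ← coact_act h']
  exact coact_congr rfl e _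

theorem act_smul {m : M.bundle.total} {p : L.P.total} {γ : H.arr}
    (h : M.bundle.anchor m = L.P.proj p) (hγ : L.P.anchor p = H.tgt γ) :
    L.act m (L.P.smul p γ hγ) (h.trans (proj_smul hγ).symm) =
      (L.obj M).smul (L.act m p h) γ ((anchor_act h).trans hγ) := by
  have hl := (L.hom M.pullUnitFst).anchor_lift (t := m) (q := p) h.symm
  have h1 : (L.obj M.pullUnit).smul ((L.hom M.pullUnitFst).lift m p h.symm) γ (hl.trans hγ) =
      (L.hom M.pullUnitFst).lift m (L.P.smul p γ hγ) (h.trans (proj_smul hγ).symm).symm := by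
    refine (L.hom M.pullUnitFst).eq_lift _ ?_ ?_
    · exact (proj_smul (E := L.obj M.pullUnit) _).trans
        ((L.hom M.pullUnitFst).proj_lift (t := m) (q := p) h.symm)
    · exact (L.map_smul _ _ _ _).trans
        (smul_congr ((L.hom M.pullUnitFst).map_lift (t := m) (q := p) h.symm) rfl _)
  exact (congrArg (L.map M.pullUnitAct) h1.symm).trans (L.map_smul _ _ _ _)

theorem map_act {N : BObj G} (a : M ⟶ N) {m : M.bundle.total} {p : L.P.total}
    (h : M.bundle.anchor m = L.P.proj p) :
    L.map a (L.act m p h) = L.act (a.map m) p ((a.anchor_map m).trans h) := by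
  have h1 : L.map (pullUnitMap a) ((L.hom M.pullUnitFst).lift m p h.symm) =
      (L.hom N.pullUnitFst).lift (a.map m) p ((a.anchor_map m).trans h).symm := by
    refine (L.hom N.pullUnitFst).eq_lift _ ?_ ?_
    · exact (L.proj_map _ _).trans
        (congrArg a.map ((L.hom M.pullUnitFst).proj_lift (t := m) (q := p) h.symm))
    · refine (L.map_comp _ _ _).symm.trans ?_
      rw [pullUnitMap_comp_fst]
      exact (L.hom M.pullUnitFst).map_lift (t := m) (q := p) h.symm
  refine (L.map_comp _ _ _).symm.trans ?_
  rw [← pullUnitMap_comp_act]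
  exact (L.map_comp _ _ _).trans (congrArg (L.map N.pullUnitAct) h1)

/-- The left action of `G`. -/
noncomputable def lact (L : BundleFunctor G H) (g : G.arr) (p : L.P.total)
    (h : G.src g = L.P.proj p) : L.P.total :=
  L.act (M := unitObj G) g p h

theorem proj_lact {g : G.arr} {p : L.P.total} (h : G.src g = L.P.proj p) :
    L.P.proj (L.lact g p h) = G.tgt g := proj_act (M := unitObj G) h

theorem anchor_lact {g : G.arr} {p : L.P.total} (h : G.src g = L.P.proj p) :
    L.P.anchor (L.lact g p h) = L.P.anchor p := anchor_act (M := unitObj G) h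

/-- The pair `(m, g)` is a point of the bundle `M.pullUnit`. Naturality of `act` at this one point,
along the action morphism and along the morphism to the trivial bundle, yields the two sides. -/
theorem smul_act {m : M.bundle.total} {g : G.arr} {p : L.P.total}
    (h : M.bundle.anchor m = G.tgt g) (h' : G.src g = L.P.proj p) :
    L.act (M.bundle.smul m g h) p ((anchor_smul h).trans h') =
      L.act m (L.lact g p h') (h.trans (proj_lact h').symm) := by
  let z : M.pullUnit.bundle.total := pullback.mk m g h
  have hz : M.pullUnit.bundle.anchor z = L.P.proj p := h'
  have h1 : L.map M.pullUnitAct (L.act z p hz) = L.act (M.bundle.smul m g h) p _ :=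
    map_act M.pullUnitAct hz
  have h2 : L.map M.pullUnitFst (L.act z p hz) = L.lact g p h' := map_act M.pullUnitFst hz
  have h3 : L.act z p hz =
      (L.hom M.pullUnitFst).lift m (L.lact g p h') (h.trans (proj_lact h').symm).symm :=
    (L.hom M.pullUnitFst).eq_lift _ (proj_act hz) h2
  exact h1.symm.trans (congrArg (L.map M.pullUnitAct) h3)

theorem mul_lact {g g' : G.arr} {p : L.P.total} (h : G.src g = G.tgt g')
    (h' : G.src g' = L.P.proj p) :
    L.lact (G.mul g g' h) p ((TopGroupoid.src_mul h).trans h') =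
      L.lact g (L.lact g' p h') (h.trans (proj_lact h').symm) :=
  smul_act (M := unitObj G) h h'

theorem lact_smul {g : G.arr} {p : L.P.total} {γ : H.arr} (h : G.src g = L.P.proj p)
    (hγ : L.P.anchor p = H.tgt γ) : L.lact g (L.P.smul p γ hγ) (h.trans (proj_smul hγ).symm) =
      L.P.smul (L.lact g p h) γ ((anchor_lact h).trans hγ) :=
  act_smul (M := unitObj G) h hγ

theorem lact_congr {g g' : G.arr} {p p' : L.P.total} (h₁ : g = g') (h₂ : p = p')
    (h : G.src g = L.P.proj p) : L.lact g p h = L.lact g' p' (by rw [← h₁, ← h₂, h]) := by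
  subst h₁ h₂; rfl

/-- The unit acts injectively and is idempotent, hence acts as the identity. -/
theorem unit_lact (p : L.P.total) : L.lact (G.unit (L.P.proj p)) p (G.src_unit _) = p := by
  have hu := G.src_unit (L.P.proj p)
  have ht := G.tgt_unit (L.P.proj p)
  refine act_injective (M := unitObj G) (m := G.unit (L.P.proj p))
    (hu.trans ((proj_lact hu).trans ht).symm) hu ?_
  refine (mul_lact (hu.trans ht.symm) hu).symm.trans (lact_congr ?_ rfl _)
  refine Eq.trans ?_ (TopGroupoid.mul_unit (G.unit (L.P.proj p)))
  exact TopGroupoid.mul_congr rfl (congrArg G.unit hu.symm) _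

theorem continuous_lact {T : CGTop.{u}} {g : T → G.arr} {p : T → L.P.total}
    (hg : Continuous g) (hp : Continuous p) (h : ∀ t, G.src (g t) = L.P.proj (p t)) :
    Continuous fun t => L.lact (g t) (p t) (h t) :=
  continuous_act (M := unitObj G) hg hp h

end Action

end BundleFunctor

open BundleFunctor

/-! ### The slice of a functor between principal bundles, and the groupoid presenting it -/

/-- A section of a principal bundle over a space that is étale over the base. -/
structure EtaleSection {H : TopGroupoid.{u}} (Q : BObj H) where
  space : CGTop.{u}
  toBase : C(space, Q.base)
  sec : C(space, Q.bundle.total)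
  isLocalHomeomorph : IsLocalHomeomorph toBase
  surjective : Function.Surjective toBase
  proj_sec : ∀ n, Q.bundle.proj (sec n) = toBase n

theorem EtaleSection.nonempty {H : TopGroupoid.{u}} (Q : BObj H) : Nonempty (EtaleSection Q) :=
  let ⟨N, c, s, h₁, h₂, h₃⟩ := Q.bundle.proj_local.exists_isLocalHomeomorph
  ⟨⟨N, c, s, h₁, h₂, h₃⟩⟩

theorem EtaleSection.admitsLocalSections {H : TopGroupoid.{u}} {Q : BObj H} (S : EtaleSection Q) :
    AdmitsLocalSections S.toBase := fun t => by
  obtain ⟨n, rfl⟩ := S.surjective t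
  obtain ⟨e, hne, he⟩ := S.isLocalHomeomorph n
  exact ⟨e.target, e.open_target, he ▸ e.map_source hne,
    ⟨fun v => e.symm v, e.continuousOn_symm.domRestrict⟩, fun v => he ▸ e.right_inv v.2⟩

namespace BundleFunctor

variable {G H : TopGroupoid.{u}} (L : BundleFunctor G H) {Q : BObj H}

variable (Q) in
/-- The objects of the slice of `L` over `Q`: bundles `M` with a morphism `L M ⟶ Q`. -/
structure Slice where
  left : BObj G
  str : L.bobj left ⟶ Q

namespace Slice

variable {L}

/-- The morphisms of the slice of `L` over `Q`. -/
@[ext]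
structure Hom (A B : L.Slice Q) where
  left : A.left ⟶ B.left
  w : L.hom left ≫ B.str = A.str

instance : Category (L.Slice Q) where
  Hom := Hom
  id A := ⟨𝟙 A.left, by rw [L.hom_id, Category.id_comp]⟩
  comp f g := ⟨f.left ≫ g.left, by rw [L.hom_comp, Category.assoc, g.w, f.w]⟩
  id_comp f := Hom.ext (Category.id_comp f.left)
  comp_id f := Hom.ext (Category.comp_id f.left)
  assoc f g h := Hom.ext (Category.assoc f.left g.left h.left)

end Slice

variable (Q) in
/-- The slice of `L` over `Q` as a category over `CGTop`. -/
def slice : BasedCategory.{u, u + 1} CGTop.{u} :=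
  BasedCategory.ofFunctor (𝒳 := L.Slice Q)
    { obj := fun A => A.left.base
      map := fun f => f.left.base }

variable (S : EtaleSection Q)

/-- The space of objects of the groupoid presenting the slice. -/
def sliceBase : CGTop.{u} := pullback L.P.anchor (Q.bundle.anchor.comp S.sec)

/-- The relation between `w` and `w'` that makes `g` an arrow from `w'` to `w`. -/
def SliceRel (w : L.sliceBase S) (g : G.arr) (w' : L.sliceBase S) : Prop :=
  -- A pair `(p, n)` stands for the trivial bundle at the image of `p`, with the structure map
  -- sending `p` to `sec n`. The arrow `g` respects the structure maps of `w'` and `w` exactly when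
  -- `g p' = p γ` and `sec n' = sec n γ` for one `γ`.
  ∃ (h : G.src g = L.P.proj w'.fst) (γ : H.arr) (h' : L.P.anchor w.fst = H.tgt γ),
    L.lact g w'.fst h = L.P.smul w.fst γ h' ∧
      S.sec w'.snd = Q.bundle.smul (S.sec w.snd) γ (w.condition.symm.trans h')

/-- The arrows of the groupoid presenting the slice. -/
@[ext]
structure SliceArr where
  left : L.sliceBase S
  arr : G.arr
  right : L.sliceBase S
  rel : L.SliceRel S left arr right

variable {L S}

namespace SliceRel

variable {w w' w'' : L.sliceBase S} {g g' : G.arr}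

theorem src (h : L.SliceRel S w g w') : G.src g = L.P.proj w'.fst := h.1

theorem tgt (h : L.SliceRel S w g w') : G.tgt g = L.P.proj w.fst := by
  obtain ⟨h1, γ, h2, h3, -⟩ := h
  rw [← proj_lact h1, h3, proj_smul]

theorem toBase (h : L.SliceRel S w g w') : S.toBase w'.snd = S.toBase w.snd := by
  obtain ⟨h1, γ, h2, -, h3⟩ := h
  rw [← S.proj_sec, ← S.proj_sec, h3, proj_smul]

theorem mul (h : L.SliceRel S w g w') (h' : L.SliceRel S w' g' w'') (e : G.src g = G.tgt g') :
    L.SliceRel S w (G.mul g g' e) w'' := by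
  obtain ⟨h1, γ, h2, h3, h4⟩ := h
  obtain ⟨h1', γ', h2', h3', h4'⟩ := h'
  have e' : H.src γ = H.tgt γ' := by
    rw [← h2', ← anchor_smul h2, ← h3, anchor_lact]
  refine ⟨(TopGroupoid.src_mul e).trans h1', H.mul γ γ' e', h2.trans (TopGroupoid.tgt_mul e').symm,
    ?_, ?_⟩
  · rw [← smul_smul h2 e', mul_lact e h1']
    refine (lact_congr rfl h3' _).trans ((lact_smul h1 h2').trans ?_)
    exact smul_congr h3 rfl _
  · rw [h4', ← smul_smul (w.condition.symm.trans h2) e']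
    exact smul_congr h4 rfl _

theorem unit (w : L.sliceBase S) : L.SliceRel S w (G.unit (L.P.proj w.fst)) w :=
  ⟨G.src_unit _, H.unit (L.P.anchor w.fst), (H.tgt_unit _).symm,
    (unit_lact _).trans (smul_unit _).symm,
    (smul_unit _).symm.trans (smul_congr rfl (congrArg H.unit w.condition.symm) _)⟩

theorem inv (h : L.SliceRel S w g w') : L.SliceRel S w' (G.inv g) w := by
  have h0 := h.tgt
  obtain ⟨h1, γ, h2, h3, h4⟩ := h
  have h5 : L.P.anchor w'.fst = H.tgt (H.inv γ) := by
    rw [H.tgt_inv, ← anchor_smul h2, ← h3, anchor_lact]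
  refine ⟨(G.src_inv g).trans h0, H.inv γ, h5, ?_, ?_⟩
  · have e : w.fst = L.lact g (L.P.smul w'.fst (H.inv γ) h5) (h1.trans (proj_smul h5).symm) := by
      rw [lact_smul h1 h5]
      exact ((smul_congr h3 rfl _).trans (smul_inv_smul h2)).symm
    refine (lact_congr rfl e _).trans ?_
    have e2 := mul_lact (L := L) (G.src_inv g) (h1.trans (proj_smul h5).symm)
    refine e2.symm.trans ((lact_congr ((TopGroupoid.inv_mul g).trans (congrArg G.unit
      (h1.trans (proj_smul h5).symm))) rfl _).trans (unit_lact _))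
  · exact ((smul_congr h4 rfl _).trans (smul_inv_smul _)).symm

end SliceRel

namespace SliceArr

variable (L S) in
/-- The arrows of the groupoid presenting the slice, as triples. -/
def ofKify (z : Kify {z : L.sliceBase S × G.arr × L.sliceBase S // L.SliceRel S z.1 z.2.1 z.2.2}) :
    L.SliceArr S := ⟨z.val.1.1, z.val.1.2.1, z.val.1.2.2, z.val.2⟩

instance : TopologicalSpace (L.SliceArr S) :=
  TopologicalSpace.coinduced (ofKify L S) inferInstance

theorem continuous_triple :
    Continuous fun k : L.SliceArr S => ((k.left, k.arr, k.right) : _ × _ × _) :=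
  continuous_coinduced_dom.2 (continuous_subtype_val.comp Kify.continuous_val)

theorem continuous_left : Continuous fun k : L.SliceArr S => k.left := continuous_triple.fst

theorem continuous_arr : Continuous fun k : L.SliceArr S => k.arr := continuous_triple.snd.fst

theorem continuous_right : Continuous fun k : L.SliceArr S => k.right := continuous_triple.snd.snd

theorem continuous_mk {T : Type u} [TopologicalSpace T] [CompactlyGeneratedSpace T]
    {w w' : T → L.sliceBase S} {g : T → G.arr} (hw : Continuous w) (hg : Continuous g)
    (hw' : Continuous w') (h : ∀ t, L.SliceRel S (w t) (g t) (w' t)) :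
    Continuous fun t => SliceArr.mk (w t) (g t) (w' t) (h t) :=
  (show Continuous (ofKify L S) from continuous_coinduced_rng).comp
    (Kify.continuous_of_val (h := fun t => ⟨⟨(w t, g t, w' t), h t⟩⟩)
      ((hw.prodMk (hg.prodMk hw')).subtype_mk h))

instance : T2Space (L.SliceArr S) :=
  T2Space.of_injective_continuous (fun _ _ h => SliceArr.ext (congrArg Prod.fst h)
    (congrArg (fun z => z.2.1) h) (congrArg (fun z => z.2.2) h)) continuous_triple

instance : CompactlyGeneratedSpace (L.SliceArr S) :=
  compactlyGeneratedSpace_of_coinduced continuous_coinduced_rng rfl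

end SliceArr

variable (L S) in
/-- The space of arrows of the groupoid presenting the slice. -/
def sliceArr : CGTop.{u} := ⟨L.SliceArr S⟩

theorem SliceArr.src_arr_eq {k k' : L.SliceArr S} (h : k.right = k'.left) :
    G.src k.arr = G.tgt k'.arr :=
  k.rel.src.trans ((congrArg (fun w : L.sliceBase S => L.P.proj w.fst) h).trans k'.rel.tgt.symm)

variable (L S)

/-- The groupoid presenting the slice. -/
def sliceGroupoid : TopGroupoid.{u} where
  obj := L.sliceBase S
  arr := L.sliceArr S
  src := ⟨fun k => k.right, SliceArr.continuous_right⟩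
  tgt := ⟨fun k => k.left, SliceArr.continuous_left⟩
  unit := ⟨fun w => SliceArr.mk w _ w (SliceRel.unit w), SliceArr.continuous_mk continuous_id
    (G.unit.continuous.comp (L.P.proj.continuous.comp CGTop.continuous_fst)) continuous_id _⟩
  inv := ⟨fun k => SliceArr.mk k.right _ k.left k.rel.inv,
    SliceArr.continuous_mk SliceArr.continuous_right
      (G.inv.continuous.comp SliceArr.continuous_arr) SliceArr.continuous_left _⟩
  comp := ⟨fun z => SliceArr.mk z.fst.left
      (G.mul z.fst.arr z.snd.arr (SliceArr.src_arr_eq z.condition)) z.snd.right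
      (z.fst.rel.mul (show L.SliceRel S z.fst.right _ _ from
        (show z.fst.right = z.snd.left from z.condition) ▸ z.snd.rel) _),
    SliceArr.continuous_mk (SliceArr.continuous_left.comp CGTop.continuous_fst)
      (TopGroupoid.continuous_mul (SliceArr.continuous_arr.comp CGTop.continuous_fst)
        (SliceArr.continuous_arr.comp CGTop.continuous_snd) _)
      (SliceArr.continuous_right.comp CGTop.continuous_snd) _⟩
  src_unit _ := rfl
  tgt_unit _ := rfl
  src_inv _ := rfl
  tgt_inv _ := rfl
  src_comp _ := rfl
  tgt_comp _ := rfl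
  unit_comp k := SliceArr.ext rfl ((TopGroupoid.mul_congr (congrArg G.unit k.rel.tgt.symm) rfl
    ((G.src_unit _).trans k.rel.tgt.symm)).trans (TopGroupoid.unit_mul _)) rfl
  comp_unit k := SliceArr.ext rfl ((TopGroupoid.mul_congr rfl (congrArg G.unit k.rel.src.symm)
    (k.rel.src.trans (G.tgt_unit _).symm)).trans (TopGroupoid.mul_unit _)) rfl
  inv_comp k := SliceArr.ext rfl
    ((TopGroupoid.inv_mul k.arr).trans (congrArg G.unit k.rel.src)) rfl
  comp_inv k := SliceArr.ext rfl
    ((TopGroupoid.mul_inv k.arr).trans (congrArg G.unit k.rel.tgt)) rfl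
  assoc _ _ _ h h' := SliceArr.ext rfl
    (TopGroupoid.mul_assoc' (SliceArr.src_arr_eq h) (SliceArr.src_arr_eq h')) rfl

/-! ### The principal bundle attached to an object of the slice -/

namespace Slice

variable {L} (A : L.Slice Q)

/-- The total space of the bundle associated with an object of the slice. -/
def total : CGTop.{u} := pullback ((CGTop.Hom.toMap A.str.base).comp A.left.bundle.proj) S.toBase

variable {S}

/-- The point of `Q` associated with a point of the total space, lifted along the structure map. -/
noncomputable def point (z : A.total S) : (L.obj A.left).total :=
  A.str.lift (A.left.bundle.proj z.fst) (S.sec z.snd) ((S.proj_sec _).trans z.condition.symm)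

theorem proj_point (z : A.total S) : A.left.bundle.proj z.fst = (L.obj A.left).proj (A.point z) :=
  (A.str.proj_lift _).symm

/-- The anchor of the bundle associated with an object of the slice. -/
noncomputable def anchor : C(A.total S, L.sliceBase S) :=
  -- A point `(m, n)` goes to `(p, n)`, where `p` is the only point of `P` for which the structure
  -- map sends `L.act m p` to `sec n`.
  ⟨fun z => pullback.mk (L.coact z.fst (A.point z) (A.proj_point z)) z.snd
    ((anchor_coact _).trans (A.str.anchor_lift _)),
   continuous_pullback_mk (continuous_coact CGTop.continuous_fst
    (A.str.continuous_lift (A.left.bundle.proj.continuous.comp CGTop.continuous_fst)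
      (S.sec.continuous.comp CGTop.continuous_snd)
      fun z => (S.proj_sec _).trans z.condition.symm) _) CGTop.continuous_snd _⟩

theorem proj_anchor_fst (z : A.total S) :
    A.left.bundle.anchor z.fst = L.P.proj (A.anchor z).fst := (proj_coact (A.proj_point z)).symm

theorem str_act_anchor (z : A.total S) :
    A.str.map (L.act z.fst (A.anchor z).fst (A.proj_anchor_fst z)) = S.sec z.snd :=
  (congrArg A.str.map (act_coact (A.proj_point z))).trans (A.str.map_lift _)

/-- Both the structure map and `L.act m` are injective on fibres, so the equation in
`str_act_anchor` characterises the anchor. All later anchors are computed through this criterion. -/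
theorem anchor_eq (z : A.total S) (w : L.sliceBase S) (h : w.snd = z.snd)
    (h₁ : A.left.bundle.anchor z.fst = L.P.proj w.fst)
    (h₂ : A.str.map (L.act z.fst w.fst h₁) = S.sec z.snd) : A.anchor z = w := by
  refine pullback_ext (act_injective (A.proj_anchor_fst z) h₁ ?_) h.symm
  exact A.str.map_injective ((proj_act _).trans (proj_act _).symm)
    ((A.str_act_anchor z).trans h₂.symm)

/-- With `p`, `p'` the points of `P` in the two anchors, `L.act (m g) p' = L.act m (g p')` lies in
the same fibre of `L M` as `L.act m p`. The arrow of `H` between these two points is the required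
`γ`. -/
theorem rel_anchor {z z' : A.total S} {g : G.arr} (h : A.left.bundle.anchor z.fst = G.tgt g)
    (hz : z'.fst = A.left.bundle.smul z.fst g h) :
    L.SliceRel S (A.anchor z) g (A.anchor z') := by
  have h1 : G.src g = L.P.proj (A.anchor z').fst := by
    rw [← A.proj_anchor_fst z', hz, anchor_smul]
  have h2 : L.act z'.fst (A.anchor z').fst (A.proj_anchor_fst z') =
      L.act z.fst (L.lact g _ h1) (h.trans (proj_lact h1).symm) :=
    (act_congr hz rfl _).trans (smul_act h h1)
  obtain ⟨γ, hγ, hγ'⟩ := exists_smul_eq (E := L.obj A.left)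
    (p := L.act z.fst (A.anchor z).fst (A.proj_anchor_fst z))
    (p' := L.act z.fst (L.lact g _ h1) (h.trans (proj_lact h1).symm))
    ((proj_act _).trans (proj_act _).symm)
  have hγ1 : L.P.anchor (A.anchor z).fst = H.tgt γ := (anchor_act _).symm.trans hγ
  refine ⟨h1, γ, hγ1, ?_, ?_⟩
  · refine act_injective (h.trans (proj_lact h1).symm)
      ((A.proj_anchor_fst z).trans (proj_smul hγ1).symm) ?_
    exact hγ'.symm.trans (act_smul (A.proj_anchor_fst z) hγ1).symm
  · refine (A.str_act_anchor z').symm.trans ((congrArg A.str.map (h2.trans hγ'.symm)).trans ?_)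
    exact (A.str.map_smul hγ).trans (smul_congr (A.str_act_anchor z) rfl _)

theorem anchor_eq_tgt {z : A.total S} {k : L.SliceArr S} (h : A.anchor z = k.left) :
    A.left.bundle.anchor z.fst = G.tgt k.arr :=
  (A.proj_anchor_fst z).trans ((congrArg (fun w : L.sliceBase S => L.P.proj w.fst) h).trans
    k.rel.tgt.symm)

theorem snd_eq {z : A.total S} {k : L.SliceArr S} (h : A.anchor z = k.left) :
    z.snd = k.left.snd := congrArg (fun w : L.sliceBase S => w.snd) h

/-- The action of the groupoid on the bundle associated with an object of the slice. -/
def smulPt (z : A.total S) (k : L.SliceArr S) (h : A.anchor z = k.left) : A.total S :=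
  pullback.mk (A.left.bundle.smul z.fst k.arr (A.anchor_eq_tgt h)) k.right.snd
    ((congrArg (Hom.toMap A.str.base) (proj_smul _)).trans (z.condition.trans
      ((congrArg S.toBase (A.snd_eq h)).trans k.rel.toBase.symm)))

/-- For an arrow of the slice groupoid with associated `γ`, acting by `m g` on `p'` is acting by `m`
on `g p' = p γ`. The structure map sends the result to `sec n γ = sec n'`. -/
theorem anchor_smulPt {z : A.total S} {k : L.SliceArr S} (h : A.anchor z = k.left) :
    A.anchor (A.smulPt z k h) = k.right := by
  obtain ⟨h1, γ, h2, h3, h4⟩ := k.rel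
  have h5 : A.left.bundle.anchor z.fst = L.P.proj k.left.fst :=
    (A.proj_anchor_fst z).trans (congrArg (fun w : L.sliceBase S => L.P.proj w.fst) h)
  refine A.anchor_eq _ _ rfl ((anchor_smul _).trans h1) ?_
  have h6 : L.act (A.smulPt z k h).fst k.right.fst ((anchor_smul _).trans h1) =
      (L.obj A.left).smul (L.act z.fst k.left.fst h5) γ ((anchor_act h5).trans h2) := by
    refine (smul_act (A.anchor_eq_tgt h) h1).trans ?_
    exact (act_congr rfl h3 _).trans (act_smul h5 h2)
  refine (congrArg A.str.map h6).trans ((A.str.map_smul _).trans (Eq.trans ?_ h4.symm))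
  refine smul_congr ?_ rfl _
  refine Eq.trans ?_ ((A.str_act_anchor z).trans (congrArg S.sec (A.snd_eq h)))
  exact congrArg A.str.map (act_congr rfl (congrArg (fun w : L.sliceBase S => w.fst) h.symm) _)

variable (S)

/-- The action map of the bundle associated with an object of the slice. -/
def actMap : C(pullback A.anchor (L.sliceGroupoid S).tgt, A.total S) :=
  ⟨fun z => A.smulPt z.fst z.snd z.condition,
    continuous_pullback_mk (PrincipalBundle.continuous_smul
      (CGTop.continuous_fst.comp CGTop.continuous_fst)
      (SliceArr.continuous_arr.comp CGTop.continuous_snd) _)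
      (CGTop.continuous_snd.comp (SliceArr.continuous_right.comp CGTop.continuous_snd)) _⟩

/-- The principal bundle associated with an object of the slice. -/
noncomputable def bundle : PrincipalBundle (L.sliceGroupoid S) A.left.base where
  total := A.total S
  proj := ⟨fun z => A.left.bundle.proj z.fst,
    A.left.bundle.proj.continuous.comp CGTop.continuous_fst⟩
  anchor := A.anchor
  act := A.actMap S
  anchor_act z := A.anchor_smulPt z.condition
  act_unit z := pullback_ext ((smul_congr rfl (congrArg G.unit (A.proj_anchor_fst z).symm)
    ((A.proj_anchor_fst z).trans (G.tgt_unit _).symm)).trans (smul_unit z.fst)) rfl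
  act_act z k k' h h' := pullback_ext
    (PrincipalBundle.smul_smul (A.anchor_eq_tgt h) (SliceArr.src_arr_eq h')) rfl
  proj_act z := proj_smul (E := A.left.bundle) _
  proj_local x := by
    obtain ⟨V, hV, hx, s, hs⟩ := A.left.bundle.proj_local x
    obtain ⟨O, hO, hxO, r, hr⟩ := S.admitsLocalSections (Hom.toMap A.str.base x)
    have hW : IsOpen (V ∩ Hom.toMap A.str.base ⁻¹' O) :=
      hV.inter (hO.preimage (Hom.toMap A.str.base).continuous)
    have := hW.compactlyGeneratedSpace
    have h : ∀ v : ↑(V ∩ Hom.toMap A.str.base ⁻¹' O),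
        (CGTop.Hom.toMap A.str.base).comp A.left.bundle.proj (s ⟨v, v.2.1⟩) =
          S.toBase (r ⟨Hom.toMap A.str.base (v : A.left.base), v.2.2⟩) := fun v =>
      (congrArg (Hom.toMap A.str.base) (hs _)).trans
        (hr ⟨Hom.toMap A.str.base (v : A.left.base), v.2.2⟩).symm
    exact ⟨_, hW, ⟨hx, hxO⟩, ⟨fun v => pullback.mk _ _ (h v), continuous_pullback_mk
      (s.continuous.comp (continuous_subtype_val.subtype_mk _))
      (r.continuous.comp (((Hom.toMap A.str.base).continuous.comp
        continuous_subtype_val).subtype_mk _)) h⟩, fun v => hs ⟨v, v.2.1⟩⟩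
  shear := shear_of_div (G := L.sliceGroupoid S) (act := A.actMap S)
    (proj := ⟨fun z : A.total S => A.left.bundle.proj z.fst,
      A.left.bundle.proj.continuous.comp CGTop.continuous_fst⟩)
    (fun z => proj_smul (E := A.left.bundle) _)
    -- The division in the new bundle is the division in `M`, framed by the two anchors;
    -- `rel_anchor` says that this is an arrow.
    ⟨fun z => SliceArr.mk (A.anchor z.fst)
        (A.left.bundle.div z.fst.fst z.snd.fst z.condition) (A.anchor z.snd)
        (A.rel_anchor (anchor_eq_tgt_div _) (smul_div _).symm),
      SliceArr.continuous_mk (A.anchor.continuous.comp CGTop.continuous_fst)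
        (continuous_div (CGTop.continuous_fst.comp CGTop.continuous_fst)
          (CGTop.continuous_fst.comp CGTop.continuous_snd) _)
        (A.anchor.continuous.comp CGTop.continuous_snd) _⟩
    (fun _ => rfl)
    (fun z => pullback_ext (smul_div _) rfl)
    (fun z => SliceArr.ext z.condition (div_eq (A.anchor_eq_tgt z.condition) _)
      (A.anchor_smulPt z.condition))

end Slice

end BundleFunctor

namespace BundleFunctor

variable {G H : TopGroupoid.{u}} {L : BundleFunctor G H} {Q : BObj H} (S : EtaleSection Q)

/-! ### Full faithfulness of the functor from the slice to bundles -/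

namespace Slice

/-- The object of the classifying stack associated with an object of the slice. -/
noncomputable def bobj (A : L.Slice Q) : BObj (L.sliceGroupoid S) := ⟨A.left.base, A.bundle S⟩

variable {S}

section Map

variable {A B : L.Slice Q} (f : A ⟶ B)

theorem Hom.str_map (e : (L.obj A.left).total) : B.str.map (L.map f.left e) = A.str.map e :=
  congrArg (fun φ : L.bobj A.left ⟶ Q => φ.map e) f.w

theorem Hom.str_base (x : A.left.base) : CGTop.Hom.toMap B.str.base
    (CGTop.Hom.toMap f.left.base x) = CGTop.Hom.toMap A.str.base x :=
  congrArg (fun φ : L.bobj A.left ⟶ Q => CGTop.Hom.toMap φ.base x) f.w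

/-- The image of a point under a morphism of the slice. -/
def mapPt (z : A.total S) : B.total S :=
  pullback.mk (f.left.map z.fst) z.snd
    ((congrArg (CGTop.Hom.toMap B.str.base) (f.left.proj_map z.fst)).trans
      ((Hom.str_base f _).trans z.condition))

theorem anchor_mapPt (z : A.total S) : B.anchor (mapPt f z) = A.anchor z := by
  refine B.anchor_eq _ _ rfl ((f.left.anchor_map _).trans (A.proj_anchor_fst z)) ?_
  refine Eq.trans ?_ (A.str_act_anchor z)
  exact (congrArg B.str.map (map_act f.left (A.proj_anchor_fst z)).symm).trans (Hom.str_map f _)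

end Map

variable (S) in
/-- The morphism of the classifying stack associated with a morphism of the slice. -/
noncomputable def bmap {A B : L.Slice Q} (f : A ⟶ B) : A.bobj S ⟶ B.bobj S where
  base := f.left.base
  map := ⟨mapPt f, continuous_pullback_mk (f.left.map.continuous.comp CGTop.continuous_fst)
    CGTop.continuous_snd _⟩
  anchor_map z := anchor_mapPt f z
  map_act _ _ h := pullback_ext (f.left.map_smul (A.anchor_eq_tgt h)) rfl
  proj_map z := f.left.proj_map z.fst

section Full

variable {A B : L.Slice Q} (b : A.bobj S ⟶ B.bobj S)

theorem snd_map (z : A.total S) : (show B.total S from b.map z).snd = z.snd :=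
  congrArg (fun w : L.sliceBase S => w.snd) (b.anchor_map z)

/-- By `rel_anchor`, whenever the `M`-components of `z` and `z'` differ by `g`, the two points
differ by an arrow of the slice groupoid with component `g`, whatever their étale components are.
Equivariance of `b` does the rest. -/
theorem fst_map_smul {z z' : A.total S} {g : G.arr} (h : A.left.bundle.anchor z.fst = G.tgt g)
    (hz : z'.fst = A.left.bundle.smul z.fst g h)
    (h' : B.left.bundle.anchor (show B.total S from b.map z).fst = G.tgt g) :
    (show B.total S from b.map z').fst =
      B.left.bundle.smul (show B.total S from b.map z).fst g h' := by
  let k : L.SliceArr S := ⟨A.anchor z, g, A.anchor z', A.rel_anchor h hz⟩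
  have e : z' = A.smulPt z k rfl := pullback_ext hz rfl
  have e' : b.map z' = (B.bobj S).bundle.smul (b.map z) k (b.anchor_map z) :=
    (congrArg b.map e).trans (b.map_smul (P := A.bobj S) (γ := k) rfl)
  exact congrArg (fun z : B.total S => z.fst) e'

theorem anchor_fst_map (z : A.total S) :
    B.left.bundle.anchor (show B.total S from b.map z).fst = A.left.bundle.anchor z.fst :=
  (B.proj_anchor_fst _).trans ((congrArg (fun w : L.sliceBase S => L.P.proj w.fst)
    (b.anchor_map z)).trans (A.proj_anchor_fst z).symm)

/-- The case of a unit arrow in `fst_map_smul`: changing only the étale component does not affect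
the first component of the image, so `b` descends to the total space of `A.left`. -/
theorem fst_map_eq {z z' : A.total S} (h : z.fst = z'.fst) :
    (show B.total S from b.map z).fst = (show B.total S from b.map z').fst := by
  have h1 := (A.left.bundle.smul_unit z'.fst).symm
  rw [fst_map_smul b (z := z') (z' := z) (G.tgt_unit _).symm (h.trans h1)
    ((anchor_fst_map b z').trans (G.tgt_unit _).symm)]
  exact (smul_congr rfl (congrArg G.unit (anchor_fst_map b z').symm) _).trans (smul_unit _)

variable (S) in
theorem exists_total (m : A.left.bundle.total) : ∃ z : A.total S, z.fst = m :=
  let ⟨n, hn⟩ := S.surjective (CGTop.Hom.toMap A.str.base (A.left.bundle.proj m))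
  ⟨pullback.mk m n hn.symm, rfl⟩

/-- The map of total spaces underlying a morphism of the slice. -/
noncomputable def preimageMap (m : A.left.bundle.total) : B.left.bundle.total :=
  (show B.total S from b.map (exists_total S m).choose).fst

theorem preimageMap_fst (z : A.total S) :
    preimageMap b z.fst = (show B.total S from b.map z).fst :=
  fst_map_eq b (exists_total S z.fst).choose_spec

/-- Locally on the base, a section of the étale map lifts points of the total space of `A.left`
continuously to `A.total S`, where the map is read off from `b`. -/
theorem continuous_preimageMap : Continuous (preimageMap b) := by
  refine continuous_of_local fun m => ?_
  obtain ⟨O, hO, hm, r, hr⟩ := S.admitsLocalSections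
    (CGTop.Hom.toMap A.str.base (A.left.bundle.proj m))
  let t : A.left.bundle.total → Q.base :=
    fun m => CGTop.Hom.toMap A.str.base (A.left.bundle.proj m)
  have ht : Continuous t :=
    (CGTop.Hom.toMap A.str.base).continuous.comp A.left.bundle.proj.continuous
  have hW : IsOpen (t ⁻¹' O) := hO.preimage ht
  have := hW.compactlyGeneratedSpace
  let z : t ⁻¹' O → A.total S := fun v => pullback.mk (v : A.left.bundle.total) (r ⟨t v, v.2⟩)
    (hr ⟨t v, v.2⟩).symm
  have hz : Continuous z := continuous_pullback_mk continuous_subtype_val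
    (r.continuous.comp ((ht.comp continuous_subtype_val).subtype_mk _)) _
  refine ⟨_, hW, hm, ?_⟩
  have e : (fun v : t ⁻¹' O => preimageMap b (v : A.left.bundle.total)) =
      fun v => (show B.total S from b.map (z v)).fst := funext fun v => preimageMap_fst b (z v)
  rw [e]
  exact CGTop.continuous_fst.comp (b.map.continuous.comp hz)

/-- The morphism of bundles underlying a morphism of the slice. -/
noncomputable def preimageHom : A.left ⟶ B.left where
  base := b.base
  map := ⟨preimageMap b, continuous_preimageMap b⟩
  anchor_map m := by
    obtain ⟨z, rfl⟩ := exists_total S m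
    exact (congrArg B.left.bundle.anchor (preimageMap_fst b z)).trans (anchor_fst_map b z)
  map_act m g h := by
    obtain ⟨z, rfl⟩ := exists_total S m
    obtain ⟨z', hz'⟩ := exists_total S (A.left.bundle.smul z.fst g h)
    refine (congrArg (preimageMap b) hz'.symm).trans ((preimageMap_fst b z').trans ?_)
    exact (fst_map_smul b h hz' ((anchor_fst_map b z).trans h)).trans
      (smul_congr (preimageMap_fst b z).symm rfl _)
  proj_map m := by
    obtain ⟨z, rfl⟩ := exists_total S m
    exact (congrArg B.left.bundle.proj (preimageMap_fst b z)).trans (b.proj_map z)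

/-- Every point of `L A.left` is the translate by some arrow of `H` of an `L.act m p` with `(p, n)`
the anchor of some `(m, n)`. On such points both sides equal `sec n`, because `b` preserves anchors.
-/
theorem preimageHom_w : L.hom (preimageHom b) ≫ B.str = A.str := by
  refine BObj.Hom.ext_map fun e => ?_
  change B.str.map (L.map (preimageHom b) e) = A.str.map e
  obtain ⟨m, hm⟩ := A.left.bundle.proj_surjective ((L.obj A.left).proj e)
  obtain ⟨z, rfl⟩ := exists_total S m
  obtain ⟨γ, hγ, rfl⟩ := exists_smul_eq ((proj_act (A.proj_anchor_fst z)).trans hm)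
  have h1 : B.str.map (L.map (preimageHom b) (L.act z.fst (A.anchor z).fst (A.proj_anchor_fst z)))
      = A.str.map (L.act z.fst (A.anchor z).fst (A.proj_anchor_fst z)) := by
    refine (congrArg B.str.map (map_act (preimageHom b) (A.proj_anchor_fst z))).trans ?_
    refine Eq.trans ?_ ((B.str_act_anchor (b.map z)).trans
      ((congrArg S.sec (snd_map b z)).trans (A.str_act_anchor z).symm))
    exact congrArg B.str.map (act_congr (preimageMap_fst b z)
      (congrArg (fun w : L.sliceBase S => w.fst) (b.anchor_map z).symm) _)
  refine (congrArg B.str.map (L.map_smul _ _ _ hγ)).trans ((B.str.map_smul _).trans ?_)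
  exact (smul_congr h1 rfl _).trans (A.str.map_smul hγ).symm

/-- A morphism of the slice from a morphism of the associated bundles. -/
noncomputable def preimage : A ⟶ B := ⟨preimageHom b, preimageHom_w b⟩

theorem bmap_preimage : bmap S (preimage b) = b :=
  BObj.Hom.ext_map fun z => pullback_ext (preimageMap_fst b z) (snd_map b z).symm

end Full

theorem bmap_injective {A B : L.Slice Q} {f f' : A ⟶ B} (h : bmap S f = bmap S f') : f = f' := by
  refine Hom.ext (BObj.Hom.ext_map fun m => ?_)
  obtain ⟨z, rfl⟩ := exists_total S m
  exact congrArg (fun φ : A.bobj S ⟶ B.bobj S => (show B.total S from φ.map z).fst) h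

end Slice

/-- The functor from the slice to the classifying stack of the groupoid presenting it. -/
noncomputable def sliceFunctor : L.slice Q ⥤ᵇ (L.sliceGroupoid S).B where
  obj A := Slice.bobj S A
  map f := Slice.bmap S f
  map_id _ := rfl
  map_comp _ _ := rfl
  w := rfl

instance : (sliceFunctor (L := L) S).toFunctor.Full :=
  ⟨fun b => ⟨Slice.preimage b, Slice.bmap_preimage b⟩⟩

instance : (sliceFunctor (L := L) S).toFunctor.Faithful := ⟨fun h => Slice.bmap_injective h⟩

variable {S}

/-- A bundle with a section over a space comes from the slice over this space. -/
theorem exists_slice_hom (E : BObj (L.sliceGroupoid S)) {V : CGTop.{u}} (j : V ⟶ E.base)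
    (τ : C(V, E.bundle.total)) (hτ : ∀ v, E.bundle.proj (τ v) = Hom.toMap j v) :
    ∃ (A : L.Slice Q) (θ : A.bobj S ⟶ E), (L.sliceGroupoid S).B.p.IsHomLift j θ := by
  -- The anchor of the section writes down the object of the slice: its first component gives the
  -- trivial bundle `M`, with section `m₀` and hence a section `e` of `L M`, and its second gives
  -- the point of `Q` to which `e` must go.
  let w : C(V, L.sliceBase S) := E.bundle.anchor.comp τ
  have hw : Continuous w := w.continuous
  let x : C(V, G.obj) := ⟨fun v => L.P.proj (w v).fst,
    L.P.proj.continuous.comp (CGTop.continuous_fst.comp hw)⟩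
  let M : BObj G := (unitObj G).pull (ofMap x)
  let m₀ : C(V, M.bundle.total) := ⟨fun v => pullback.mk v (G.unit (x v)) (G.tgt_unit _).symm,
    continuous_pullback_mk continuous_id (G.unit.continuous.comp x.continuous) _⟩
  have hm₀ : ∀ v, M.bundle.anchor (m₀ v) = L.P.proj (w v).fst := fun v => G.src_unit (x v)
  let e : C(V, (L.obj M).total) := ⟨fun v => L.act (m₀ v) (w v).fst (hm₀ v),
    continuous_act m₀.continuous (CGTop.continuous_fst.comp hw) hm₀⟩
  let s : C(V, Q.bundle.total) := ⟨fun v => S.sec (w v).snd,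
    S.sec.continuous.comp (CGTop.continuous_snd.comp hw)⟩
  let t : C(V, Q.base) := ⟨fun v => S.toBase (w v).snd,
    S.toBase.continuous.comp (CGTop.continuous_snd.comp hw)⟩
  obtain ⟨str, hstr, hstr'⟩ := BObj.exists_hom_of_section (P := L.bobj M) (Q := Q) e
    (fun v => proj_act (hm₀ v)) (ofMap t) s (fun v => S.proj_sec _)
    (fun v => (anchor_act (hm₀ v)).trans (w v).condition)
  let A : L.Slice Q := ⟨M, str⟩
  let z₀ : C(V, A.total S) := ⟨fun v => pullback.mk (m₀ v) (w v).snd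
      (congrArg (fun φ : V ⟶ Q.base => Hom.toMap φ v) hstr),
    continuous_pullback_mk m₀.continuous (CGTop.continuous_snd.comp hw) _⟩
  -- The section `z₀` has anchor `w` by construction, the same as `τ`, so it may be sent to `τ`.
  obtain ⟨θ, hθ, -⟩ := BObj.exists_hom_of_section (P := A.bobj S) (Q := E) z₀ (fun v => rfl) j τ hτ
    (fun v => A.anchor_eq (z₀ v) (w v) rfl (hm₀ v) (hstr' v))
  exact ⟨A, θ, (TopGroupoid.isHomLift_B_iff (G := L.sliceGroupoid S) (P := A.bobj S) j θ).2 hθ⟩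

end BundleFunctor

/-! ### Essential surjectivity is a local property -/

section Descent

variable {D : BasedCategory.{v₁, u₁} CGTop.{u}} {B : BasedCategory.{v₂, u₂} CGTop.{u}}

/-- Objects of `D` over the members of a sieve whose images are restrictions of a given object
form a descent datum. -/
theorem IsFiberedInGroupoids.exists_descentDatum (hB : IsFiberedInGroupoids B) (F : D ⥤ᵇ B)
    [F.toFunctor.Full] [F.toFunctor.Faithful] {T : CGTop.{u}} (S : Sieve T) (E : B.obj)
    (h : ∀ s : (sieveCategory S).obj, ∃ (d : D.obj) (θ : F.obj d ⟶ E),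
      B.p.IsHomLift s.obj.hom θ) :
    ∃ (A : sieveCategory S ⥤ᵇ D) (θ : ∀ s, F.obj (A.obj s) ⟶ E),
      (∀ s, B.p.IsHomLift s.obj.hom (θ s)) ∧
        ∀ {s s' : (sieveCategory S).obj} (φ : s ⟶ s'), F.map (A.map φ) ≫ θ s' = θ s := by
  choose d θ hθ using h
  have hw : ∀ {s s' : (sieveCategory S).obj} (φ : s ⟶ s'),
      (sieveCategory S).p.map φ ≫ s'.obj.hom = s.obj.hom := fun φ => Over.w φ.hom
  -- The transition arrows are the unique factorisations through the Cartesian arrows to `E`.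
  -- Uniqueness gives functoriality, and full faithfulness carries everything back to `D`.
  have hχ : ∀ {s s' : (sieveCategory S).obj} (φ : s ⟶ s'), ∃ χ : F.obj (d s) ⟶ F.obj (d s'),
      B.p.IsHomLift ((sieveCategory S).p.map φ) χ ∧ χ ≫ θ s' = θ s := fun {s s'} φ =>
    hB.exists_factor (hθ s') ((hw φ).symm ▸ hθ s)
  choose χ hχ₁ hχ₂ using @hχ
  let A : (sieveCategory S).obj ⥤ D.obj :=
    { obj := d
      map := fun φ => F.toFunctor.preimage (χ φ)
      map_id := fun s => F.toFunctor.map_injective (by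
        rw [F.toFunctor.map_preimage, F.toFunctor.map_id]
        refine hB.hom_ext (θ s) (hχ₁ (𝟙 s)) ?_ ((hχ₂ (𝟙 s)).trans (Category.id_comp _).symm)
        rw [CategoryTheory.Functor.map_id]
        exact IsHomLift.id (@IsHomLift.domain_eq _ _ _ _ B.p _ _ _ _ _ _ (hθ s)))
      map_comp := fun {s s' s''} φ ψ => F.toFunctor.map_injective (by
        rw [F.toFunctor.map_comp, F.toFunctor.map_preimage, F.toFunctor.map_preimage,
          F.toFunctor.map_preimage]
        have := hχ₁ φ
        have := hχ₁ ψ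
        refine hB.hom_ext (θ s'') (hχ₁ (φ ≫ ψ)) ?_ ?_
        · rw [CategoryTheory.Functor.map_comp]
          infer_instance
        · rw [hχ₂, Category.assoc, hχ₂, hχ₂]) }
  have hl : ∀ {s s' : (sieveCategory S).obj} (φ : s ⟶ s'),
      D.p.IsHomLift ((sieveCategory S).p.map φ) (A.map φ) := fun φ => by
    rw [← F.isHomLift_iff]
    change B.p.IsHomLift _ (F.map (F.toFunctor.preimage (χ φ)))
    rw [F.toFunctor.map_preimage]
    exact hχ₁ φ
  have hA : A ⋙ D.p = (sieveCategory S).p :=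
    CategoryTheory.Functor.ext (fun s => @IsHomLift.domain_eq _ _ _ _ D.p _ _ _ _ _ _ (hl (𝟙 s)))
      fun s s' φ => by
        have := hl φ
        exact IsHomLift.fac' D.p ((sieveCategory S).p.map φ) (A.map φ)
  refine ⟨⟨A, hA⟩, θ, hθ, fun φ => ?_⟩
  · change F.map (F.toFunctor.preimage (χ φ)) ≫ _ = _
    rw [F.toFunctor.map_preimage, hχ₂]

end Descent

/-! ### Gluing morphisms of principal bundles -/

namespace BObj

variable {K : TopGroupoid.{u}} {P Q : BObj K}

/-- The projection of a bundle whose base is known to be a given space. -/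
def projTo (P : BObj K) {T : CGTop.{u}} (h : P.base = T) : C(P.bundle.total, T) :=
  (Hom.toMap (eqToHom h)).comp P.bundle.proj

section

variable {R S : CGTop.{u}} {r : R ⟶ S} {a : P ⟶ Q}
  (h : Functor.IsHomLift K.B.p (a := P) (b := Q) r a) (hP : P.base = R) (hQ : Q.base = S)

include h in
theorem projTo_map (p : P.bundle.total) :
    Q.projTo hQ (a.map p) = Hom.toMap r (P.projTo hP p) := by
  subst hP hQ
  rw [K.isHomLift_B_iff] at h
  subst h
  exact a.proj_map p

theorem eq_of_projTo_eq {p p' : P.bundle.total} (h₁ : P.projTo hP p = P.projTo hP p')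
    (h₂ : a.map p = a.map p') : p = p' := by
  subst hP
  exact a.map_injective h₁ h₂

include h in
theorem exists_lift_projTo {T : Type u} [TopologicalSpace T] [CompactlyGeneratedSpace T]
    [T2Space T] (t : C(T, R)) (q : C(T, Q.bundle.total))
    (hq : ∀ x, Q.projTo hQ (q x) = Hom.toMap r (t x)) :
    ∃ l : C(T, P.bundle.total), (∀ x, P.projTo hP (l x) = t x) ∧ ∀ x, a.map (l x) = q x := by
  subst hP hQ
  rw [K.isHomLift_B_iff] at h
  subst h
  exact ⟨⟨fun x => a.lift (t x) (q x) (hq x),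
    Hom.continuous_lift (T := ⟨T⟩) a t.continuous q.continuous hq⟩,
    fun x => a.proj_lift (hq x), fun x => a.map_lift (hq x)⟩

end

end BObj

theorem BObj.exists_hom_of_projTo_eq {K : TopGroupoid.{u}} {P Q : BObj K} {T : CGTop.{u}}
    (hP : P.base = T) (hQ : Q.base = T) (b : C(P.bundle.total, Q.bundle.total))
    (h₁ : ∀ p, Q.bundle.anchor (b p) = P.bundle.anchor p)
    (h₂ : ∀ (p : P.bundle.total) (γ : K.arr) (e : P.bundle.anchor p = K.tgt γ),
      b (P.bundle.smul p γ e) = Q.bundle.smul (b p) γ ((h₁ p).trans e))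
    (h₃ : ∀ p, Q.projTo hQ (b p) = P.projTo hP p) :
    ∃ a : P ⟶ Q, Functor.IsHomLift K.B.p (a := P) (b := Q) (𝟙 T) a := by
  subst hP
  obtain ⟨T, Q⟩ := Q
  obtain rfl : T = P.base := hQ
  exact ⟨⟨𝟙 P.base, b, h₁, h₂, h₃⟩, (K.isHomLift_B_iff (P := P) (Q := ⟨P.base, Q⟩) _ _).2 rfl⟩

/-- Morphisms of principal bundles over the identity can be defined locally on the base. -/
theorem BObj.exists_glue {K : TopGroupoid.{u}} {T : CGTop.{u}} {ι : Type u} {V : ι → CGTop.{u}}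
    {σ : ∀ i, V i ⟶ T} (hσ : IsOpenCover σ) {P E : K.B.obj} (hP : K.B.p.obj P = T)
    (hE : K.B.p.obj E = T) (A : sieveCategory (Sieve.ofArrows V σ) ⥤ᵇ K.B)
    (h : ∀ s, A.obj s ⟶ P) (k : ∀ s, A.obj s ⟶ E)
    (hh : ∀ s, K.B.p.IsHomLift s.obj.hom (h s)) (hk : ∀ s, K.B.p.IsHomLift s.obj.hom (k s))
    (hn : ∀ {s s'} (φ : s ⟶ s'), A.map φ ≫ h s' = h s)
    (kn : ∀ {s s'} (φ : s ⟶ s'), A.map φ ≫ k s' = k s) :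
    ∃ b : P ⟶ E, K.B.p.IsHomLift (𝟙 T) b := by
  let P' : BObj K := P
  let E' : BObj K := E
  let R : ∀ s : (sieveCategory (Sieve.ofArrows V σ)).obj, BObj K := fun s => A.obj s
  let N : ∀ {s s'} (φ : s ⟶ s'), R s ⟶ R s' := fun φ => A.map φ
  let h' : ∀ s, R s ⟶ P' := h
  let k' : ∀ s, R s ⟶ E' := k
  have hR : ∀ s, (R s).base = s.obj.left := fun s => A.w_obj s
  have hn' : ∀ {s s'} (φ : s ⟶ s') (w : (R s).bundle.total),
      (h' s').map ((N φ).map w) = (h' s).map w := fun {s s'} φ w =>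
    congrArg (fun a : R s ⟶ P' => a.map w) (hn φ)
  have kn' : ∀ {s s'} (φ : s ⟶ s') (w : (R s).bundle.total),
      (k' s').map ((N φ).map w) = (k' s).map w := fun {s s'} φ w =>
    congrArg (fun a : R s ⟶ E' => a.map w) (kn φ)
  have hb : ∀ s (z : (R s).bundle.total),
      P'.projTo hP ((h' s).map z) = Hom.toMap s.obj.hom ((R s).projTo (hR s) z) := fun s z =>
    projTo_map (hh s) (hR s) hP z
  have kb : ∀ s (z : (R s).bundle.total),
      E'.projTo hE ((k' s).map z) = Hom.toMap s.obj.hom ((R s).projTo (hR s) z) := fun s z =>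
    projTo_map (hk s) (hR s) hE z
  -- Any point of a local bundle can be moved to the bundle over the one-point object of the sieve
  -- without changing its images in `P` and `E`.
  have hpt : ∀ s (z : (R s).bundle.total) (x : T)
      (_ : Hom.toMap s.obj.hom ((R s).projTo (hR s) z) = x),
      ∃ w : (R (hσ.pt x)).bundle.total, (h' _).map w = (h' s).map z ∧
        (k' _).map w = (k' s).map z := by
    rintro s z x rfl
    let φ := hσ.ptHom s ((R s).projTo (hR s) z)
    have hN : K.B.p.IsHomLift ((sieveCategory (Sieve.ofArrows V σ)).p.map φ) (A.map φ) :=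
      inferInstance
    obtain ⟨l, -, hl⟩ := exists_lift_projTo (T := point) (a := N φ) hN
      (hR _) (hR s) (ContinuousMap.id point) (ContinuousMap.const point z) fun _ => rfl
    refine ⟨l PUnit.unit, ?_, ?_⟩
    · exact (hn' φ _).symm.trans (congrArg _ (hl _))
    · exact (kn' φ _).symm.trans (congrArg _ (hl _))
  -- Two local points with the same image in `P` move to the same one-point object. There,
  -- injectivity on the fibre makes them equal, so their images in `E` agree. This replaces a
  -- comparison on overlaps.
  have compat : ∀ s s' (z : (R s).bundle.total) (z' : (R s').bundle.total),
      (h' s).map z = (h' s').map z' → (k' s).map z = (k' s').map z' := by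
    intro s s' z z' e
    obtain ⟨w, hw, hw'⟩ := hpt s z _ (hb s z).symm
    obtain ⟨v, hv, hv'⟩ := hpt s' z' (P'.projTo hP ((h' s).map z)) (by rw [e, hb])
    have : w = v := eq_of_projTo_eq (a := h' _) (hR _) (Subsingleton.elim (α := PUnit) _ _)
      (hw.trans (e.trans hv.symm))
    rw [← hw', ← hv', this]
  have hsurj : ∀ p, ∃ i, ∃ z : (R (hσ.mem i)).bundle.total, (h' (hσ.mem i)).map z = p := fun p => by
    obtain ⟨i, y, hy⟩ := hσ.2 (P'.projTo hP p)
    obtain ⟨l, -, hl⟩ := exists_lift_projTo (T := point) (hh (hσ.mem i)) (hR _) hP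
      (ContinuousMap.const point y) (ContinuousMap.const point p) fun _ => hy.symm
    exact ⟨i, l PUnit.unit, hl _⟩
  choose i z hz using hsurj
  let b : P'.bundle.total → E'.bundle.total := fun p => (k' (hσ.mem (i p))).map (z p)
  have hbk : ∀ i (w : (R (hσ.mem i)).bundle.total),
      b ((h' (hσ.mem i)).map w) = (k' (hσ.mem i)).map w := fun _ _ => compat _ _ _ _ (hz _)
  -- The chosen preimages `z p` need not vary continuously. Over a member of the cover, `b` is
  -- computed with a continuous lift instead, which `compat` permits.
  have hbc : Continuous b := by
    refine continuous_of_local fun p => ?_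
    obtain ⟨j, y, hy⟩ := hσ.2 (P'.projTo hP p)
    have ho : Topology.IsOpenEmbedding (Hom.toMap (σ j)) := hσ.1 j
    have hO : IsOpen (P'.projTo hP ⁻¹' Set.range (Hom.toMap (σ j))) :=
      ho.isOpen_range.preimage (P'.projTo hP).continuous
    have := hO.compactlyGeneratedSpace
    refine ⟨_, hO, ⟨y, hy⟩, ?_⟩
    let t : C(P'.projTo hP ⁻¹' Set.range (Hom.toMap (σ j)), V j) :=
      ⟨fun v => ho.toIsEmbedding.toHomeomorph.symm ⟨P'.projTo hP v, v.2⟩,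
        ho.toIsEmbedding.toHomeomorph.symm.continuous.comp
          (((P'.projTo hP).continuous.comp continuous_subtype_val).subtype_mk _)⟩
    obtain ⟨l, -, hl⟩ := exists_lift_projTo (hh (hσ.mem j)) (hR _) hP t
      ⟨fun v => v.1, continuous_subtype_val⟩ fun v =>
        (congrArg Subtype.val (ho.toIsEmbedding.toHomeomorph.apply_symm_apply
          ⟨P'.projTo hP v, v.2⟩)).symm
    have e : (fun v : P'.projTo hP ⁻¹' Set.range (Hom.toMap (σ j)) => b v) =
        fun v => (k' (hσ.mem j)).map (l v) :=
      funext fun v => (congrArg b (hl v).symm).trans (hbk j _)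
    rw [e]
    exact (k' (hσ.mem j)).map.continuous.comp l.continuous
  have hbase : (P'.base : CGTop.{u}) = E'.base := hP.trans hE.symm
  have hproj : ∀ p, E'.projTo hE (b p) = P'.projTo hP p := fun p =>
    (kb _ _).trans ((hb _ _).symm.trans (congrArg _ (hz p)))
  have hanchor : ∀ p, E'.bundle.anchor (b p) = P'.bundle.anchor p := fun p =>
    ((k' _).anchor_map _).trans (((h' _).anchor_map _).symm.trans (congrArg _ (hz p)))
  have hsmul : ∀ (p : P'.bundle.total) (γ : K.arr) (e : P'.bundle.anchor p = K.tgt γ),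
      b (P'.bundle.smul p γ e) = E'.bundle.smul (b p) γ ((hanchor p).trans e) := fun p γ e => by
    have e' := ((h' (hσ.mem (i p))).anchor_map (z p)).symm.trans ((congrArg _ (hz p)).trans e)
    refine (congrArg b ((smul_congr (hz p).symm rfl _).trans
      ((h' _).map_smul e').symm)).trans ((hbk _ _).trans ((k' _).map_smul e'))
  exact exists_hom_of_projTo_eq hP hE ⟨b, hbc⟩ hanchor hsmul hproj

/-- A fully faithful morphism from a stack to a classifying stack is essentially surjective if it
is locally so. -/
theorem IsStack.essSurjOnFibers {D : BasedCategory.{v₁, u₁} CGTop.{u}} (hD : IsStack D)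
    {K : TopGroupoid.{u}} (F : D ⥤ᵇ K.B) [F.toFunctor.Full] [F.toFunctor.Faithful]
    (h : ∀ E : K.B.obj, ∃ (ι : Type u) (V : ι → CGTop.{u}) (σ : ∀ i, V i ⟶ K.B.p.obj E),
      IsOpenCover σ ∧ ∀ i, ∃ (d : D.obj) (θ : F.obj d ⟶ E), K.B.p.IsHomLift (σ i) θ) :
    F.EssSurjOnFibers := by
  intro E
  obtain ⟨ι, V, σ, hσ, hloc⟩ := h E
  obtain ⟨A, θ, hθ, hA⟩ := K.isFiberedInGroupoids_B.exists_descentDatum F (Sieve.ofArrows V σ) E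
    fun s => by
      obtain ⟨i, r, hr⟩ := (Sieve.mem_ofArrows_iff _ _ _).1 s.property
      obtain ⟨d, θ, hθ⟩ := hloc i
      have hd : D.p.obj d = V i := (F.w_obj d).symm.trans (IsHomLift.domain_eq K.B.p (σ i) θ)
      obtain ⟨d', φ, hφ⟩ := hD.1.exists_lift hd r
      refine ⟨d', F.map φ ≫ θ, isHomLift_congr (f := r ≫ σ i) inferInstance hr.symm⟩
  have := hD.2 _ ι V σ hσ
  -- The stack condition extends the descent datum to all of `CGTop/T`; the glued object of `D` is
  -- the value of `a` at the identity of `T`.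
  let a := (precomp (sieveInclusion (Sieve.ofArrows V σ)) D).objPreimage A
  let i : (sieveInclusion (Sieve.ofArrows V σ)).comp a ≅ A :=
    (precomp (sieveInclusion (Sieve.ofArrows V σ)) D).objObjPreimageIso A
  let t : (K.B.p.obj E).underline.obj := underline.mk (𝟙 _)
  let m : ∀ s, (sieveInclusion (Sieve.ofArrows V σ)).obj s ⟶ t := fun s =>
    underline.homMk s.obj.hom (Category.comp_id s.obj.hom)
  have hm : ∀ s, (K.B.p.obj E).underline.p.IsHomLift s.obj.hom (m s) := fun s =>
    IsHomLift.map (K.B.p.obj E).underline.p (m s)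
  have hi := fun s => i.hom.isHomLift' s
  have ht : K.B.p.obj (F.obj (a.obj t)) = K.B.p.obj E := (F.w_obj _).trans (a.w_obj t)
  -- Only morphisms are glued on the side of the classifying stack, so its own descent for objects
  -- is not needed. The result lies over an identity, hence is invertible.
  obtain ⟨b, hb⟩ := BObj.exists_glue hσ ht rfl
    (((sieveInclusion (Sieve.ofArrows V σ)).comp a).comp F)
    (fun s => F.map (a.map (m s))) (fun s => F.map (i.hom.toNatTrans.app s) ≫ θ s)
    (fun s => (F.isHomLift_iff _ _).2 ((a.isHomLift_iff _ _).2 (hm s)))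
    (fun s => by
      refine isHomLift_congr (f := 𝟙 s.obj.left ≫ s.obj.hom) ?_ (Category.id_comp _)
      exact @IsHomLift.comp _ _ _ _ K.B.p _ _ _ _ _ _ _ _ _ _
        ((F.isHomLift_iff _ _).2 (hi s)) (hθ s))
    (fun {s s'} φ => by
      change F.map (a.map _) ≫ F.map (a.map _) = _
      rw [← F.map_comp, ← a.map_comp]
      exact congrArg (fun f => F.map (a.map f))
        (underline.map_injective (Over.w φ.hom)))
    (fun {s s'} φ => by
      change F.map (((sieveInclusion (Sieve.ofArrows V σ)).comp a).map φ) ≫ F.map _ ≫ _ = _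
      rw [← Category.assoc, ← F.map_comp, i.hom.naturality, F.map_comp, Category.assoc, hA]
      rfl)
  have := K.isFiberedInGroupoids_B.isIso b hb
  exact ⟨a.obj t, asIso b, hb⟩

/-! ### Morphisms of classifying stacks as functors between principal bundles -/

namespace BObj

variable {H : TopGroupoid.{u}}

/-- The principal bundle underlying an object of `BH` whose base is known to be a given space. -/
def bundleTo (P : BObj H) {T : CGTop.{u}} (h : P.base = T) : PrincipalBundle H T where
  -- Only the projection is transported along `h`. The total space, anchor and action stay the same
  -- terms, so the comparison with `P` is the identity map.
  total := P.bundle.total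
  proj := P.projTo h
  anchor := P.bundle.anchor
  act := P.bundle.act
  anchor_act := P.bundle.anchor_act
  act_unit := P.bundle.act_unit
  act_act := P.bundle.act_act
  proj_act z := congrArg (Hom.toMap (eqToHom h)) (P.bundle.proj_act z)
  proj_local := by
    subst h
    exact P.bundle.proj_local
  shear := by
    subst h
    exact P.bundle.shear

/-- The identity of the total space as a morphism from the bundle `P.bundleTo h`. -/
def bundleToHom (P : BObj H) {T : CGTop.{u}} (h : P.base = T) :
    (⟨T, P.bundleTo h⟩ : BObj H) ⟶ P where
  base := eqToHom h.symm
  map := ContinuousMap.id _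
  anchor_map _ := rfl
  map_act _ _ _ := rfl
  proj_map p := by
    subst h
    rfl

/-- The identity of the total space as a morphism to the bundle `P.bundleTo h`. -/
def bundleToInv (P : BObj H) {T : CGTop.{u}} (h : P.base = T) :
    P ⟶ (⟨T, P.bundleTo h⟩ : BObj H) where
  base := eqToHom h
  map := ContinuousMap.id _
  anchor_map _ := rfl
  map_act _ _ _ := rfl
  proj_map _ := rfl

theorem bundleToHom_inv (P : BObj H) {T : CGTop.{u}} (h : P.base = T) :
    P.bundleToHom h ≫ P.bundleToInv h = 𝟙 _ := Hom.ext_map fun _ => rfl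

theorem bundleToInv_hom (P : BObj H) {T : CGTop.{u}} (h : P.base = T) :
    P.bundleToInv h ≫ P.bundleToHom h = 𝟙 _ := Hom.ext_map fun _ => rfl

end BObj

namespace BundleFunctor

variable {G H : TopGroupoid.{u}} (F : G.B ⥤ᵇ H.B)

/-- The value of a morphism of classifying stacks on a principal bundle. -/
def value (M : BObj G) : BObj H := F.obj M

/-- The value of a morphism of classifying stacks on a morphism of principal bundles. -/
def valueMap {M N : BObj G} (a : M ⟶ N) : value F M ⟶ value F N :=
  F.map (X := M) (Y := N) a

theorem isHomLift_valueMap {M N : BObj G} (a : M ⟶ N) :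
    Functor.IsHomLift H.B.p (a := value F M) (b := value F N) a.base (valueMap F a) :=
  (F.isHomLift_iff (a := M) (b := N) a.base a).2 ((G.isHomLift_B_iff a.base a).2 rfl)

/-- The functor between principal bundles underlying a morphism of classifying stacks. -/
def ofBased : BundleFunctor G H where
  obj M := (value F M).bundleTo (F.w_obj M)
  map a := (valueMap F a).map
  anchor_map a p := (valueMap F a).anchor_map p
  map_smul a p γ h := (valueMap F a).map_act p γ h
  proj_map {M N} a p := projTo_map (isHomLift_valueMap F a) (F.w_obj M) (F.w_obj N) p
  map_id M p := congrArg (fun b : value F M ⟶ value F M => b.map p) (F.map_id M)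
  map_comp {M N O} a b p := congrArg (fun b : value F M ⟶ value F O => b.map p)
    (F.map_comp (X := M) (Y := N) (Z := O) a b)

/-- The comparison of a morphism of classifying stacks with the underlying functor. -/
def ofBasedHom (M : G.B.obj) :
    @Quiver.Hom H.B.obj _ ((ofBased F).bobj M) (F.obj M) :=
  (value F M).bundleToHom (F.w_obj M)

/-- The inverse of `ofBasedHom`. -/
def ofBasedInv (M : G.B.obj) :
    @Quiver.Hom H.B.obj _ (F.obj M) ((ofBased F).bobj M) :=
  (value F M).bundleToInv (F.w_obj M)

theorem ofBasedHom_inv (M : G.B.obj) : ofBasedHom F M ≫ ofBasedInv F M = 𝟙 _ :=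
  bundleToHom_inv _ _

theorem ofBasedInv_hom (M : G.B.obj) : ofBasedInv F M ≫ ofBasedHom F M = 𝟙 _ :=
  bundleToInv_hom _ _

theorem ofBasedHom_naturality {M N : G.B.obj} (a : M ⟶ N) :
    @CategoryStruct.comp H.B.obj _ _ _ _ ((ofBased F).hom a) (ofBasedHom F N) =
      ofBasedHom F M ≫ F.map a :=
  Hom.ext_map (P := (ofBased F).bobj M) (Q := value F N) fun _ => rfl

end BundleFunctor

theorem IsEquivalentOver.exists_isEquivalence {A : BasedCategory.{v₁, u₁} CGTop.{u}}
    {B : BasedCategory.{v₂, u₂} CGTop.{u}} (h : IsEquivalentOver A B) :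
    ∃ (F : A ⥤ᵇ B) (E : B ⥤ᵇ A) (_ : E.comp F ≅ BasedFunctor.id B),
      F.toFunctor.IsEquivalence ∧ E.toFunctor.IsEquivalence := by
  obtain ⟨F, E, ⟨η⟩, ⟨ε⟩⟩ := h
  have η' : F.toFunctor ⋙ E.toFunctor ≅ 𝟭 _ := (BasedNatTrans.forgetful A A).mapIso η
  have ε' : E.toFunctor ⋙ F.toFunctor ≅ 𝟭 _ := (BasedNatTrans.forgetful B B).mapIso ε
  exact ⟨F, E, ε, .mk' E.toFunctor η'.symm ε', .mk' F.toFunctor ε'.symm η'⟩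

/-! ### The 2-fibre product with a space as a slice -/

/-- The chases are stated in an abstract category so that they apply to `H.B.obj` and `BObj H`,
which agree only after unfolding. -/
theorem comp_comp_eq_of_square {C : Type u₁} [Category.{v₁} C] {a a' b b' c : C} {m : a ⟶ b}
    {l' : b ⟶ b'} {l : a ⟶ a'} {n : a' ⟶ b'} {s' : b' ⟶ c} {s : a' ⟶ c} (h : m ≫ l' = l ≫ n)
    (h' : n ≫ s' = s) : m ≫ l' ≫ s' = l ≫ s := by
  rw [← Category.assoc, h, Category.assoc, h']

theorem comp_eq_of_comp_comp_eq {C : Type u₁} [Category.{v₁} C] {a a' b b' c : C} {m : a ⟶ b}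
    {l' : b ⟶ b'} {l : a ⟶ a'} {n : a' ⟶ b'} {s' : b' ⟶ c} {s : a' ⟶ c} {k : a' ⟶ a}
    (h : m ≫ l' = l ≫ n) (hk : k ≫ l = 𝟙 _) (h' : m ≫ l' ≫ s' = l ≫ s) : n ≫ s' = s := by
  rw [← Category.assoc, h, Category.assoc] at h'
  rw [← Category.id_comp s, ← hk, Category.assoc, ← h', ← Category.assoc, hk, Category.id_comp]

theorem IsHomLift.unique {C : Type u₁} {D : Type u₂} [Category.{v₁} C] [Category.{v₂} D]
    {p : D ⥤ C} {R S : C} {r r' : R ⟶ S} {a b : D} {φ : a ⟶ b} (h : p.IsHomLift r φ)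
    (h' : p.IsHomLift r' φ) : r = r' :=
  (IsHomLift.fac p r φ).trans (IsHomLift.fac p r' φ).symm

theorem IsHomLift.exists_isHomLift {C : Type u₁} {D : Type u₂} [Category.{v₁} C]
    [Category.{v₂} D] (p : D ⥤ C) {R S : C} {a b : D} (φ : a ⟶ b) (ha : p.obj a = R)
    (hb : p.obj b = S) : ∃ r : R ⟶ S, p.IsHomLift r φ := by
  subst ha hb
  exact ⟨_, IsHomLift.map p φ⟩

namespace underline

variable {U : CGTop.{u}}

/-- The morphism to the terminal object of `CGTop/U`. -/
def toTop (z : U.underline.obj) : z ⟶ mk (𝟙 U) := homMk (hom z) (Category.comp_id _)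

theorem comp_toTop {z z' : U.underline.obj} (b : z ⟶ z') : b ≫ toTop z' = toTop z :=
  map_injective (map_comp_hom b)

theorem isHomLift_toTop {T : CGTop.{u}} (r : T ⟶ U) :
    U.underline.p.IsHomLift r (toTop (mk r)) :=
  IsHomLift.map U.underline.p (toTop (mk r))

end underline

namespace BundleFunctor.Slice

variable {G H : TopGroupoid.{u}} {L : BundleFunctor G H} {Q : BObj H}

variable (L Q) in
/-- The projection from the slice. -/
def proj : L.slice Q ⥤ᵇ G.B where
  obj A := A.left
  map φ := φ.left
  map_id _ := rfl
  map_comp _ _ := rfl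
  w := rfl

end BundleFunctor.Slice

namespace fiberProduct

variable {X : BasedCategory.{v₁, u₁} CGTop.{u}} {Y : BasedCategory.{v₂, u₂} CGTop.{u}}
  {f : X ⥤ᵇ Y} {U : CGTop.{u}} {q : U.underline ⥤ᵇ Y}

section Structure

variable (A : FiberProductObj f q)

/-- The morphism to the value of `q` at the terminal object. -/
def str : f.obj A.x ⟶ q.obj (underline.mk (𝟙 U)) := A.α ≫ q.map (underline.toTop A.z)

theorem map_comp_str {A B : FiberProductObj f q} (φ : A ⟶ B) : f.map φ.a ≫ str B = str A := by
  rw [str, ← Category.assoc, φ.comm, Category.assoc, ← q.map_comp, underline.comp_toTop]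
  rfl

/-- The fibres of `CGTop/U` are discrete, so the component in `U` is determined by its base map. -/
theorem hom_ext {A B : FiberProductObj f q} {φ ψ : A ⟶ B} (h : φ.a = ψ.a) : φ = ψ :=
  FiberProductObj.Hom.ext h (underline.hom_subsingleton φ.isHomLift (by rw [h]; exact ψ.isHomLift))

/-- An object of the 2-fibre product is encoded by `x` and `str`: the map to `U` is the base map of
`str`, and the 2-cell is recovered by Cartesian factorisation. Compatibility with `str` is therefore
enough for a morphism. -/
theorem exists_hom (hY : IsFiberedInGroupoids Y) {A B : FiberProductObj f q} (a : A.x ⟶ B.x)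
    (h : f.map a ≫ str B = str A) : ∃ φ : A ⟶ B, φ.a = a := by
  obtain ⟨r, hr⟩ := IsHomLift.exists_isHomLift U.underline.p (underline.toTop A.z)
    A.base_eq.symm rfl
  obtain ⟨r', hr'⟩ := IsHomLift.exists_isHomLift U.underline.p (underline.toTop B.z)
    B.base_eq.symm rfl
  have hA := A.isHomLift
  have hB := B.isHomLift
  have h1 : Y.p.IsHomLift (𝟙 (X.p.obj A.x) ≫ r) (str A) := by
    rw [str]
    infer_instance
  have h2 : Y.p.IsHomLift (X.p.map a ≫ 𝟙 (X.p.obj B.x) ≫ r') (str A) := by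
    rw [← h, str]
    infer_instance
  rw [Category.id_comp] at h1 h2
  -- Both maps to `U` are the base map of `str A`, so `a` lies over a map of spaces over `U`.
  have e := IsHomLift.unique h1 h2
  obtain ⟨b, hb, hb'⟩ := (underline.isFiberedInGroupoids U).exists_factor hr'
    (φ' := underline.toTop A.z) (e ▸ hr)
  refine ⟨⟨a, b, hb, hY.hom_ext (q.map (underline.toTop B.z)) (g := X.p.map a) ?_ ?_ ?_⟩, rfl⟩
  · exact isHomLift_congr (f := X.p.map a ≫ 𝟙 _) inferInstance (Category.comp_id _)
  · exact isHomLift_congr (f := 𝟙 _ ≫ X.p.map a) inferInstance (Category.id_comp _)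
  · rw [Category.assoc, Category.assoc, ← q.map_comp, hb']
    exact h

/-- Take for `z` the base map of `β`; then `β` factors over the identity through the image under `q`
of the Cartesian arrow from `z` to the terminal object. -/
theorem exists_obj (hY : IsFiberedInGroupoids Y) (x : X.obj)
    (β : f.obj x ⟶ q.obj (underline.mk (𝟙 U))) :
    ∃ (z : U.underline.obj) (_ : X.p.obj x = U.underline.p.obj z) (α : f.obj x ⟶ q.obj z),
      Y.p.IsHomLift (𝟙 (X.p.obj x)) α ∧ α ≫ q.map (underline.toTop z) = β := by
  obtain ⟨r, hr⟩ := IsHomLift.exists_isHomLift Y.p β (f.w_obj x) (q.w_obj _)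
  obtain ⟨α, hα, hα'⟩ := hY.exists_factor (g := 𝟙 (X.p.obj x))
    ((q.isHomLift_iff r _).2 (underline.isHomLift_toTop r)) (φ' := β) (by rwa [Category.id_comp])
  exact ⟨underline.mk r, rfl, α, hα, hα'⟩

end Structure

variable {G H : TopGroupoid.{u}} (F : G.B ⥤ᵇ X) (E : X ⥤ᵇ G.B) (ε : E.comp F ≅ BasedFunctor.id X)
  (F' : Y ⥤ᵇ H.B)

variable (f) in
/-- The functor between principal bundles given by a morphism of topological stacks. -/
abbrev bundleFunctor : BundleFunctor G H := ofBased ((F.comp f).comp F')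

variable (q) in
/-- The principal bundle on `U` given by a morphism to a topological stack. -/
abbrev target : BObj H := F'.obj (q.obj (underline.mk (𝟙 U)))

/-- The components of the counit of an equivalence. -/
def counit (x : X.obj) : F.obj (E.obj x) ⟶ x := ε.hom.toNatTrans.app x

theorem counit_naturality {x y : X.obj} (a : x ⟶ y) :
    F.map (E.map a) ≫ counit F E ε y = counit F E ε x ≫ a := ε.hom.naturality a

theorem isHomLift_counit (x : X.obj) : X.p.IsHomLift (𝟙 (X.p.obj x)) (counit F E ε x) :=
  ε.hom.isHomLift' x

instance (x : X.obj) : IsIso (counit F E ε x) :=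
  ⟨ε.inv.toNatTrans.app x, BasedCategory.congr_app ε.hom_inv_id x,
    BasedCategory.congr_app ε.inv_hom_id x⟩

/-- The structure morphism of the object of the slice given by an object of the fibre product. -/
def toSliceStr (A : FiberProductObj f q) :
    @Quiver.Hom H.B.obj _ ((bundleFunctor f F F').bobj (E.obj A.x)) (target q F') :=
  ofBasedHom ((F.comp f).comp F') (E.obj A.x) ≫ F'.map (f.map (counit F E ε A.x) ≫ str A)

theorem map_map_comp_str {A B : FiberProductObj f q} (a : A.x ⟶ B.x) :
    f.map (F.map (E.map a)) ≫ f.map (counit F E ε B.x) ≫ str B = 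
      f.map (counit F E ε A.x) ≫ f.map a ≫ str B := by
  rw [← Category.assoc, ← f.map_comp, counit_naturality, f.map_comp, Category.assoc]

/-- The functor from the 2-fibre product to the slice. -/
def toSlice : fiberProduct f q ⥤ᵇ (bundleFunctor f F F').slice (target q F') where
  obj A := ⟨E.obj A.x, toSliceStr F E ε F' A⟩
  map φ := ⟨E.map φ.a, comp_comp_eq_of_square (C := H.B.obj)
    (ofBasedHom_naturality ((F.comp f).comp F') (E.map φ.a))
      ((F'.map_comp _ _).symm.trans (congrArg F'.map ((map_map_comp_str F E ε φ.a).trans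
        (congrArg _ (map_comp_str φ)))))⟩
  map_id A := Slice.Hom.ext (E.map_id A.x)
  map_comp φ ψ := Slice.Hom.ext (E.map_comp φ.a ψ.a)
  w := congrArg (fun T => (fst f q).toFunctor ⋙ T) E.w

instance [E.toFunctor.Faithful] : (toSlice (f := f) (q := q) F E ε F').toFunctor.Faithful :=
  ⟨fun h => hom_ext (E.toFunctor.map_injective (congrArg Slice.Hom.left h))⟩

theorem toSlice_full (hY : IsFiberedInGroupoids Y) [E.toFunctor.Full] [F'.toFunctor.Faithful] :
    (toSlice (f := f) (q := q) F E ε F').toFunctor.Full := by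
  refine ⟨fun {A B} m => ?_⟩
  obtain ⟨a, ha⟩ := E.toFunctor.map_surjective (X := A.x) (Y := B.x) (Slice.Hom.left m)
  have h1 := comp_eq_of_comp_comp_eq (C := H.B.obj)
    (ofBasedHom_naturality ((F.comp f).comp F') (E.map a)) (ofBasedInv_hom _ _)
    ((congrArg (fun b : E.obj A.x ⟶ E.obj B.x => @CategoryStruct.comp H.B.obj _ _ _ _
      ((bundleFunctor f F F').hom b) (toSliceStr F E ε F' B)) ha).trans (Slice.Hom.w m))
  have h2 := F'.toFunctor.map_injective ((F'.map_comp _ _).trans h1)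
  have h3 := (map_map_comp_str F E ε a).symm.trans h2
  obtain ⟨φ, rfl⟩ := exists_hom hY a ((cancel_epi (f.map (counit F E ε A.x))).1 h3)
  exact ⟨φ, Slice.Hom.ext ha⟩

/-- For a bundle `M` with structure map, take the object `F M` of `X`, and as its arrow to `q` at
the terminal object a preimage under `F'` of that structure map. The comparison with `M` is a
preimage under `F` of the counit. -/
theorem exists_toSlice_hom (hY : IsFiberedInGroupoids Y) [F.toFunctor.Full]
    [F'.toFunctor.Full] (A : (bundleFunctor f F F').Slice (target q F')) :
    ∃ (d : FiberProductObj f q) (θ : (toSlice F E ε F').obj d ⟶ A),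
      ((bundleFunctor f F F').slice (target q F')).p.IsHomLift (𝟙 A.left.base) θ := by
  let M : G.B.obj := A.left
  obtain ⟨β, hβ⟩ := F'.toFunctor.map_surjective (X := f.obj (F.obj M))
    (Y := q.obj (underline.mk (𝟙 U))) (ofBasedInv ((F.comp f).comp F') M ≫ A.str)
  obtain ⟨z, hz, α, hα, hα'⟩ := exists_obj hY (F.obj M) β
  let d : FiberProductObj f q := ⟨F.obj M, z, hz, α, hα⟩
  have hd : str d = β := hα'
  obtain ⟨a, ha⟩ := F.toFunctor.map_surjective (X := E.obj (F.obj M)) (Y := M)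
    (counit F E ε (F.obj M))
  have hA : ofBasedHom ((F.comp f).comp F') M ≫ F'.map β = A.str := by
    refine (congrArg _ hβ).trans ((Category.assoc _ _ _).symm.trans ?_)
    exact (congrArg (fun b => b ≫ _) (ofBasedHom_inv _ M)).trans (Category.id_comp _)
  have hw := comp_comp_eq_of_square (C := H.B.obj)
    (ofBasedHom_naturality ((F.comp f).comp F') a)
    (s' := F'.map β) (s := F'.map (f.map (counit F E ε d.x) ≫ str d))
    ((F'.map_comp _ _).symm.trans (congrArg F'.map (by
      rw [hd]
      exact congrArg (fun b => f.map b ≫ β) ha)))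
  refine ⟨d, ⟨a, (congrArg (fun b => @CategoryStruct.comp H.B.obj _ _ _ _
    ((bundleFunctor f F F').hom a) b) hA.symm).trans hw⟩, ?_⟩
  refine ((Slice.proj (bundleFunctor f F F') (target q F')).isHomLift_iff _ _).1
    ((F.isHomLift_iff _ _).1 ?_)
  have h := isHomLift_counit F E ε (F.obj M)
  rw [← ha] at h
  exact isHomLift_id_congr h (F.w_obj M)

end fiberProduct

/-- The 2-fibre product of topological stacks over a space is presented by the groupoid of a
slice. -/
theorem exists_sliceGroupoid_isEquivalentOver {X : BasedCategory.{v₁, u₁} CGTop.{u}}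
    {Y : BasedCategory.{v₂, u₂} CGTop.{u}} (hX : IsStack X) (hY : IsTopologicalStack Y)
    {G : TopGroupoid.{u}} (hG : IsEquivalentOver G.B X) (f : X ⥤ᵇ Y) {U : CGTop.{u}}
    (q : U.underline ⥤ᵇ Y) :
    ∃ (H : TopGroupoid.{u}) (L : BundleFunctor G H) (Q : BObj H) (S : EtaleSection Q),
      IsEquivalentOver (L.sliceGroupoid S).B (fiberProduct f q) := by
  obtain ⟨hY, H, hH⟩ := hY
  obtain ⟨F, E, ε, hF, hE⟩ := hG.exists_isEquivalence
  obtain ⟨-, F', -, -, hF'⟩ := hH.exists_isEquivalence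
  let L := fiberProduct.bundleFunctor f F F'
  let Q := fiberProduct.target q F'
  obtain ⟨S⟩ := EtaleSection.nonempty Q
  refine ⟨H, L, Q, S, IsEquivalentOver.symm ?_⟩
  let N : fiberProduct f q ⥤ᵇ L.slice Q := fiberProduct.toSlice F E ε F'
  have hN : N.toFunctor.Full := fiberProduct.toSlice_full F E ε F' hY.1
  have hN' : N.toFunctor.Faithful := inferInstanceAs
    (fiberProduct.toSlice (f := f) (q := q) F E ε F').toFunctor.Faithful
  -- Descent is applied to the composite because the slice itself has not been shown to be a stack.
  let Ψ := N.comp (sliceFunctor S)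
  have h₁ : Ψ.toFunctor.Full := inferInstanceAs (N.toFunctor ⋙ (sliceFunctor S).toFunctor).Full
  have h₂ : Ψ.toFunctor.Faithful :=
    inferInstanceAs (N.toFunctor ⋙ (sliceFunctor S).toFunctor).Faithful
  refine Ψ.isEquivalentOver ((hX.fiberProduct hY (underline.isStack U) f q).essSurjOnFibers Ψ
    fun T => ?_)
  let T' : BObj (L.sliceGroupoid S) := T
  -- Over each open set carrying a local section, the bundle is the restriction of one coming from
  -- the slice, hence from the 2-fibre product.
  choose V hV hxV s hs using T'.bundle.proj_local
  refine ⟨T'.base, fun x => CGTop.opens _ (V x) (hV x), fun x => CGTop.opensι _ (V x) (hV x),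
    ⟨fun x => CGTop.isOpenEmbedding_opensι _ _ _, fun x => ⟨x, ⟨x, hxV x⟩, rfl⟩⟩, fun x => ?_⟩
  obtain ⟨A, θ, hθ⟩ := exists_slice_hom T' (V := CGTop.opens _ (V x) (hV x))
    (CGTop.opensι _ (V x) (hV x)) (s x) (hs x)
  obtain ⟨d, θ', hθ'⟩ := fiberProduct.exists_toSlice_hom F E ε F' hY.1 A
  have hA : A.left.base = CGTop.opens _ (V x) (hV x) :=
    @IsHomLift.domain_eq _ _ _ _ (L.sliceGroupoid S).B.p _ _ _ _ _ _ hθ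
  refine ⟨d, (sliceFunctor S).map θ' ≫ θ, ?_⟩
  refine isHomLift_congr (f := 𝟙 _ ≫ _) ?_ (Category.id_comp _)
  exact @IsHomLift.comp _ _ _ _ (L.sliceGroupoid S).B.p _ _ _ _ _ _ _ _ _ _
    (((sliceFunctor S).isHomLift_iff _ _).2 (isHomLift_id_congr hθ' hA)) hθ

/-! ### Lifting homotopies in the groupoid of a slice -/

theorem HasHomotopyLifting.of_homeomorph {T T' : Type*} [TopologicalSpace T] [TopologicalSpace T']
    (e : T ≃ₜ T') {X Y : Type*} [TopologicalSpace X] [TopologicalSpace Y] {f : X → Y}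
    (hf : HasHomotopyLifting T f) : HasHomotopyLifting T' f := by
  intro h g hg
  obtain ⟨H, hH, hH'⟩ := hf ⟨fun z => h (e z.1, z.2), by fun_prop⟩ ⟨fun t => g (e t), by fun_prop⟩
    fun t => hg (e t)
  refine ⟨⟨fun z => H (e.symm z.1, z.2), by fun_prop⟩, fun t => ?_, fun z => ?_⟩
  · exact (hH _).trans (congrArg g (e.apply_symm_apply t))
  · exact (hH' _).trans (congrArg (fun t => h (t, z.2)) (e.apply_symm_apply z.1))

namespace BundleFunctor

variable {G H : TopGroupoid.{u}} {L : BundleFunctor G H} {Q : BObj H} {S : EtaleSection Q}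

/-- Freeness of `Q` recovers `γ` from `sec n' = sec n γ`, and then `p` is `g p'` moved by the
inverse of `γ`. -/
theorem SliceRel.left_unique {w v w' : L.sliceBase S} {g : G.arr} (h : L.SliceRel S w g w')
    (h' : L.SliceRel S v g w') (e : w.snd = v.snd) : w = v := by
  obtain ⟨h₁, γ, h₂, h₃, h₄⟩ := h
  obtain ⟨h₁', γ', h₂', h₃', h₄'⟩ := h'
  have eγ : γ = γ' := smul_left_injective (w.condition.symm.trans h₂)
    ((congrArg (fun n => Q.bundle.anchor (S.sec n)) e).trans (v.condition.symm.trans h₂'))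
    (h₄.symm.trans (h₄'.trans (smul_congr (congrArg S.sec e.symm) rfl _)))
  subst eγ
  refine pullback_ext ?_ e
  refine (smul_inv_smul h₂).symm.trans (Eq.trans ?_ (smul_inv_smul h₂'))
  exact smul_congr (h₃.symm.trans h₃') rfl _

/-- Given an arrow `g` of `G` and a point `w'` of the base over its source, an arrow of the
groupoid of the slice ending at a given point of the étale space. -/
theorem exists_sliceRel_of_lact {T : CGTop.{u}} {w' : T → L.sliceBase S} (hw' : Continuous w')
    {g : T → G.arr} (hg : Continuous g) (h : ∀ t, G.src (g t) = L.P.proj (w' t).fst)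
    {n : T → S.space} (hn : Continuous n) (h' : ∀ t, S.toBase (n t) = S.toBase (w' t).snd) :
    ∃ w : T → L.sliceBase S, Continuous w ∧ (∀ t, (w t).snd = n t) ∧
      ∀ t, L.SliceRel S (w t) (g t) (w' t) := by
  have hp : ∀ t, Q.bundle.proj (S.sec (w' t).snd) = Q.bundle.proj (S.sec (n t)) := fun t => by
    rw [S.proj_sec, S.proj_sec, h']
  -- The arrow from `sec n'` to `sec n` is the inverse of the `γ` sought, so `p` has to be `g p'`
  -- moved by `δ`.
  let δ : T → H.arr := fun t => Q.bundle.div _ _ (hp t)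
  have hδ : Continuous δ := continuous_div
    (S.sec.continuous.comp (CGTop.continuous_snd.comp hw')) (S.sec.continuous.comp hn) hp
  have ha : ∀ t, L.P.anchor (L.lact (g t) (w' t).fst (h t)) = H.tgt (δ t) := fun t =>
    (anchor_lact _).trans ((w' t).condition.trans (anchor_eq_tgt_div (hp t)))
  let p : T → L.P.total := fun t => L.P.smul (L.lact (g t) (w' t).fst (h t)) (δ t) (ha t)
  have hpc : Continuous p := PrincipalBundle.continuous_smul
    (continuous_lact hg (CGTop.continuous_fst.comp hw') h) hδ ha
  have hpa : ∀ t, L.P.anchor (p t) = Q.bundle.anchor (S.sec (n t)) := fun t =>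
    (anchor_smul _).trans (src_div (hp t))
  refine ⟨fun t => pullback.mk (p t) (n t) (hpa t), continuous_pullback_mk hpc hn hpa,
    fun t => rfl, fun t => ?_⟩
  have hi : L.P.anchor (p t) = H.tgt (H.inv (δ t)) := (anchor_smul _).trans (H.tgt_inv _).symm
  refine ⟨h t, H.inv (δ t), hi, (smul_inv_smul (ha t)).symm, ?_⟩
  have hs := smul_div (hp t)
  exact (smul_inv_smul (anchor_eq_tgt_div (hp t))).symm.trans (smul_congr hs rfl _)

/-- The source map of the groupoid of a slice lifts, locally, the homotopies that the source map of
`G` lifts. -/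
theorem exists_restrict_sliceGroupoid_src (r : L.SliceArr S) {O : Set G.arr} {V : Set G.obj}
    (h : Set.MapsTo G.src O V) (hr : r.arr ∈ O) (hO : IsOpen O) (hV : IsOpen V) :
    ∃ (O' : Set (L.SliceArr S)) (V' : Set (L.sliceBase S))
      (h' : Set.MapsTo (L.sliceGroupoid S).src O' V'), r ∈ O' ∧ IsOpen O' ∧ IsOpen V' ∧
        Continuous (h'.restrict _ O' V') ∧ ∀ T : CGTop.{u},
          HasHomotopyLifting T (h.restrict _ O V) → HasHomotopyLifting T (h'.restrict _ O' V') := by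
  obtain ⟨e, hre, he⟩ := S.isLocalHomeomorph r.left.snd
  have hc : Continuous fun w : L.sliceBase S => w.snd := CGTop.continuous_snd
  have hc' : Continuous fun w : L.sliceBase S => w.fst := CGTop.continuous_fst
  -- The neighbourhood restricts `g` to the part of `G` that lifts homotopies and `n` to a chart of
  -- the étale map; the given source point is constrained only through its images in `G.obj` and
  -- `Q.base`.
  let O' : Set (L.SliceArr S) := {k | k.arr ∈ O ∧ k.left.snd ∈ e.source}
  let V' : Set (L.sliceBase S) := {w | L.P.proj w.fst ∈ V ∧ S.toBase w.snd ∈ e.target}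
  have h' : Set.MapsTo (L.sliceGroupoid S).src O' V' := fun k hk => by
    refine ⟨?_, ?_⟩
    · exact k.rel.src ▸ h hk.1
    · refine Set.mem_of_eq_of_mem k.rel.toBase ?_
      rw [he]
      exact e.map_source hk.2
  refine ⟨O', V', h', ⟨hr, hre⟩, (hO.preimage SliceArr.continuous_arr).inter
    (e.open_source.preimage (hc.comp SliceArr.continuous_left)),
    (hV.preimage (L.P.proj.continuous.comp hc')).inter
      (e.open_target.preimage (S.toBase.continuous.comp hc)),
    ((L.sliceGroupoid S).src.continuous.restrict h'), fun T hT F g hg => ?_⟩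
  have hF : Continuous fun z => (F z : L.sliceBase S) := continuous_subtype_val.comp F.continuous
  have hgc : Continuous fun t => (g t : L.SliceArr S) := continuous_subtype_val.comp g.continuous
  have hg' : ∀ t, (g t : L.SliceArr S).right = F (t, 0) := fun t => congrArg Subtype.val (hg t)
  obtain ⟨γ, hγ, hγ'⟩ := hT
    ⟨fun z => ⟨L.P.proj (F z : L.sliceBase S).fst, (F z).2.1⟩,
      (L.P.proj.continuous.comp (hc'.comp hF)).subtype_mk _⟩
    ⟨fun t => ⟨(g t : L.SliceArr S).arr, (g t).2.1⟩,
      (SliceArr.continuous_arr.comp hgc).subtype_mk _⟩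
    fun t => Subtype.ext ((g t : L.SliceArr S).rel.src.trans
      (congrArg (fun w : L.sliceBase S => L.P.proj w.fst) (hg' t)))
  have hγ'' : ∀ z, G.src (γ z) = L.P.proj (F z : L.sliceBase S).fst := fun z =>
    congrArg Subtype.val (hγ' z)
  -- The component in the étale space lifts by inverting the chart `e`; the component in `G` has
  -- been lifted by hypothesis, and together they determine the arrow.
  let n : T × unitInterval → S.space := fun z => e.symm (S.toBase (F z : L.sliceBase S).snd)
  have hn : Continuous n := e.continuousOn_symm.comp_continuous
    (S.toBase.continuous.comp (hc.comp hF)) fun z => (F z).2.2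
  have hn' : ∀ z, S.toBase (n z) = S.toBase (F z : L.sliceBase S).snd := fun z => by
    rw [he]
    exact (e.right_inv (he ▸ (F z).2.2)).trans (he ▸ rfl)
  obtain ⟨w, hw, hwn, hrel⟩ := exists_sliceRel_of_lact (T := ⟨T × unitInterval⟩) hF
    (continuous_subtype_val.comp γ.continuous) hγ'' hn hn'
  refine ⟨⟨fun z => ⟨⟨w z, γ z, F z, hrel z⟩, (γ z).2, ?_⟩,
    (SliceArr.continuous_mk hw (continuous_subtype_val.comp γ.continuous) hF hrel).subtype_mk _⟩,
    fun t => ?_, fun z => rfl⟩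
  · refine Set.mem_of_eq_of_mem (hwn z) (e.map_target (F z).2.2)
  -- At time zero the lift and the prescribed arrow share their `G`-component and their source, and
  -- their étale components lie in the chart over the same point, so `left_unique` makes them equal.
  · have e₁ : (γ (t, 0) : G.arr) = (g t : L.SliceArr S).arr := congrArg Subtype.val (hγ t)
    have e₂ : w (t, 0) = (g t : L.SliceArr S).left := by
      refine (hrel (t, 0)).left_unique ?_ ?_
      · change L.SliceRel S _ (γ (t, 0) : G.arr) _
        rw [e₁, ← hg']
        exact (g t : L.SliceArr S).rel
      refine (hwn _).trans ?_
      change e.symm (S.toBase (F (t, 0) : L.sliceBase S).snd) = _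
      rw [← hg', (g t : L.SliceArr S).rel.toBase, he]
      exact e.left_inv (g t).2.2
    exact Subtype.ext (SliceArr.ext e₂ e₁ (hg' t).symm)

theorem isLocallyHurewiczFibration_sliceGroupoid_src (S : EtaleSection Q)
    (hG : IsLocallyHurewiczFibration G.src) :
    IsLocallyHurewiczFibration (L.sliceGroupoid S).src := fun r => by
  obtain ⟨O, V, h, hr, hO, hV, -, hf⟩ := hG (SliceArr.arr (L := L) (S := S) r)
  obtain ⟨O', V', h', hr', hO', hV', hc, hf'⟩ := exists_restrict_sliceGroupoid_src r h hr
    hO hV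
  exact ⟨O', V', h', hr', hO', hV', hc, fun T => hf' T (hf T)⟩

theorem isLocallySerreFibration_sliceGroupoid_src (S : EtaleSection Q)
    (hG : IsLocallySerreFibration G.src) :
    IsLocallySerreFibration (L.sliceGroupoid S).src := fun r => by
  obtain ⟨O, V, h, hr, hO, hV, -, hf⟩ := hG (SliceArr.arr (L := L) (S := S) r)
  obtain ⟨O', V', h', hr', hO', hV', hc, hf'⟩ := exists_restrict_sliceGroupoid_src r h hr
    hO hV
  -- The cube lives in the lowest universe, so it is lifted to an object of `CGTop` and the result
  -- transported back.
  exact ⟨O', V', h', hr', hO', hV', hc, fun n => .of_homeomorph Homeomorph.ulift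
    (hf' ⟨ULift.{u} (Fin n → unitInterval)⟩ (.of_homeomorph Homeomorph.ulift.symm (hf n)))⟩

end BundleFunctor

theorem mainTheorem4 {X : BasedCategory.{v₁, u₁} CGTop.{u}} {Y : BasedCategory.{v₂, u₂} CGTop.{u}}
    (hX : IsTopologicalStack X) (hY : IsTopologicalStack Y) (f : X ⥤ᵇ Y) :
    (IsSerreStack X → IsSerreMorphism f) ∧ (IsHurewiczStack X → IsHurewiczMorphism f) := by
  refine ⟨fun h U q => ?_, fun h U q => ?_⟩
  · obtain ⟨-, G, hG, hGX⟩ := h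
    obtain ⟨H, L, Q, S, hS⟩ := exists_sliceGroupoid_isEquivalentOver hX.1 hY hGX f q
    exact ⟨⟨hX.1.fiberProduct hY.1 (underline.isStack U) f q, _, hS⟩, _,
      isLocallySerreFibration_sliceGroupoid_src S hG, hS⟩
  · obtain ⟨-, G, hG, hGX⟩ := h
    obtain ⟨H, L, Q, S, hS⟩ := exists_sliceGroupoid_isEquivalentOver hX.1 hY hGX f q
    exact ⟨⟨hX.1.fiberProduct hY.1 (underline.isStack U) f q, _, hS⟩, _,
      isLocallyHurewiczFibration_sliceGroupoid_src S hG, hS⟩
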